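/- Let $\mathbb{G}$ be a Carnot group of dimension $n$ (a connected, simply connected Lie group whose Lie algebra splits as $\mathfrak g=H_1\oplus\dots\oplus H_k$ with $[H_1,H_j]=H_{j+1}$ for $1\le j<k$ and $[H_1,H_k]=0$), written in exponential coordinates of the first kind. Let $X_1,\dots,X_n$ be a left-invariant frame adapted to the stratification, and let $g$ be the left-invariant Riemannian metric that makes it orthonormal. Put $H=H_1$, $V=H_2\oplus\dots\oplus H_k$, let $P_H,P_V$ denote the components of a tangent vector $P$ in $H$, $V$, and let $d$ be the Carnot–Carathéodory distance, i.e. the infimum of the $g$-lengths of piecewise smooth horizontal paths joining two points. The metric normal to a closed set $S$ at $x\in S$ is $\gamma_{\mathcal N}=\{z\in\mathbb{G}: d(x,z)=\inf_{w\in S}d(w,z)\}$. For $x_0\in\mathbb{G}$ and $P_0=\sum_I (P_0)_I X_I(x_0)$ let $\exp_{SR}(x_0,P_0)(t)$ be the value at time $t\ge 0$ of the normal CC-geodesic with these initial data, i.e. of the component $\gamma$ of the solution of $$\dot\gamma=P_H,\qquad \dot P=-C(P_V)P_H,\qquad \gamma(0)=x_0,\quad P(0)=P_0,$$ where $C(P_V)_{IJ}=\sum_{\alpha}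 P_\alpha\langle[X_I,X_J],X_\alpha\rangle$, the sum being over the vertical indices $\alpha$. Let $f:\mathbb{G}\to\mathbb{R}$ be of class $C^2$ and $S=\{f=0\}$. Let $y\in\mathbb{G}$ and $r>0$ be such that the open CC-ball $\{z: d(y,z)<r\}$ is contained in $\{f<0\}$ or in $\{f>0\}$, and the closed CC-ball $\{z: d(y,z)\le r\}$ meets $S$ exactly in one point $x$. Assume that $x$ is non-characteristic, i.e. $df_x$ does not vanish identically on $H_x$. Let $\nu$ be the Riemannian unit normal to $S$ at $x$ pointing out of the ball, that is $\nu=\operatorname{grad} f(x)/|\operatorname{grad} f(x)|$ if the open ball is contained in $\{f<0\}$, and the opposite vector if it is contained in $\{f>0\}$. Put $$\mathcal N(x)=\frac{\nu}{|\nu_H|}=(\nu_{\!H},\varpi).$$ Then the normal CC-geodesic $\gamma(t)=\exp_{SR}(x,-\mathcal N(x))(t)$ exists on $[0,r]$ and joins $\gamma(0)=x$ to the center $\gamma(r)=y$, and $\gamma(t)\in\gamma_{\mathcal N}$ for every $t\in[0,r]$. In particular, the metric normal to $S$ at $x$ exists, in the sense that $\gamma_{\mathcal N}$ does not reduce to the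 point $x$. -/

import Mathlib

open scoped ContDiff ENNReal

noncomputable section

/-- The space `ℝⁿ` of exponential coordinates, with its Euclidean structure. -/
abbrev Coord (n : ℕ) : Type := EuclideanSpace ℝ (Fin n)

/-- A Lie group structure on `ℝⁿ` written in exponential coordinates of the first kind: a smooth
associative multiplication for which every line `t ↦ t • x` is a one-parameter subgroup (so the Lie
group exponential is the identity of `ℝⁿ`).  The last condition makes `0` the identity and `-x` the
inverse of `x`, see `ExpLieGroup.zero_mul`, `ExpLieGroup.mul_zero`, `ExpLieGroup.neg_mul` and
`ExpLieGroup.mul_neg`. -/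
structure ExpLieGroup (n : ℕ) where
  mul : Coord n → Coord n → Coord n
  smooth_mul : ContDiff ℝ ∞ (fun p : Coord n × Coord n => mul p.1 p.2)
  mul_assoc : ∀ x y z : Coord n, mul (mul x y) z = mul x (mul y z)
  mul_smul_smul : ∀ (s t : ℝ) (x : Coord n), mul (s • x) (t • x) = (s + t) • x

namespace ExpLieGroup

variable {n : ℕ} (G : ExpLieGroup n)

theorem zero_mul (x : Coord n) : G.mul 0 x = x := by
  simpa using G.mul_smul_smul 0 1 x

theorem mul_zero (x : Coord n) : G.mul x 0 = x := by
  simpa using G.mul_smul_smul 1 0 x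

theorem mul_neg (x : Coord n) : G.mul x (-x) = 0 := by
  simpa using G.mul_smul_smul 1 (-1) x

theorem neg_mul (x : Coord n) : G.mul (-x) x = 0 := by
  simpa using G.mul_smul_smul (-1) 1 x

/-- The left-invariant vector field with value `v` at the identity:
`x ↦ (L_x)_* v`, the derivative of `y ↦ x • y` at `y = 0` in the direction `v`. -/
def leftField (v x : Coord n) : Coord n := fderiv ℝ (G.mul x) 0 v

/-- The inverse identification `T_x G → T_0 G` by left translation by `x⁻¹ = -x`. Its value on a
tangent vector is the vector of components in the left-invariant frame. -/
def leftTriv (x v : Coord n) : Coord n := fderiv ℝ (G.mul (-x)) x v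

/-- The Lie bracket of the Lie algebra `T_0 G = ℝⁿ`. -/
def bracket (v w : Coord n) : Coord n :=
  VectorField.lieBracket ℝ (G.leftField v) (G.leftField w) 0

/-- The left-invariant Riemannian metric `g` that is the Euclidean inner product on `T_0 G`; the
frame `X_1, …, X_n` of left-invariant fields extending the standard basis is orthonormal. -/
def metric (x v w : Coord n) : ℝ := inner ℝ (G.leftTriv x v) (G.leftTriv x w)

end ExpLieGroup

/-- The `j`-th layer `H_j = span {e_i : ord i = j}` attached to a degree function `ord`. -/
def gradedLayer {n : ℕ} (ord : Fin n → ℕ) (j : ℕ) : Submodule ℝ (Coord n) :=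
  Submodule.span ℝ {v | ∃ i, ord i = j ∧ v = EuclideanSpace.single i 1}

/-- A Carnot group in exponential coordinates with respect to an orthonormal basis of the Lie
algebra adapted to the stratification: `ord i` is the layer of the basis vector `e_i`, and
`[H_1, H_j] = H_{j+1}` for all `j ≥ 1`. As there are finitely many indices, `H_j = 0` for large `j`;
the step is the largest value of `ord`. -/
structure CarnotGroup (n : ℕ) extends ExpLieGroup n where
  ord : Fin n → ℕ
  one_le_ord : ∀ i, 1 ≤ ord i
  stratified : ∀ j, 1 ≤ j →
    Submodule.span ℝ {Z | ∃ X ∈ gradedLayer ord 1, ∃ Y ∈ gradedLayer ord j,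
      Z = toExpLieGroup.bracket X Y} = gradedLayer ord (j + 1)

namespace CarnotGroup

variable {n : ℕ} (G : CarnotGroup n)

/-- The frame `X_1, …, X_n` of left-invariant vector fields. -/
def frame (I : Fin n) (x : Coord n) : Coord n := G.leftField (EuclideanSpace.single I 1) x

/-- The horizontal space `H_x ⊆ T_x G`, spanned by the `X_i(x)` of degree one. -/
def horizontal (x : Coord n) : Submodule ℝ (Coord n) :=
  Submodule.span ℝ {v | ∃ i, G.ord i = 1 ∧ v = G.frame i x}

/-- Horizontal part of a vector given by its components in the frame. -/
def projH (P : Coord n) : Coord n := WithLp.toLp 2 fun I => if G.ord I = 1 then P I else 0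

/-- Structural constants `C^R_{IJ} = ⟨[X_I, X_J], X_R⟩`. -/
def structConst (R I J : Fin n) : ℝ :=
  G.bracket (EuclideanSpace.single I 1) (EuclideanSpace.single J 1) R

/-- The matrix `C(Z_V) = ∑_α Z_α C^α`, the sum being over the vertical indices `α`. -/
def vertMatrix (Z : Coord n) : Matrix (Fin n) (Fin n) ℝ :=
  Matrix.of fun I J => ∑ α with G.ord α ≠ 1, Z α * G.structConst α I J

/-! ### The Carnot–Carathéodory distance -/

/-- `γ` is a piecewise smooth horizontal path on `[0, T]`. -/
def IsHorizontalPath (γ : ℝ → Coord n) (T : ℝ) : Prop :=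
  ∃ (N : ℕ) (τ : ℕ → ℝ), Monotone τ ∧ τ 0 = 0 ∧ τ N = T ∧
    ∀ i < N, ContDiffOn ℝ ∞ γ (Set.Icc (τ i) (τ (i + 1))) ∧
      ∀ t ∈ Set.Ioo (τ i) (τ (i + 1)), deriv γ t ∈ G.horizontal (γ t)

/-- Length of a path on `[0, T]`. -/
def pathLength (γ : ℝ → Coord n) (T : ℝ) : ℝ :=
  ∫ t in (0 : ℝ)..T, Real.sqrt (G.metric (γ t) (deriv γ t) (deriv γ t))

/-- The CC-distance: infimum of the lengths of the piecewise smooth horizontal paths from `p` to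
`q`. It is taken in `[0, ∞]`, so that the infimum of the empty set would be `∞`. -/
def ccDist (p q : Coord n) : ℝ≥0∞ :=
  ⨅ (T : ℝ) (γ : ℝ → Coord n) (_ : G.IsHorizontalPath γ T ∧ γ 0 = p ∧ γ T = q),
    ENNReal.ofReal (G.pathLength γ T)

/-- Open CC-ball. -/
def ccBall (y : Coord n) (r : ℝ) : Set (Coord n) := {z | G.ccDist y z < ENNReal.ofReal r}

/-- Closed CC-ball. -/
def ccClosedBall (y : Coord n) (r : ℝ) : Set (Coord n) := {z | G.ccDist y z ≤ ENNReal.ofReal r}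

/-- The metric normal to `S` at `x`: the points `z` with `d(x, z) = inf_{w ∈ S} d(w, z)`. -/
def metricNormal (S : Set (Coord n)) (x : Coord n) : Set (Coord n) :=
  {z | G.ccDist x z = ⨅ w ∈ S, G.ccDist w z}

/-! ### Normal CC-geodesics and the sub-Riemannian exponential map -/

/-- `γ` together with the momentum `P` (components in the frame) solves on `[0, r]` the normal
CC-geodesic equations `γ' = P_H`, `P' = - C(P_V) P_H` with `γ(0) = x₀`, `P(0) = P₀`. -/
def IsNormalSolution (x₀ P₀ : Coord n) (r : ℝ) (γ P : ℝ → Coord n) : Prop :=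
  γ 0 = x₀ ∧ P 0 = P₀ ∧ ∀ t ∈ Set.Icc 0 r,
    HasDerivWithinAt γ (G.leftField (G.projH (P t)) (γ t)) (Set.Icc 0 r) t ∧
    HasDerivWithinAt P
      (WithLp.toLp 2 (-((G.vertMatrix (P t)).mulVec (G.projH (P t)).ofLp))) (Set.Icc 0 r) t

/-- `γ` is on `[0, r]` the normal CC-geodesic with initial data `γ(0) = x₀`, `P(0) = P₀`. -/
def IsNormalGeodesic (x₀ P₀ : Coord n) (r : ℝ) (γ : ℝ → Coord n) : Prop :=
  ∃ P : ℝ → Coord n, G.IsNormalSolution x₀ P₀ r γ P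

open Classical in
/-- `expSR x₀ P₀ t` is the position at time `t ≥ 0` of the normal CC-geodesic with initial data
`x₀`, `P₀` (and `x₀` if there were no such geodesic on `[0, t]`). -/
def expSR (x₀ P₀ : Coord n) (t : ℝ) : Coord n :=
  if h : ∃ γ : ℝ → Coord n, G.IsNormalGeodesic x₀ P₀ t γ then h.choose t else x₀

/-! ### Hypersurfaces `{f = 0}` -/

/-- The Riemannian gradient of `f` at `x`, by its components `X_I f(x)` in the orthonormal frame. -/
def grad (f : Coord n → ℝ) (x : Coord n) : Coord n :=
  WithLp.toLp 2 fun I => fderiv ℝ f x (G.frame I x)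

/-- `x` is a characteristic point of `{f = 0}`: `H_x ⊆ ker df_x`. -/
def IsCharacteristic (f : Coord n → ℝ) (x : Coord n) : Prop :=
  ∀ v ∈ G.horizontal x, fderiv ℝ f x v = 0

/-- The Riemannian unit normal `ν = grad f / |grad f|` (components in the frame). -/
def unitNormal (f : Coord n → ℝ) (x : Coord n) : Coord n := ‖G.grad f x‖⁻¹ • G.grad f x

/-- `𝒩 = ν / |P_H ν| = (ν_H, ϖ)` (components in the frame), for the unit normal `ν` in the
direction of the gradient of `f`. -/
def normalN (f : Coord n → ℝ) (x : Coord n) : Coord n :=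
  ‖G.projH (G.unitNormal f x)‖⁻¹ • G.unitNormal f x

end CarnotGroup

end

/-!
Rolling a CC-ball into contact with a hypersurface: why the normal geodesic issued from the contact
point runs to the centre of the ball.

Suppose `f < 0` on the open ball of radius `r` about `y` and `f x = 0`, `d(y, x) ≤ r`. The argument
does not use the existence of minimizing geodesics. Instead it works with nearly minimizing
trajectories: for each `ε > 0` there is a smooth horizontal trajectory from `y`, of speed at most
one, that is within `ε` of `x` at the time `r + ε` (`CarnotGroup.exists_nearly_minimizing`).

Let `ℓ` be the right translate to the identity of `df_x`, and call `Ad_g^* ℓ` the momentum of `ℓ` at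
`g`; in the frame it has the components `ℓ (Ad_g e_I)`, and at `x` it is `grad f x`
(`CarnotGroup.momentum_fderiv_eq_grad`). Perturbing the velocity `u` of a trajectory `γ` to `u + s v`
moves its endpoint, measured by `ℓ` after right translation, by `s ∫ ⟨v, (Ad_γ^* ℓ)_H⟩ + O(s²)`.
If `u` were not almost parallel in `L²` to the horizontal momentum `(Ad_γ^* ℓ)_H`, rotating `u`
slightly towards the horizontal momentum, in the plane in `L²` spanned by the two, would produce a
trajectory of length less than `r` whose endpoint has `f > 0`, which is impossible
(`CarnotGroup.exists_forall_variation`). Hence the alignment defect of nearly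
minimizing trajectories tends to zero (`CarnotGroup.exists_forall_alignmentDefect_lt`). The length of
the horizontal momentum changes along `γ` at a rate proportional to `[u, (Ad_γ^* ℓ)_H]`, so it is
almost constant, and the velocity converges in `L¹` to the horizontal momentum divided by
`a = |(grad f x)_H|`, which is positive as `x` is not characteristic
(`CarnotGroup.exists_forall_integral_norm_smul_sub_le`).

The reversed trajectories are therefore approximate integral curves of the vector field
`g ↦ -a⁻¹ (Ad_g^* ℓ)_H`, started near `x`; by Grönwall's inequality they converge to the integral
curve `γ` of that field from `x`, so that `γ r = y` (`CarnotGroup.normal_trajectory_apply_eq`).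
Since `P = -a⁻¹ Ad_γ^* ℓ` satisfies `P' = - C(P_V) P_H` and starts at `-grad f x / a = -𝒩`, the
curve `γ` is the normal geodesic of the statement (`CarnotGroup.isNormalSolution_of_isTrajectory`).
It has unit speed, and the points of `S` have distance at least `r` from `y`, so the triangle
inequality places `γ` in the metric normal (`CarnotGroup.mem_metricNormal_of_isTrajectory`).
-/

noncomputable section

open Set Filter Topology MeasureTheory
open scoped ContDiff ENNReal

namespace ExpLieGroup

variable {n : ℕ} (G : ExpLieGroup n)

/-! ### Calculus on the group -/

theorem contDiff_mul_right (x : Coord n) : ContDiff ℝ ∞ (G.mul x) :=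
  G.smooth_mul.comp (contDiff_const.prodMk contDiff_id)

theorem contDiff_mul_left (x : Coord n) : ContDiff ℝ ∞ (fun z => G.mul z x) :=
  G.smooth_mul.comp (contDiff_id.prodMk contDiff_const)

theorem contDiff_mul_comp {F : Type*} [NormedAddCommGroup F] [NormedSpace ℝ F] {k : ℕ∞}
    {a b : F → Coord n} (ha : ContDiff ℝ k a) (hb : ContDiff ℝ k b) :
    ContDiff ℝ k (fun z => G.mul (a z) (b z)) :=
  (G.smooth_mul.of_le (mod_cast le_top)).comp (ha.prodMk hb)

theorem differentiableAt_mul_right (x z : Coord n) : DifferentiableAt ℝ (G.mul x) z :=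
  (G.contDiff_mul_right x).differentiable (by simp) z

theorem differentiableAt_mul_left (x z : Coord n) : DifferentiableAt ℝ (fun z => G.mul z x) z :=
  (G.contDiff_mul_left x).differentiable (by simp) z

theorem neg_mul_cancel_left (x y : Coord n) : G.mul (-x) (G.mul x y) = y := by
  rw [← G.mul_assoc, G.neg_mul, G.zero_mul]

theorem mul_neg_cancel_left (x y : Coord n) : G.mul x (G.mul (-x) y) = y := by
  rw [← G.mul_assoc, G.mul_neg, G.zero_mul]

theorem mul_neg_cancel_right (x y : Coord n) : G.mul (G.mul x y) (-y) = x := by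
  rw [G.mul_assoc, G.mul_neg, G.mul_zero]

theorem neg_mul_cancel_right (x y : Coord n) : G.mul (G.mul x (-y)) y = x := by
  rw [G.mul_assoc, G.neg_mul, G.mul_zero]

theorem neg_mul_rev (x y : Coord n) : -(G.mul x y) = G.mul (-y) (-x) := by
  have h : G.mul (G.mul x y) (G.mul (-y) (-x)) = 0 := by
    rw [← G.mul_assoc, G.mul_neg_cancel_right, G.mul_neg]
  have := G.neg_mul_cancel_left (G.mul x y) (G.mul (-y) (-x))
  rwa [h, G.mul_zero] at this

/-- The differential at the identity of left translation by `x`, so that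
`leftField v x = leftMap x v`. -/
def leftMap (x : Coord n) : Coord n →L[ℝ] Coord n := fderiv ℝ (G.mul x) 0

theorem leftField_eq (v x : Coord n) : G.leftField v x = G.leftMap x v := rfl

theorem contDiff_leftMap : ContDiff ℝ ∞ G.leftMap :=
  ContDiff.fderiv (m := ∞) (f := G.mul) G.smooth_mul contDiff_const (by simp)

theorem leftMap_zero : G.leftMap 0 = ContinuousLinearMap.id ℝ (Coord n) := by
  have : G.mul 0 = id := funext G.zero_mul
  rw [leftMap, this, fderiv_id]

theorem leftField_zero (v : Coord n) : G.leftField v 0 = v := by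
  simp [leftField_eq, leftMap_zero]

/-- Left-invariant fields are left invariant. -/
theorem fderiv_mul_leftField (g x v : Coord n) :
    fderiv ℝ (G.mul g) x (G.leftField v x) = G.leftField v (G.mul g x) := by
  have h : G.mul (G.mul g x) = G.mul g ∘ G.mul x := funext fun z => G.mul_assoc g x z
  rw [leftField, leftField, h, fderiv_comp _ (G.differentiableAt_mul_right _ _)
    (G.differentiableAt_mul_right _ _), G.mul_zero]
  rfl

theorem leftTriv_leftField (x v : Coord n) : G.leftTriv x (G.leftField v x) = v := by
  rw [leftTriv, fderiv_mul_leftField, G.neg_mul, leftField_zero]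

theorem leftField_leftTriv (x v : Coord n) : G.leftField (G.leftTriv x v) x = v := by
  have h : G.mul x ∘ G.mul (-x) = id := funext fun z => G.mul_neg_cancel_left x z
  have h2 := fderiv_comp x (G.differentiableAt_mul_right x (G.mul (-x) x))
    (G.differentiableAt_mul_right (-x) x)
  rw [h, fderiv_id, G.neg_mul] at h2
  exact (DFunLike.congr_fun h2 v).symm

theorem metric_leftField (x v : Coord n) :
    G.metric x (G.leftField v x) (G.leftField v x) = ‖v‖ ^ 2 := by
  rw [metric, leftTriv_leftField, real_inner_self_eq_norm_sq]

/-- The adjoint representation, the differential at the identity of `w ↦ g w g⁻¹`. -/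
def Ad (g : Coord n) : Coord n →L[ℝ] Coord n :=
  fderiv ℝ (fun w => G.mul (G.mul g w) (-g)) 0

theorem contDiff_conj : ContDiff ℝ ∞
    (Function.uncurry fun g w : Coord n => G.mul (G.mul g w) (-g)) :=
  G.contDiff_mul_comp (k := ⊤) (G.contDiff_mul_comp (k := ⊤) contDiff_fst contDiff_snd)
    contDiff_fst.neg

theorem differentiableAt_conj (g z : Coord n) :
    DifferentiableAt ℝ (fun w => G.mul (G.mul g w) (-g)) z :=
  (G.contDiff_conj.comp (contDiff_const.prodMk contDiff_id : ContDiff ℝ ∞ fun w => (g, w))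
    ).differentiable (by simp) z

theorem contDiff_Ad : ContDiff ℝ ∞ G.Ad :=
  ContDiff.fderiv (m := ∞) (f := fun g w => G.mul (G.mul g w) (-g)) G.contDiff_conj
    contDiff_const (by simp)

theorem Ad_zero : G.Ad 0 = ContinuousLinearMap.id ℝ (Coord n) := by
  have : (fun w => G.mul (G.mul 0 w) (-0)) = id := by
    funext w; simp [G.zero_mul, G.mul_zero]
  rw [Ad, this, fderiv_id]

theorem Ad_mul (g h v : Coord n) : G.Ad (G.mul g h) v = G.Ad g (G.Ad h v) := by
  have e : (fun w => G.mul (G.mul (G.mul g h) w) (-(G.mul g h))) =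
      (fun w => G.mul (G.mul g w) (-g)) ∘ (fun w => G.mul (G.mul h w) (-h)) := by
    funext w; simp only [G.neg_mul_rev, G.mul_assoc, Function.comp]
  rw [Ad, e, fderiv_comp _ (G.differentiableAt_conj _ _) (G.differentiableAt_conj _ _)]
  simp only [G.mul_zero, G.mul_neg]
  rfl

/-- Right translations carry left-invariant fields to left-invariant fields, up to the adjoint
representation. -/
theorem fderiv_mul_left_leftField (η γ a : Coord n) :
    fderiv ℝ (fun z => G.mul z γ) η (G.leftField a η) =
      G.leftField (G.Ad (-γ) a) (G.mul η γ) := by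
  have e : (fun z => G.mul z γ) ∘ G.mul η =
      G.mul (G.mul η γ) ∘ (fun w => G.mul (G.mul (-γ) w) (-(-γ))) := by
    funext w
    simp only [Function.comp, neg_neg, G.mul_assoc, G.mul_neg_cancel_left]
  have h1 := fderiv_comp 0 (G.differentiableAt_mul_left γ (G.mul η 0))
    (G.differentiableAt_mul_right η 0)
  rw [e, fderiv_comp _ (G.differentiableAt_mul_right _ _) (G.differentiableAt_conj _ _)] at h1
  simp only [G.mul_zero, G.mul_neg] at h1
  exact (DFunLike.congr_fun h1 a).symm

theorem fderiv_mul_prod (a b v w : Coord n) :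
    fderiv ℝ (fun p : Coord n × Coord n => G.mul p.1 p.2) (a, b) (v, w) =
      fderiv ℝ (fun z => G.mul z b) a v + fderiv ℝ (G.mul a) b w := by
  have hd : DifferentiableAt ℝ (fun p : Coord n × Coord n => G.mul p.1 p.2) (a, b) :=
    G.smooth_mul.differentiable (by simp) _
  have h1 : HasFDerivAt (fun z : Coord n => (z, b)) (ContinuousLinearMap.inl ℝ _ _) a :=
    hasFDerivAt_prodMk_left a b
  have h2 : HasFDerivAt (fun z : Coord n => (a, z)) (ContinuousLinearMap.inr ℝ _ _) b :=
    hasFDerivAt_prodMk_right a b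
  have e1 := (HasFDerivAt.comp a hd.hasFDerivAt h1).fderiv
  have e2 := (HasFDerivAt.comp b hd.hasFDerivAt h2).fderiv
  have e3 : (v, w) = ContinuousLinearMap.inl ℝ (Coord n) (Coord n) v +
    ContinuousLinearMap.inr ℝ (Coord n) (Coord n) w := by simp
  rw [e3, map_add]
  exact congrArg₂ (· + ·) (DFunLike.congr_fun e1 v).symm (DFunLike.congr_fun e2 w).symm

/-- The differential of the inversion `x ↦ -x` in left-invariant frames. -/
theorem neg_leftField (u g : Coord n) :
    -(G.leftField u g) = G.leftField (-(G.Ad g u)) (-g) := by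
  have hd : DifferentiableAt ℝ (fun p : Coord n × Coord n => G.mul p.1 p.2) (g, -g) :=
    G.smooth_mul.differentiable (by simp) _
  have h1 : HasFDerivAt (fun z : Coord n => (z, -z))
      ((ContinuousLinearMap.id ℝ _).prod (-(ContinuousLinearMap.id ℝ _))) g :=
    (hasFDerivAt_id g).prodMk (hasFDerivAt_id g).neg
  have h2 := (HasFDerivAt.comp g hd.hasFDerivAt h1).fderiv
  have e : (fun p : Coord n × Coord n => G.mul p.1 p.2) ∘ (fun z : Coord n => (z, -z)) =
      fun _ => 0 := funext fun z => G.mul_neg z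
  rw [e] at h2
  have h3 := DFunLike.congr_fun h2 (G.leftField u g)
  simp only [fderiv_fun_const, Pi.zero_apply, _root_.zero_apply,
    ContinuousLinearMap.comp_apply, ContinuousLinearMap.prod_apply,
    _root_.neg_apply, ContinuousLinearMap.id_apply] at h3
  rw [G.fderiv_mul_prod, G.fderiv_mul_left_leftField, neg_neg, G.mul_neg, leftField_zero] at h3
  have h4 : G.leftField (G.leftTriv (-g) (-(G.leftField u g))) (-g) = -(G.leftField u g) :=
    G.leftField_leftTriv _ _
  rw [← h4, G.fderiv_mul_leftField, G.mul_neg, leftField_zero] at h3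
  rw [← h4, eq_neg_of_add_eq_zero_right h3.symm]

/-- Product rule for two curves given by their left-invariant velocities. -/
theorem hasDerivWithinAt_mul {α β : ℝ → Coord n} {a b : Coord n} {s : Set ℝ} {t : ℝ}
    (hα : HasDerivWithinAt α (G.leftField a (α t)) s t)
    (hβ : HasDerivWithinAt β (G.leftField b (β t)) s t) :
    HasDerivWithinAt (fun t => G.mul (α t) (β t))
      (G.leftField (b + G.Ad (-(β t)) a) (G.mul (α t) (β t))) s t := by
  have hd : DifferentiableAt ℝ (fun p : Coord n × Coord n => G.mul p.1 p.2) (α t, β t) :=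
    G.smooth_mul.differentiable (by simp) _
  have h := hd.hasFDerivAt.comp_hasDerivWithinAt t (hα.prodMk hβ)
  rw [G.fderiv_mul_prod, G.fderiv_mul_left_leftField, G.fderiv_mul_leftField, add_comm] at h
  rw [leftField_eq, map_add]
  exact h

/-- The quotient `α β⁻¹` of two curves moves with the transported difference of their
left-invariant velocities. -/
theorem hasDerivWithinAt_mul_neg {α β : ℝ → Coord n} {a b : Coord n} {s : Set ℝ} {t : ℝ}
    (hα : HasDerivWithinAt α (G.leftField a (α t)) s t)
    (hβ : HasDerivWithinAt β (G.leftField b (β t)) s t) :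
    HasDerivWithinAt (fun t => G.mul (α t) (-(β t)))
      (G.leftField (G.Ad (β t) (a - b)) (G.mul (α t) (-(β t)))) s t := by
  have h := hβ.neg
  rw [neg_leftField] at h
  have h2 := G.hasDerivWithinAt_mul hα h
  simp only [Pi.neg_apply, neg_neg] at h2
  rw [map_sub, sub_eq_neg_add]
  exact h2

theorem contDiff_leftField (v : Coord n) : ContDiff ℝ ∞ (G.leftField v) :=
  G.contDiff_leftMap.clm_apply contDiff_const

/-- The differential of the adjoint representation at the identity is the bracket. -/
theorem fderiv_Ad_zero (v w : Coord n) :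
    fderiv ℝ (fun g => G.Ad g w) 0 v = G.bracket v w := by
  set M : Coord n × Coord n → Coord n := fun p => G.mul p.1 p.2 with hM
  have hM2 : ContDiff ℝ ∞ (fderiv ℝ M) := G.smooth_mul.fderiv_right (by simp)
  have hMd : Differentiable ℝ (fderiv ℝ M) := hM2.differentiable (by simp)
  have hsym : ∀ p q, fderiv ℝ (fderiv ℝ M) (0, 0) p q = fderiv ℝ (fderiv ℝ M) (0, 0) q p :=
    fun p q => (G.smooth_mul.contDiffAt.isSymmSndFDerivAt
      (by rw [minSmoothness_of_isRCLikeNormedField]; exact WithTop.coe_le_coe.2 le_top)) p q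
  -- the second derivative of the multiplication, in mixed directions
  have hL : ∀ v w, fderiv ℝ (G.leftField w) 0 v = fderiv ℝ (fderiv ℝ M) (0, 0) (v, 0) (0, w) := by
    intro v w
    have e : G.leftField w = fun g => fderiv ℝ M (g, 0) (0, w) := by
      funext g; rw [hM, G.fderiv_mul_prod]; simp [leftField]
    have h1 : HasFDerivAt (fun z : Coord n => (z, (0 : Coord n)))
      (ContinuousLinearMap.inl ℝ _ _) 0 := hasFDerivAt_prodMk_left _ _
    have h2 := (HasFDerivAt.comp (f := fun z : Coord n => (z, (0 : Coord n))) (0 : Coord n)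
      (hMd (0, 0)).hasFDerivAt h1).clm_apply
      (hasFDerivAt_const ((0 : Coord n), w) (0 : Coord n))
    rw [e]
    have h3 := h2.fderiv
    simp only [Function.comp_def] at h3
    rw [h3]; simp
  have hA : ∀ g, G.Ad g w = fderiv ℝ M (g, -g) (G.leftField w g, 0) := by
    intro g
    rw [hM, G.fderiv_mul_prod, G.fderiv_mul_left_leftField, map_zero, add_zero, neg_neg, G.mul_neg,
      leftField_zero]
  have h1 : HasFDerivAt (fun z : Coord n => (z, -z))
      ((ContinuousLinearMap.id ℝ _).prod (-(ContinuousLinearMap.id ℝ _))) 0 :=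
    (hasFDerivAt_id (0 : Coord n)).prodMk (hasFDerivAt_id (0 : Coord n)).neg
  have h1' : HasFDerivAt (fderiv ℝ M) (fderiv ℝ (fderiv ℝ M) (0, 0)) ((0 : Coord n), -(0 : Coord n)) := by
    rw [neg_zero]; exact (hMd (0, 0)).hasFDerivAt
  have h2 : HasFDerivAt (G.leftField w) (fderiv ℝ (G.leftField w) 0) 0 :=
    ((G.contDiff_leftField w).differentiable (by simp) 0).hasFDerivAt
  have h3 := (HasFDerivAt.comp (0 : Coord n) h1' h1).clm_apply
      (h2.prodMk (hasFDerivAt_const (0 : Coord n) (0 : Coord n)))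
  have h4 := h3.fderiv
  simp only [Function.comp_def] at h4
  have e : (fun g => G.Ad g w) = fun g => fderiv ℝ M (g, -g) (G.leftField w g, 0) := funext hA
  rw [e, h4]
  -- pure second derivatives vanish, as `z ↦ z * 0` is linear
  have hz : fderiv ℝ (fderiv ℝ M) (0, 0) (v, 0) (w, 0) = 0 := by
    have e : (fun g => fderiv ℝ M (g, 0) (w, 0)) = fun _ => w := by
      funext g
      have : (fun z => G.mul z 0) = id := funext G.mul_zero
      rw [hM, G.fderiv_mul_prod, this]; simp
    have h1 : HasFDerivAt (fun z : Coord n => (z, (0 : Coord n)))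
      (ContinuousLinearMap.inl ℝ _ _) 0 := hasFDerivAt_prodMk_left _ _
    have h2 := (HasFDerivAt.comp (f := fun z : Coord n => (z, (0 : Coord n))) (0 : Coord n)
      (hMd (0, 0)).hasFDerivAt h1).clm_apply
      (hasFDerivAt_const (w, (0 : Coord n)) (0 : Coord n))
    have h3 := h2.fderiv
    simp only [Function.comp_def] at h3
    rw [e] at h3
    have := DFunLike.congr_fun h3 v
    simpa using this.symm
  have hs : ((v, -v) : Coord n × Coord n) = (v, 0) - (0, v) := by simp
  have hid : ∀ z : Coord n, fderiv ℝ M (0, 0) (z, 0) = z := by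
    intro z
    have : (fun z => G.mul z 0) = id := funext G.mul_zero
    rw [hM, G.fderiv_mul_prod, this]; simp
  rw [bracket, VectorField.lieBracket, leftField_zero, leftField_zero]
  simp only [_root_.add_apply, ContinuousLinearMap.comp_apply,
    ContinuousLinearMap.flip_apply, ContinuousLinearMap.prod_apply, _root_.neg_apply,
    ContinuousLinearMap.id_apply, _root_.zero_apply, neg_zero, hid, hs, map_sub,
    _root_.sub_apply, hz]
  rw [hL w v, hsym (w, 0)]
  abel

/-- The adjoint representation along a left-invariant direction. -/
theorem fderiv_Ad (g v w : Coord n) :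
    fderiv ℝ (fun g => G.Ad g w) g (G.leftField v g) = G.Ad g (G.bracket v w) := by
  have hd : Differentiable ℝ (fun g => G.Ad g w) :=
    (G.contDiff_Ad.clm_apply contDiff_const).differentiable (by simp)
  have e : (fun g => G.Ad g w) ∘ G.mul g = fun h => G.Ad g (G.Ad h w) :=
    funext fun h => G.Ad_mul g h w
  have h1 := fderiv_comp 0 (hd (G.mul g 0)) (G.differentiableAt_mul_right g 0)
  have h2 := ((G.Ad g).hasFDerivAt.comp (0 : Coord n) (hd 0).hasFDerivAt).fderiv
  simp only [Function.comp_def] at h2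
  rw [e, h2, G.mul_zero] at h1
  have h3 := DFunLike.congr_fun h1 v
  rw [← fderiv_Ad_zero]
  exact h3.symm

theorem hasDerivWithinAt_Ad {γ : ℝ → Coord n} {u : Coord n} {s : Set ℝ} {t : ℝ}
    (hγ : HasDerivWithinAt γ (G.leftField u (γ t)) s t) (w : Coord n) :
    HasDerivWithinAt (fun t => G.Ad (γ t) w) (G.Ad (γ t) (G.bracket u w)) s t := by
  have hd : Differentiable ℝ (fun g => G.Ad g w) :=
    (G.contDiff_Ad.clm_apply contDiff_const).differentiable (by simp)
  have h := (hd (γ t)).hasFDerivAt.comp_hasDerivWithinAt t hγ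
  rwa [fderiv_Ad] at h

/-- The Lie bracket as a bilinear map. -/
def bracketL : Coord n →L[ℝ] Coord n →L[ℝ] Coord n :=
  fderiv ℝ G.Ad 0

theorem bracketL_apply (v w : Coord n) : G.bracketL v w = G.bracket v w := by
  rw [← fderiv_Ad_zero, bracketL]
  have h := ((G.contDiff_Ad.differentiable (by simp) 0).hasFDerivAt.clm_apply
    (hasFDerivAt_const w (0 : Coord n))).fderiv
  rw [h]; simp

theorem bracket_self (v : Coord n) : G.bracket v v = 0 := by
  simp [bracket, VectorField.lieBracket]

theorem bracket_swap (v w : Coord n) : G.bracket v w = -G.bracket w v := by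
  simp [bracket, VectorField.lieBracket]

end ExpLieGroup

/-! ### Differential inequalities and ordinary differential equations -/

/-- Grönwall's inequality with an integrable inhomogeneity `b`, for right derivatives. The
differential inequality is only required as long as the curve stays in the ball of radius `ρ`; the
bound itself guarantees that the curve never leaves it. -/
theorem norm_le_exp_mul_of_norm_deriv_right_le {E : Type*} [NormedAddCommGroup E] [NormedSpace ℝ E]
    {d d' : ℝ → E} {b : ℝ → ℝ} {T L ρ δ : ℝ} (hd : ContinuousOn d (Icc 0 T))
    (hd' : ∀ t ∈ Ico 0 T, HasDerivWithinAt d (d' t) (Ici t) t)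
    (hb : IntervalIntegrable b volume 0 T) (hb0 : ∀ t ∈ Ico 0 T, 0 ≤ b t)
    (hbc : ∀ t ∈ Ico 0 T, ContinuousWithinAt b (Ici t) t) (hL : 0 ≤ L) (hδ : ‖d 0‖ ≤ δ)
    (hbound : ∀ t ∈ Ico 0 T, ‖d t‖ ≤ ρ → ‖d' t‖ ≤ L * ‖d t‖ + b t)
    (hρ : Real.exp (L * T) * (δ + ∫ s in (0 : ℝ)..T, b s) < ρ) :
    ∀ t ∈ Icc 0 T, ‖d t‖ ≤ Real.exp (L * t) * (δ + ∫ s in (0 : ℝ)..t, b s) := by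
  intro t ht
  have hT : 0 ≤ T := ht.1.trans ht.2
  have hδ0 : 0 ≤ δ := (norm_nonneg _).trans hδ
  set I : ℝ → ℝ := fun t => ∫ s in (0 : ℝ)..t, b s with hI
  have hbint : IntegrableOn b (Ioc 0 T) := (intervalIntegrable_iff_integrableOn_Ioc_of_le hT).1 hb
  have hsub : ∀ t ∈ Icc 0 T, IntervalIntegrable b volume 0 t := fun t ht =>
    hb.mono_set (by rw [uIcc_of_le ht.1, uIcc_of_le hT]; exact Icc_subset_Icc_right ht.2)
  have hIc : ContinuousOn I (Icc 0 T) := by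
    have := intervalIntegral.continuousOn_primitive_interval
      (μ := volume) (f := b) (a := 0) (b := T)
      (by rw [uIcc_of_le hT]; exact (integrableOn_Icc_iff_integrableOn_Ioc).2 hbint)
    rwa [uIcc_of_le hT] at this
  have hId : ∀ t ∈ Ico 0 T, HasDerivWithinAt I (b t) (Ici t) t := by
    intro t ht
    refine intervalIntegral.integral_hasDerivWithinAt_right (hsub t ⟨ht.1, ht.2.le⟩)
      (t := Ioi t) ⟨Ioo t T, Ioo_mem_nhdsGT ht.2, ?_⟩ ((hbc t ht).mono Ioi_subset_Ici_self)
    exact (hbint.mono_set fun z hz => ⟨ht.1.trans_lt hz.1, hz.2.le⟩).aestronglyMeasurable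
  have hImono : ∀ t ∈ Icc 0 T, I t ≤ I T := by
    intro t ht
    have h1 : I T - I t = ∫ s in t..T, b s :=
      intervalIntegral.integral_interval_sub_left hb (hsub t ht)
    have h2 : 0 ≤ ∫ s in t..T, b s := by
      rw [intervalIntegral.integral_of_le ht.2, integral_Ioc_eq_integral_Ioo]
      exact setIntegral_nonneg measurableSet_Ioo fun s hs => hb0 s ⟨ht.1.trans hs.1.le, hs.2⟩
    linarith
  have hI0 : ∀ t ∈ Icc 0 T, 0 ≤ I t := by
    intro t ht
    simp only [hI]
    rw [intervalIntegral.integral_of_le ht.1, integral_Ioc_eq_integral_Ioo]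
    exact setIntegral_nonneg measurableSet_Ioo fun s hs => hb0 s ⟨hs.1.le, hs.2.trans_le ht.2⟩
  -- strict barrier functions, for every small slope `κ > 0`
  have key : ∀ᶠ κ in 𝓝[>] (0 : ℝ), ‖d t‖ ≤ Real.exp (L * t) * (δ + I t + κ * t) := by
    have hlim : Tendsto (fun κ : ℝ => Real.exp (L * T) * (δ + I T + κ * T)) (𝓝[>] 0)
        (𝓝 (Real.exp (L * T) * (δ + I T + 0 * T))) :=
      (Continuous.tendsto (by fun_prop) 0).mono_left nhdsWithin_le_nhds
    rw [zero_mul, add_zero] at hlim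
    filter_upwards [hlim.eventually (gt_mem_nhds hρ), self_mem_nhdsWithin] with κ hκ hκ0
    rw [mem_Ioi] at hκ0
    refine image_norm_le_of_norm_deriv_right_lt_deriv_boundary' hd hd'
      (B := fun t => Real.exp (L * t) * (δ + I t + κ * t))
      (B' := fun t => Real.exp (L * t) * L * (δ + I t + κ * t) + Real.exp (L * t) * (b t + κ))
      ?_ ?_ ?_ ?_ ht
    · simpa [hI] using hδ
    · exact (by fun_prop : Continuous fun t => Real.exp (L * t)).continuousOn.mul
        ((continuousOn_const.add hIc).add (by fun_prop))
    · intro x hx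
      have h1 : HasDerivWithinAt (fun t => Real.exp (L * t)) (Real.exp (L * x) * L) (Ici x) x := by
        simpa using (((hasDerivAt_id x).const_mul L).exp).hasDerivWithinAt
      have h2 : HasDerivWithinAt (fun t => δ + I t + κ * t) (b x + κ) (Ici x) x := by
        simpa using! ((hId x hx).const_add δ).add ((hasDerivAt_id x).const_mul κ).hasDerivWithinAt
      exact h1.mul h2
    · intro x hx hxe
      have hx' : x ∈ Icc 0 T := ⟨hx.1, hx.2.le⟩
      have hle : ‖d x‖ ≤ ρ := by
        rw [hxe]
        refine le_trans ?_ hκ.le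
        have := hImono x hx'
        have := hI0 x hx'
        have := hx.2.le
        have := hx.1
        gcongr
      have h1 := hbound x hx hle
      have h2 : 1 ≤ Real.exp (L * x) := Real.one_le_exp (mul_nonneg hL hx.1)
      have h3 := hb0 x hx
      have h4 : b x + κ ≤ Real.exp (L * x) * (b x + κ) := le_mul_of_one_le_left (by linarith) h2
      have h5 : L * ‖d x‖ = Real.exp (L * x) * L * (δ + I x + κ * x) := by rw [hxe]; ring
      linarith
  have hlim : Tendsto (fun κ : ℝ => Real.exp (L * t) * (δ + I t + κ * t)) (𝓝[>] 0)
      (𝓝 (Real.exp (L * t) * (δ + I t + 0 * t))) :=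
    (Continuous.tendsto (by fun_prop) 0).mono_left nhdsWithin_le_nhds
  rw [zero_mul, add_zero] at hlim
  exact ge_of_tendsto hlim key

/-- The equation `z' = B(z) c(t)`, cut off outside a neighbourhood of a compact set `K`, has a
solution on any bounded time interval. -/
theorem exists_cutoff_solution {E F : Type*} [NormedAddCommGroup E] [NormedSpace ℝ E]
    [FiniteDimensional ℝ E] [NormedAddCommGroup F] [NormedSpace ℝ F]
    {B : E → F →L[ℝ] E} (hB : ContDiff ℝ 1 B) {c : ℝ → F} {T : ℝ} (hT : 0 ≤ T)
    (hc : ContinuousOn c (Icc 0 T)) {K : Set E} (hK : IsCompact K) (x₀ : E) :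
    ∃ (χ : E → ℝ) (γ : ℝ → E), (∀ z, 0 ≤ χ z ∧ χ z ≤ 1) ∧ (∀ z ∈ K, χ z = 1) ∧ Continuous χ ∧
      γ 0 = x₀ ∧
      ∀ t ∈ Icc 0 T, HasDerivWithinAt γ (χ (γ t) • B (γ t) (c t)) (Icc 0 T) t := by
  obtain ⟨R, hR⟩ := hK.isBounded.subset_closedBall (0 : E)
  set R' := max R 1
  have hR' : 0 < R' := lt_max_of_lt_right one_pos
  let χ : ContDiffBump (0 : E) := ⟨R', R' + 1, hR', by linarith⟩
  have hχK : ∀ z ∈ K, χ z = 1 := fun z hz => χ.one_of_mem_closedBall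
    (Metric.closedBall_subset_closedBall (le_max_left _ _) (hR hz))
  have hsm : ContDiff ℝ 1 fun z => χ z • B z := χ.contDiff.smul hB
  have hsupp : HasCompactSupport fun z => χ z • B z := χ.hasCompactSupport.smul_right
  obtain ⟨K₁, hK₁⟩ := hsm.lipschitzWith_of_hasCompactSupport hsupp (by simp)
  obtain ⟨C, hC⟩ := hsupp.exists_bound_of_continuous hsm.continuous
  obtain ⟨M, hM⟩ := isCompact_Icc.exists_bound_of_continuousOn hc
  have hM0 : 0 ≤ M := (norm_nonneg _).trans (hM 0 ⟨le_rfl, hT⟩)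
  have hC0 : 0 ≤ C := (norm_nonneg _).trans (hC 0)
  lift M to NNReal using hM0
  lift C to NNReal using hC0
  lift T to NNReal using hT
  have hP : IsPicardLindelof (fun t z => (χ z • B z) (c t)) (tmin := 0) (tmax := (T : ℝ))
      ⟨0, ⟨le_rfl, T.2⟩⟩ x₀ (C * M * T) 0 (C * M) (K₁ * M) := by
    refine ⟨fun t ht => ?_, fun x _ => ?_, fun t ht x _ => ?_, ?_⟩
    · refine LipschitzOnWith.of_dist_le_mul fun z _ w _ => ?_
      rw [dist_eq_norm, ← _root_.sub_apply]
      refine (ContinuousLinearMap.le_opNorm _ _).trans ?_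
      rw [← dist_eq_norm]
      have h1 := hK₁.dist_le_mul z w
      have h2 := hM t ht
      push_cast
      calc _ ≤ (K₁ * dist z w) * M := by gcongr
        _ = _ := by ring
    · exact continuousOn_const.clm_apply hc
    · refine (ContinuousLinearMap.le_opNorm _ _).trans ?_
      have h2 := hM t ht
      push_cast
      gcongr
      exact hC x
    · simp
  obtain ⟨γ, h0, hγ⟩ := hP.exists_eq_forall_mem_Icc_hasDerivWithinAt₀
  exact ⟨χ, γ, fun z => ⟨χ.nonneg, χ.le_one⟩, hχK, χ.continuous, h0, hγ⟩

namespace ExpLieGroup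

variable {n : ℕ} (G : ExpLieGroup n)

/-! ### Trajectories of left-invariant control systems -/

/-- `γ` moves on `[0, T]` with left-invariant velocity `u`. -/
def IsTrajectory (γ u : ℝ → Coord n) (T : ℝ) : Prop :=
  ∀ t ∈ Icc 0 T, HasDerivWithinAt γ (G.leftField (u t) (γ t)) (Icc 0 T) t

/-- `γ` is continuous on `[0, T]` and has there the left-invariant right velocity `u`. This weaker
notion includes piecewise smooth curves. -/
def IsRightTrajectory (γ u : ℝ → Coord n) (T : ℝ) : Prop :=
  ContinuousOn γ (Icc 0 T) ∧
    ∀ t ∈ Ico 0 T, HasDerivWithinAt γ (G.leftField (u t) (γ t)) (Ici t) t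

variable {G} {γ u α v : ℝ → Coord n} {T : ℝ}

theorem IsTrajectory.continuousOn (h : G.IsTrajectory γ u T) : ContinuousOn γ (Icc 0 T) :=
  fun t ht => (h t ht).continuousWithinAt

theorem IsTrajectory.isRightTrajectory (h : G.IsTrajectory γ u T) : G.IsRightTrajectory γ u T :=
  ⟨h.continuousOn, fun t ht => (h t ⟨ht.1, ht.2.le⟩).mono_of_mem_nhdsWithin
    (mem_of_superset (Icc_mem_nhdsGE ht.2) (Icc_subset_Icc_left ht.1))⟩

theorem IsTrajectory.mono (h : G.IsTrajectory γ u T) {S : ℝ} (hS : S ≤ T) :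
    G.IsTrajectory γ u S :=
  fun t ht => (h t ⟨ht.1, ht.2.trans hS⟩).mono (Icc_subset_Icc_right hS)

theorem IsTrajectory.congr_control (h : G.IsTrajectory γ u T) (huv : ∀ t ∈ Icc 0 T, u t = v t) :
    G.IsTrajectory γ v T := fun t ht => huv t ht ▸ h t ht

theorem IsTrajectory.hasDerivAt (h : G.IsTrajectory γ u T) {t : ℝ} (ht : t ∈ Ioo 0 T) :
    HasDerivAt γ (G.leftField (u t) (γ t)) t :=
  (h t (Ioo_subset_Icc_self ht)).hasDerivAt (Icc_mem_nhds ht.1 ht.2)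

theorem IsRightTrajectory.mono (h : G.IsRightTrajectory γ u T) {S : ℝ} (hS : S ≤ T) :
    G.IsRightTrajectory γ u S :=
  ⟨h.1.mono (Icc_subset_Icc_right hS), fun t ht => h.2 t ⟨ht.1, ht.2.trans_le hS⟩⟩

/-- Left translates of trajectories, started at a later time, are trajectories. -/
theorem IsRightTrajectory.mul_left_shift (h : G.IsRightTrajectory γ u T) (g : Coord n) {s : ℝ}
    (hs : 0 ≤ s) :
    G.IsRightTrajectory (fun t => G.mul g (γ (t + s))) (fun t => u (t + s)) (T - s) := by
  constructor
  · refine (G.contDiff_mul_right g).continuous.comp_continuousOn (h.1.comp (by fun_prop) ?_)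
    intro t ht
    exact ⟨by linarith [ht.1], by linarith [ht.2]⟩
  · intro t ht
    have h1 := h.2 (t + s) ⟨by linarith [ht.1], by linarith [ht.2]⟩
    have h2 : HasDerivWithinAt (fun t => t + s) 1 (Ici t) t :=
      ((hasDerivAt_id t).add_const s).hasDerivWithinAt
    have h3 := HasDerivWithinAt.scomp t h1 h2 (fun z hz => by simpa using hz)
    rw [one_smul] at h3
    have h4 := (G.differentiableAt_mul_right g (γ (t + s))).hasFDerivAt.comp_hasDerivWithinAt t h3
    rwa [fderiv_mul_leftField] at h4

/-- Trajectories with bounded velocity, issued from a fixed point, stay in a fixed compact set for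
a bounded time. -/
theorem exists_isCompact_forall_trajectory_mem (G : ExpLieGroup n) (x₀ : Coord n) (M T : ℝ) :
    ∃ K : Set (Coord n), IsCompact K ∧ ∀ (S : ℝ) (γ u : ℝ → Coord n), S ≤ T →
      G.IsRightTrajectory γ u S → γ 0 = x₀ → (∀ t ∈ Ico 0 S, ‖u t‖ ≤ M) →
      ∀ t ∈ Icc 0 S, γ t ∈ K := by
  obtain ⟨C, hC⟩ := (isCompact_closedBall (0 : Coord n) 1).exists_bound_of_continuousOn
    G.contDiff_leftMap.continuous.continuousOn
  have hC0 : 0 ≤ C := (norm_nonneg _).trans (hC 0 (by simp))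
  set τ : ℝ := 1 / (2 * (C * |M| + 1)) with hτ
  have hCM : 0 ≤ C * |M| := by positivity
  have hτ0 : 0 < τ := by positivity
  have hτ1 : C * |M| * τ < 1 := by
    rw [hτ, mul_one_div, div_lt_one (by positivity)]; linarith
  -- a trajectory issued from the identity stays in the unit ball up to time `τ`
  have step : ∀ (S : ℝ) (γ u : ℝ → Coord n), S ≤ τ → G.IsRightTrajectory γ u S → γ 0 = 0 →
      (∀ t ∈ Ico 0 S, ‖u t‖ ≤ M) → ∀ t ∈ Icc 0 S, ‖γ t‖ ≤ 1 := by
    intro S γ u hS hγ h0 hu t ht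
    have hbd := norm_le_exp_mul_of_norm_deriv_right_le (L := 0) (δ := 0) (ρ := 1)
      (b := fun _ => C * |M|) hγ.1 hγ.2 intervalIntegrable_const (fun _ _ => hCM)
      (fun _ _ => continuousWithinAt_const) le_rfl (by simp [h0])
      (fun t ht h1 => by
        rw [MulZeroClass.zero_mul, zero_add, leftField_eq]
        refine (ContinuousLinearMap.le_opNorm _ _).trans ?_
        have := hC (γ t) (by simpa using h1)
        have := (hu t ht).trans (le_abs_self M)
        gcongr)
      (by
        have : C * |M| * S ≤ C * |M| * τ := by gcongr
        simp only [MulZeroClass.zero_mul, Real.exp_zero, one_mul, intervalIntegral.integral_const, smul_eq_mul,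
          zero_add, sub_zero]
        nlinarith) t ht
    simp only [MulZeroClass.zero_mul, Real.exp_zero, one_mul, intervalIntegral.integral_const, smul_eq_mul,
      zero_add, sub_zero] at hbd
    have : C * |M| * t ≤ C * |M| * τ := by have := ht.2.trans hS; gcongr
    nlinarith
  have main : ∀ m : ℕ, ∃ K : Set (Coord n), IsCompact K ∧ ∀ (S : ℝ) (γ u : ℝ → Coord n),
      S ≤ m * τ → G.IsRightTrajectory γ u S → γ 0 = x₀ → (∀ t ∈ Ico 0 S, ‖u t‖ ≤ M) →
      ∀ t ∈ Icc 0 S, γ t ∈ K := by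
    intro m
    induction m with
    | zero =>
      refine ⟨{x₀}, isCompact_singleton, fun S γ u hS _ h0 _ t ht => ?_⟩
      have : t = 0 := le_antisymm (by simpa using ht.2.trans hS) ht.1
      simp [this, h0]
    | succ m ih =>
      obtain ⟨K, hK, hm⟩ := ih
      refine ⟨K ∪ (fun p : Coord n × Coord n => G.mul p.1 p.2) '' (K ×ˢ Metric.closedBall 0 1),
        hK.union ((hK.prod (isCompact_closedBall _ _)).image G.smooth_mul.continuous),
        fun S γ u hS hγ h0 hu t ht => ?_⟩
      have hmτ : 0 ≤ m * τ := by positivity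
      rcases le_total t (m * τ) with h | h
      · exact Or.inl (hm t γ u h (hγ.mono ht.2) h0
          (fun t' ht' => hu t' ⟨ht'.1, ht'.2.trans_le ht.2⟩) t ⟨ht.1, le_rfl⟩)
      · right
        have hmS : m * τ ≤ S := h.trans ht.2
        have h1 := hm (m * τ) γ u le_rfl (hγ.mono hmS) h0
          (fun t' ht' => hu t' ⟨ht'.1, ht'.2.trans_le hmS⟩) (m * τ) ⟨hmτ, le_rfl⟩
        have h2 := step (S - m * τ) _ _ (by push_cast at hS; linarith)
          (hγ.mul_left_shift (-(γ (m * τ))) hmτ) (by simp [G.neg_mul])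
          (fun t' ht' => hu _ ⟨by linarith [ht'.1], by linarith [ht'.2]⟩) (t - m * τ)
          ⟨by linarith, by linarith [ht.2]⟩
        refine ⟨(γ (m * τ), G.mul (-(γ (m * τ))) (γ t)), ⟨h1, ?_⟩, G.mul_neg_cancel_left _ _⟩
        simpa using h2
  obtain ⟨m, hm⟩ := exists_nat_ge (T / τ)
  obtain ⟨K, hK, h⟩ := main m
  exact ⟨K, hK, fun S γ u hS => h S γ u (hS.trans ((div_le_iff₀ hτ0).1 hm))⟩

/-- Global existence of trajectories with a given continuous velocity: a cut-off solution is itself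
a trajectory with smaller velocity, hence stays where the cut-off is inactive. -/
theorem exists_isTrajectory (G : ExpLieGroup n) (x₀ : Coord n) (hT : 0 ≤ T)
    (hu : ContinuousOn u (Icc 0 T)) : ∃ γ, G.IsTrajectory γ u T ∧ γ 0 = x₀ := by
  obtain ⟨M, hM⟩ := isCompact_Icc.exists_bound_of_continuousOn hu
  obtain ⟨K, hK, hmem⟩ := G.exists_isCompact_forall_trajectory_mem x₀ M T
  obtain ⟨χ, γ, hχ, hχK, -, h0, hγ⟩ := exists_cutoff_solution
    (G.contDiff_leftMap.of_le (by simp)) hT hu hK x₀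
  have h1 : G.IsTrajectory γ (fun t => χ (γ t) • u t) T := by
    intro t ht
    rw [leftField_eq, map_smul]
    exact hγ t ht
  refine ⟨γ, h1.congr_control fun t ht => ?_, h0⟩
  have h2 := hmem T γ _ le_rfl h1.isRightTrajectory h0 (fun t ht => by
    rw [norm_smul, Real.norm_eq_abs, abs_of_nonneg (hχ _).1]
    exact (mul_le_of_le_one_left (norm_nonneg _) (hχ _).2).trans (hM t ⟨ht.1, ht.2.le⟩)) t ht
  simp [hχK _ h2]

theorem IsTrajectory.contDiffOn (h : G.IsTrajectory γ u T) (hu : ContDiffOn ℝ ∞ u (Icc 0 T)) :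
    ContDiffOn ℝ ∞ γ (Icc 0 T) := by
  refine ODE.contDiffOn_enat_Icc_of_hasDerivWithinAt (n := ⊤) (u := univ)
    (f := fun t z => G.leftMap z (u t)) ?_ h (fun _ _ => mem_univ _)
  exact (G.contDiff_leftMap.comp_contDiffOn contDiffOn_snd).clm_apply
    (hu.comp contDiffOn_fst fun p hp => hp.1)

/-- Two trajectories with the same origin: the quotient is controlled by the `L¹` distance of the
velocities. -/
theorem exists_forall_norm_mul_neg_le (G : ExpLieGroup n) {K : Set (Coord n)} (hK : IsCompact K) :
    ∃ C : ℝ, 0 < C ∧ ∀ (T : ℝ) (γ u α v : ℝ → Coord n), G.IsRightTrajectory γ u T →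
      G.IsRightTrajectory α v T → α 0 = γ 0 → (∀ t ∈ Icc 0 T, γ t ∈ K) →
      IntervalIntegrable (fun t => ‖v t - u t‖) volume 0 T →
      (∀ t ∈ Ico 0 T, ContinuousWithinAt (fun t => ‖v t - u t‖) (Ici t) t) →
      C * (∫ t in (0 : ℝ)..T, ‖v t - u t‖) < 1 →
      ∀ t ∈ Icc 0 T, ‖G.mul (α t) (-(γ t))‖ ≤ C * ∫ s in (0 : ℝ)..t, ‖v s - u s‖ := by
  obtain ⟨C₁, hC₁⟩ := (isCompact_closedBall (0 : Coord n) 1).exists_bound_of_continuousOn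
    G.contDiff_leftMap.continuous.continuousOn
  have hC₁0 : 0 ≤ C₁ := (norm_nonneg _).trans (hC₁ 0 (by simp))
  obtain ⟨C₂, hC₂⟩ := hK.exists_bound_of_continuousOn G.contDiff_Ad.continuous.continuousOn
  refine ⟨C₁ * |C₂| + 1, by positivity, fun T γ u α v hγ hα h0 hmem hint hcont hsmall t ht => ?_⟩
  set C := C₁ * |C₂| + 1
  have hC : 0 ≤ C := by positivity
  have hbd := norm_le_exp_mul_of_norm_deriv_right_le (L := 0) (δ := 0) (ρ := 1)
    (d := fun t => G.mul (α t) (-(γ t)))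
    (b := fun t => C * ‖v t - u t‖)
    (by exact G.smooth_mul.continuous.comp_continuousOn (hα.1.prodMk hγ.1.neg))
    (fun t ht => G.hasDerivWithinAt_mul_neg (hα.2 t ht) (hγ.2 t ht))
    (hint.const_mul C) (fun _ _ => by positivity)
    (fun t ht => (hcont t ht).const_mul C) le_rfl (by simp [h0, G.mul_neg])
    (fun t ht h1 => by
      rw [MulZeroClass.zero_mul, zero_add, leftField_eq]
      refine (ContinuousLinearMap.le_opNorm _ _).trans ?_
      have h2 := hC₁ _ (mem_closedBall_zero_iff.2 h1)
      have h3 := (hC₂ (γ t) (hmem t ⟨ht.1, ht.2.le⟩)).trans (le_abs_self _)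
      have h4 := (G.Ad (γ t)).le_opNorm (v t - u t)
      calc _ ≤ C₁ * (|C₂| * ‖v t - u t‖) := by gcongr; exact h4.trans (by gcongr)
        _ ≤ C * ‖v t - u t‖ := by nlinarith [norm_nonneg (v t - u t)])
    (by simpa using hsmall) t ht
  simpa using hbd

/-- First order expansion of the quotient of two trajectories with the same origin. -/
theorem exists_forall_norm_mul_neg_sub_integral_le (G : ExpLieGroup n) {K : Set (Coord n)}
    (hK : IsCompact K) :
    ∃ C : ℝ, 0 < C ∧ ∀ (T : ℝ) (γ u α v : ℝ → Coord n), 0 ≤ T → G.IsTrajectory γ u T →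
      G.IsTrajectory α v T → α 0 = γ 0 → (∀ t ∈ Icc 0 T, γ t ∈ K) →
      ContinuousOn u (Icc 0 T) → ContinuousOn v (Icc 0 T) →
      C * (∫ t in (0 : ℝ)..T, ‖v t - u t‖) < 1 →
      ‖G.mul (α T) (-(γ T))‖ ≤ C * ∫ t in (0 : ℝ)..T, ‖v t - u t‖ ∧
      ‖G.mul (α T) (-(γ T)) - ∫ t in (0 : ℝ)..T, G.Ad (γ t) (v t - u t)‖ ≤
        C * (∫ t in (0 : ℝ)..T, ‖v t - u t‖) ^ 2 := by
  obtain ⟨C, hC0, hC⟩ := G.exists_forall_norm_mul_neg_le hK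
  obtain ⟨C₁, hC₁⟩ := (G.contDiff_leftMap.contDiffOn (s := Metric.closedBall 0 1)
    ).exists_lipschitzOnWith (by simp) (convex_closedBall _ _) (isCompact_closedBall _ _)
  obtain ⟨C₂, hC₂⟩ := hK.exists_bound_of_continuousOn G.contDiff_Ad.continuous.continuousOn
  set C' := C + C₁ * C * |C₂| with hC'
  have hCC' : C ≤ C' := le_add_of_nonneg_right (by positivity)
  refine ⟨C', by positivity, fun T γ u α v hT hγ hα h0 hmem hu hv hsmall => ?_⟩
  set J := ∫ t in (0 : ℝ)..T, ‖v t - u t‖ with hJ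
  have hcont : ContinuousOn (fun t => v t - u t) (Icc 0 T) := hv.sub hu
  have hright : ∀ {F : Type} [NormedAddCommGroup F] {w : ℝ → F}, ContinuousOn w (Icc 0 T) →
      ∀ t ∈ Ico 0 T, ContinuousWithinAt w (Ici t) t := fun {F} _ {w} hw t ht =>
    (hw t ⟨ht.1, ht.2.le⟩).mono_of_mem_nhdsWithin
      (mem_of_superset (Icc_mem_nhdsGE ht.2) (Icc_subset_Icc_left ht.1))
  have hint : IntervalIntegrable (fun t => ‖v t - u t‖) volume 0 T :=
    hcont.norm.intervalIntegrable_of_Icc hT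
  have hJ0 : 0 ≤ J := intervalIntegral.integral_nonneg hT fun _ _ => norm_nonneg _
  have hfirst := hC T γ u α v hγ.isRightTrajectory hα.isRightTrajectory h0 hmem hint
    (hright hcont.norm) (lt_of_le_of_lt (by gcongr) hsmall)
  have hTT : T ∈ Icc 0 T := ⟨hT, le_rfl⟩
  refine ⟨(hfirst T hTT).trans (by gcongr), ?_⟩
  have hmono : ∀ t ∈ Icc 0 T, ∫ s in (0 : ℝ)..t, ‖v s - u s‖ ≤ J := fun t ht =>
    intervalIntegral.integral_mono_interval le_rfl ht.1 ht.2
      (Eventually.of_forall fun _ => norm_nonneg _) hint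
  have hAc : ContinuousOn (fun t => G.Ad (γ t) (v t - u t)) (Icc 0 T) :=
    (G.contDiff_Ad.continuous.comp_continuousOn hγ.continuousOn).clm_apply hcont
  have hAint := hAc.intervalIntegrable_of_Icc (μ := volume) hT
  have hId : ∀ t ∈ Ico 0 T, HasDerivWithinAt (fun t => ∫ s in (0 : ℝ)..t, G.Ad (γ s) (v s - u s))
      (G.Ad (γ t) (v t - u t)) (Ici t) t := by
    intro t ht
    refine intervalIntegral.integral_hasDerivWithinAt_right
      (hAint.mono_set (by rw [uIcc_of_le ht.1, uIcc_of_le hT]; exact Icc_subset_Icc_right ht.2.le))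
      (t := Ioi t) ⟨Ioo t T, Ioo_mem_nhdsGT ht.2, ?_⟩ ((hright hAc t ht).mono Ioi_subset_Ici_self)
    exact (hAc.mono fun z hz => ⟨ht.1.trans hz.1.le, hz.2.le⟩).aestronglyMeasurable
      measurableSet_Ioo
  have hIc : ContinuousOn (fun t => ∫ s in (0 : ℝ)..t, G.Ad (γ s) (v s - u s)) (Icc 0 T) := by
    have := intervalIntegral.continuousOn_primitive_interval
      (μ := volume) (f := fun s => G.Ad (γ s) (v s - u s)) (a := 0) (b := T)
      (by rw [uIcc_of_le hT]; exact hAc.integrableOn_Icc)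
    rwa [uIcc_of_le hT] at this
  have hbd := norm_le_exp_mul_of_norm_deriv_right_le (L := 0) (δ := 0)
    (ρ := C' * J ^ 2 + 1)
    (d := fun t => G.mul (α t) (-(γ t)) - ∫ s in (0 : ℝ)..t, G.Ad (γ s) (v s - u s))
    (b := fun t => C₁ * C * |C₂| * J * ‖v t - u t‖)
    ((G.smooth_mul.continuous.comp_continuousOn
      (hα.continuousOn.prodMk hγ.continuousOn.neg)).sub hIc)
    (fun t ht => (G.hasDerivWithinAt_mul_neg (hα.isRightTrajectory.2 t ht)
      (hγ.isRightTrajectory.2 t ht)).sub (hId t ht))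
    (hint.const_mul _) (fun _ _ => by positivity)
    (fun t ht => (hright hcont.norm t ht).const_mul _) le_rfl (by simp [h0, G.mul_neg])
    (fun t ht _ => by
      have ht' : t ∈ Icc 0 T := ⟨ht.1, ht.2.le⟩
      have h1 := (hfirst t ht').trans (mul_le_mul_of_nonneg_left (hmono t ht') hC0.le)
      have h1' : ‖G.mul (α t) (-(γ t))‖ ≤ 1 :=
        h1.trans (((mul_le_mul_of_nonneg_right hCC' hJ0).trans_lt hsmall).le)
      have h2 := hC₁.dist_le_mul _ (mem_closedBall_zero_iff.2 h1') 0 (by simp)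
      rw [leftMap_zero, dist_eq_norm, dist_zero_right] at h2
      have h3 := (hC₂ (γ t) (hmem t ht')).trans (le_abs_self _)
      have h4 := (G.Ad (γ t)).le_opNorm (v t - u t)
      have h5 : G.leftField (G.Ad (γ t) (v t - u t)) (G.mul (α t) (-(γ t))) -
          G.Ad (γ t) (v t - u t) =
          (G.leftMap (G.mul (α t) (-(γ t))) - ContinuousLinearMap.id ℝ (Coord n))
            (G.Ad (γ t) (v t - u t)) := rfl
      rw [h5, MulZeroClass.zero_mul, zero_add]
      refine (ContinuousLinearMap.le_opNorm _ _).trans ?_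
      calc _ ≤ (C₁ * (C * J)) * (|C₂| * ‖v t - u t‖) := by
              gcongr
              · exact h2.trans (by gcongr)
              · exact h4.trans (by gcongr)
        _ = _ := by ring)
    (by
      simp only [MulZeroClass.zero_mul, Real.exp_zero, one_mul, zero_add, intervalIntegral.integral_const_mul]
      rw [← hJ, hC']
      nlinarith [mul_nonneg hC0.le (sq_nonneg J)]) T hTT
  simp only [MulZeroClass.zero_mul, Real.exp_zero, one_mul, zero_add, intervalIntegral.integral_const_mul]
    at hbd
  refine hbd.trans ?_
  rw [← hJ, hC']
  nlinarith [mul_nonneg hC0.le (sq_nonneg J)]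

end ExpLieGroup

namespace ExpLieGroup

variable {n : ℕ} (G : ExpLieGroup n)

theorem continuous_leftTriv : Continuous fun p : Coord n × Coord n => G.leftTriv p.1 p.2 := by
  have h : ContDiff ℝ ∞ fun x : Coord n => fderiv ℝ (G.mul (-x)) x :=
    ContDiff.fderiv (m := ∞) (f := fun x z => G.mul (-x) z)
      (G.contDiff_mul_comp (k := ⊤) contDiff_fst.neg contDiff_snd) contDiff_id (by simp)
  exact (h.continuous.comp continuous_fst).clm_apply continuous_snd

theorem sqrt_metric_self (x v : Coord n) : Real.sqrt (G.metric x v v) = ‖G.leftTriv x v‖ := by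
  rw [metric, real_inner_self_eq_norm_sq, Real.sqrt_sq (norm_nonneg _)]

end ExpLieGroup

namespace CarnotGroup

variable {n : ℕ} (G : CarnotGroup n)

/-! ### Horizontal vectors -/

/-- The horizontal projection as a continuous linear map. -/
def projHL : Coord n →L[ℝ] Coord n :=
  LinearMap.toContinuousLinearMap
    { toFun := G.projH
      map_add' := fun v w => by ext i; by_cases h : G.ord i = 1 <;> simp [projH, h]
      map_smul' := fun c v => by ext i; by_cases h : G.ord i = 1 <;> simp [projH, h] }

theorem projHL_apply (v : Coord n) : G.projHL v = G.projH v := rfl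

theorem projH_apply (v : Coord n) (i : Fin n) : G.projH v i = if G.ord i = 1 then v i else 0 := rfl

theorem projH_smul (c : ℝ) (v : Coord n) : G.projH (c • v) = c • G.projH v := G.projHL.map_smul c v

theorem projH_neg (v : Coord n) : G.projH (-v) = -G.projH v := G.projHL.map_neg v

theorem projH_projH (v : Coord n) : G.projH (G.projH v) = G.projH v := by
  ext i; by_cases h : G.ord i = 1 <;> simp [projH_apply, h]

theorem inner_projH_right (u v : Coord n) (hu : G.projH u = u) :
    inner ℝ u (G.projH v) = inner ℝ u v := by
  simp only [PiLp.inner_apply]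
  refine Finset.sum_congr rfl fun i _ => ?_
  by_cases h : G.ord i = 1
  · simp [projH_apply, h]
  · have : u i = 0 := by rw [← hu, projH_apply, if_neg h]
    simp [this]

theorem norm_projH_le (v : Coord n) : ‖G.projH v‖ ≤ ‖v‖ := by
  have h1 := G.inner_projH_right (G.projH v) v (G.projH_projH v)
  rw [real_inner_self_eq_norm_sq] at h1
  have h2 := real_inner_le_norm (G.projH v) v
  by_contra! h
  nlinarith [norm_nonneg v]

theorem contDiff_projH : ContDiff ℝ ∞ G.projH := G.projHL.contDiff

theorem eq_sum_smul_single (v : Coord n) :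
    v = ∑ i, v i • (EuclideanSpace.single i 1 : Coord n) := by
  ext j
  simp [Pi.single_apply]

theorem leftField_mem_horizontal {u : Coord n} (hu : G.projH u = u) (x : Coord n) :
    G.leftField u x ∈ G.horizontal x := by
  rw [eq_sum_smul_single u, ExpLieGroup.leftField_eq, map_sum]
  refine Submodule.sum_mem _ fun i _ => ?_
  rw [map_smul]
  by_cases h : G.ord i = 1
  · exact Submodule.smul_mem _ _ (Submodule.subset_span ⟨i, h, rfl⟩)
  · have : u i = 0 := by rw [← hu, projH_apply, if_neg h]
    simp [this]

theorem projH_leftTriv_of_mem_horizontal {x v : Coord n} (hv : v ∈ G.horizontal x) :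
    G.projH (G.leftTriv x v) = G.leftTriv x v := by
  rw [horizontal] at hv
  have hlin : ∀ v, G.leftTriv x v = fderiv ℝ (G.mul (-x)) x v := fun _ => rfl
  induction hv using Submodule.span_induction with
  | mem v hv =>
    obtain ⟨i, hi, rfl⟩ := hv
    rw [frame, ExpLieGroup.leftTriv_leftField]
    ext j
    rw [projH_apply]
    split_ifs with h
    · rfl
    · have : j ≠ i := by rintro rfl; exact h hi
      simp [this]
  | zero => rw [hlin, map_zero, ← projHL_apply, map_zero]
  | add a b _ _ ha hb =>
    rw [hlin, map_add, ← hlin, ← hlin, ← projHL_apply, map_add, projHL_apply, projHL_apply, ha, hb]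
  | smul c a _ ha => rw [hlin, map_smul, ← hlin, projH_smul, ha]

/-! ### The Carnot–Carathéodory distance -/

variable {G} {γ u : ℝ → Coord n} {T : ℝ}

theorem integral_norm_eq_pathLength (hT : 0 ≤ T) (h : G.IsTrajectory γ u T) :
    G.pathLength γ T = ∫ t in (0 : ℝ)..T, ‖u t‖ := by
  refine intervalIntegral.integral_congr_ae ?_
  rw [uIoc_of_le hT]
  have h1 : ∀ᵐ t : ℝ, t ≠ T := by simp [ae_iff, measure_singleton]
  filter_upwards [h1] with t h1 ht
  rw [(h.hasDerivAt ⟨ht.1, lt_of_le_of_ne ht.2 h1⟩).deriv, ExpLieGroup.metric_leftField,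
    Real.sqrt_sq (norm_nonneg _)]

theorem isHorizontalPath_of_isTrajectory (hT : 0 ≤ T) (h : G.IsTrajectory γ u T)
    (hu : ContDiffOn ℝ ∞ u (Icc 0 T)) (hH : ∀ t ∈ Icc 0 T, G.projH (u t) = u t) :
    G.IsHorizontalPath γ T := by
  refine ⟨1, fun i => if i = 0 then 0 else T, ?_, by simp, by simp, ?_⟩
  · refine monotone_nat_of_le_succ fun i => ?_
    by_cases hi : i = 0 <;> simp [hi, hT]
  · intro i hi
    obtain rfl : i = 0 := by omega
    refine ⟨by simpa using h.contDiffOn hu, fun t ht => ?_⟩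
    simp only [if_true, zero_add, one_ne_zero, if_false] at ht
    rw [(h.hasDerivAt ht).deriv]
    exact G.leftField_mem_horizontal (hH t (Ioo_subset_Icc_self ht)) _

theorem ccDist_le_pathLength (h : G.IsHorizontalPath γ T) :
    G.ccDist (γ 0) (γ T) ≤ ENNReal.ofReal (G.pathLength γ T) :=
  iInf_le_of_le T (iInf_le_of_le γ (iInf_le_of_le ⟨h, rfl, rfl⟩ le_rfl))

theorem ccDist_le_of_isTrajectory (hT : 0 ≤ T) (h : G.IsTrajectory γ u T)
    (hu : ContDiffOn ℝ ∞ u (Icc 0 T)) (hH : ∀ t ∈ Icc 0 T, G.projH (u t) = u t) :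
    G.ccDist (γ 0) (γ T) ≤ ENNReal.ofReal (∫ t in (0 : ℝ)..T, ‖u t‖) := by
  rw [← integral_norm_eq_pathLength hT h]
  exact ccDist_le_pathLength (isHorizontalPath_of_isTrajectory hT h hu hH)

theorem IsHorizontalPath.nonneg (h : G.IsHorizontalPath γ T) : 0 ≤ T := by
  obtain ⟨N, τ, hτ, h0, hN, -⟩ := h
  rw [← h0, ← hN]
  exact hτ (Nat.zero_le N)

theorem exists_mem_Ico_of_monotone {N : ℕ} {τ : ℕ → ℝ} {t : ℝ}
    (ht : t ∈ Ico (τ 0) (τ N)) : ∃ i < N, t ∈ Ico (τ i) (τ (i + 1)) := by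
  induction N with
  | zero => exact absurd (ht.1.trans_lt ht.2) (lt_irrefl _)
  | succ N ih =>
    rcases lt_or_ge t (τ N) with h | h
    · obtain ⟨i, hi, h⟩ := ih ⟨ht.1, h⟩
      exact ⟨i, hi.trans (Nat.lt_succ_self N), h⟩
    · exact ⟨N, Nat.lt_succ_self N, h, ht.2⟩

/-- A piecewise smooth horizontal path has an integrable, right-continuous, almost everywhere
horizontal left-invariant velocity. -/
theorem IsHorizontalPath.exists_velocity (h : G.IsHorizontalPath γ T) :
    ∃ u : ℝ → Coord n, G.IsRightTrajectory γ u T ∧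
      (∀ t ∈ Ico 0 T, ContinuousWithinAt u (Ici t) t) ∧ IntervalIntegrable u volume 0 T ∧
      ∀ᵐ t, t ∈ Ioc 0 T →
        G.projH (u t) = u t ∧ Real.sqrt (G.metric (γ t) (deriv γ t) (deriv γ t)) = ‖u t‖ := by
  obtain ⟨N, τ, hτ, h0, hN, hpiece⟩ := h
  set u : ℝ → Coord n := fun t => G.leftTriv (γ t) (derivWithin γ (Ici t) t) with hu
  have hd : ∀ i < N, ∀ t ∈ Ico (τ i) (τ (i + 1)),
      HasDerivWithinAt γ (derivWithin γ (Icc (τ i) (τ (i + 1))) t) (Ici t) t := by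
    intro i hi t ht
    have h1 := ((hpiece i hi).1.differentiableOn (by simp) t ⟨ht.1, ht.2.le⟩).hasDerivWithinAt
    exact h1.mono_of_mem_nhdsWithin
      (mem_of_superset (Icc_mem_nhdsGE ht.2) (Icc_subset_Icc_left ht.1))
  have hcont : ∀ i < N, τ i < τ (i + 1) → ContinuousOn
      (fun t => G.leftTriv (γ t) (derivWithin γ (Icc (τ i) (τ (i + 1))) t))
      (Icc (τ i) (τ (i + 1))) := by
    intro i hi hlt
    exact G.continuous_leftTriv.comp_continuousOn ((hpiece i hi).1.continuousOn.prodMk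
      ((hpiece i hi).1.continuousOn_derivWithin (uniqueDiffOn_Icc hlt) (by simp)))
  have hueq : ∀ i < N, ∀ t ∈ Ico (τ i) (τ (i + 1)),
      u t = G.leftTriv (γ t) (derivWithin γ (Icc (τ i) (τ (i + 1))) t) := by
    intro i hi t ht
    simp only [hu]
    rw [(hd i hi t ht).derivWithin (uniqueDiffWithinAt_Ici t)]
  have hγc : ContinuousOn γ (Icc 0 T) := by
    have : ∀ m ≤ N, ContinuousOn γ (Icc 0 (τ m)) := by
      intro m
      induction m with
      | zero => intro _; rw [h0, Icc_self]; exact continuousOn_singleton _ _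
      | succ m ih =>
        intro hm
        have h1 : (0 : ℝ) ≤ τ m := by rw [← h0]; exact hτ (Nat.zero_le m)
        rw [← Icc_union_Icc_eq_Icc h1 (hτ (Nat.le_succ m))]
        exact (ih (by omega)).union_of_isClosed (hpiece m (by omega)).1.continuousOn isClosed_Icc
          isClosed_Icc
    rw [← hN]
    exact this N le_rfl
  refine ⟨u, ⟨hγc, fun t ht => ?_⟩, fun t ht => ?_, ?_, ?_⟩
  · obtain ⟨i, hi, hti⟩ := exists_mem_Ico_of_monotone (τ := τ) (N := N) (by rwa [h0, hN])
    rw [hueq i hi t hti, ExpLieGroup.leftField_leftTriv]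
    exact hd i hi t hti
  · obtain ⟨i, hi, hti⟩ := exists_mem_Ico_of_monotone (τ := τ) (N := N) (by rwa [h0, hN])
    have h1 := (hcont i hi (hti.1.trans_lt hti.2) t ⟨hti.1, hti.2.le⟩).mono_of_mem_nhdsWithin
      (mem_of_superset (Icc_mem_nhdsGE hti.2) (Icc_subset_Icc_left hti.1))
    refine h1.congr_of_eventuallyEq ?_ (hueq i hi t hti)
    filter_upwards [Ico_mem_nhdsGE hti.2] with s hs
    exact hueq i hi s ⟨hti.1.trans hs.1, hs.2⟩
  · rw [← h0, ← hN]
    refine IntervalIntegrable.trans_iterate fun i hi => ?_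
    rcases (hτ (Nat.le_succ i)).eq_or_lt with h | h
    · rw [Nat.succ_eq_add_one] at h; rw [h]
    · refine ((hcont i hi h).intervalIntegrable_of_Icc h.le).congr_ae ?_
      rw [uIoc_of_le h.le, Filter.EventuallyEq, ae_restrict_iff' measurableSet_Ioc]
      have h1 : ∀ᵐ t : ℝ, t ≠ τ (i + 1) := by simp [ae_iff, measure_singleton]
      filter_upwards [h1] with t h1 ht
      exact (hueq i hi t ⟨ht.1.le, lt_of_le_of_ne ht.2 h1⟩).symm
  · have h1 : ∀ᵐ t : ℝ, ∀ i, t ≠ τ i :=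
      ae_all_iff.2 fun i => by simp [ae_iff, measure_singleton]
    filter_upwards [h1] with t h1 ht
    obtain ⟨i, hi, hti⟩ := exists_mem_Ico_of_monotone (τ := τ) (N := N) (t := t)
      ⟨by rw [h0]; exact ht.1.le, lt_of_le_of_ne (by rw [hN]; exact ht.2) (h1 N)⟩
    have hti' : t ∈ Ioo (τ i) (τ (i + 1)) := ⟨lt_of_le_of_ne hti.1 (h1 i).symm, hti.2⟩
    have h2 : u t = G.leftTriv (γ t) (deriv γ t) := by
      rw [hueq i hi t hti, derivWithin_of_mem_nhds (Icc_mem_nhds hti'.1 hti'.2)]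
    rw [h2, ExpLieGroup.sqrt_metric_self]
    exact ⟨G.projH_leftTriv_of_mem_horizontal ((hpiece i hi).2 t hti'), rfl⟩

theorem IsHorizontalPath.intervalIntegrable_speed (h : G.IsHorizontalPath γ T) :
    IntervalIntegrable (fun t => Real.sqrt (G.metric (γ t) (deriv γ t) (deriv γ t))) volume 0 T := by
  obtain ⟨u, -, -, hu, hae⟩ := h.exists_velocity
  refine hu.norm.congr_ae ?_
  rw [uIoc_of_le h.nonneg, Filter.EventuallyEq, ae_restrict_iff' measurableSet_Ioc]
  filter_upwards [hae] with t h1 ht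
  exact (h1 ht).2.symm

theorem IsHorizontalPath.reverse (h : G.IsHorizontalPath γ T) :
    G.IsHorizontalPath (fun t => γ (T - t)) T := by
  obtain ⟨N, τ, hτ, h0, hN, hpiece⟩ := h
  refine ⟨N, fun i => T - τ (N - i), fun i j hij => ?_, by simp [hN], by simp [h0], fun i hi => ?_⟩
  · exact sub_le_sub_left (hτ (by omega)) T
  · have e : N - i = N - (i + 1) + 1 := by omega
    obtain ⟨h1, h2⟩ := hpiece (N - (i + 1)) (by omega)
    rw [← e] at h1 h2
    refine ⟨h1.comp (by fun_prop) fun t ht => ?_, fun t ht => ?_⟩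
    · exact ⟨by linarith [ht.2], by linarith [ht.1]⟩
    · rw [deriv_comp_const_sub]
      exact Submodule.neg_mem _ (h2 (T - t) ⟨by linarith [ht.2], by linarith [ht.1]⟩)

theorem pathLength_reverse : G.pathLength (fun t => γ (T - t)) T = G.pathLength γ T := by
  have e : ∀ t, Real.sqrt (G.metric (γ (T - t)) (deriv (fun t => γ (T - t)) t)
      (deriv (fun t => γ (T - t)) t)) =
      (fun s => Real.sqrt (G.metric (γ s) (deriv γ s) (deriv γ s))) (T - t) := by
    intro t
    simp only [deriv_comp_const_sub, ExpLieGroup.sqrt_metric_self]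
    rw [ExpLieGroup.leftTriv, map_neg, norm_neg]
    rfl
  have e2 := intervalIntegral.integral_comp_sub_left (a := 0) (b := T)
    (fun s => Real.sqrt (G.metric (γ s) (deriv γ s) (deriv γ s))) T
  rw [sub_self, sub_zero] at e2
  rw [pathLength, pathLength, ← e2]
  exact intervalIntegral.integral_congr fun t _ => e t

theorem ccDist_le_swap (p q : Coord n) : G.ccDist q p ≤ G.ccDist p q := by
  refine le_iInf fun T => le_iInf fun γ => le_iInf fun ⟨h, hp, hq⟩ => ?_
  have := ccDist_le_pathLength h.reverse
  rwa [pathLength_reverse, sub_zero, sub_self, hp, hq] at this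

theorem ccDist_comm (p q : Coord n) : G.ccDist p q = G.ccDist q p :=
  le_antisymm (ccDist_le_swap _ _) (ccDist_le_swap _ _)

/-- Triangle inequality, when one of the sides is a smooth horizontal trajectory. -/
theorem ccDist_le_ccDist_add (hT : 0 ≤ T) (h : G.IsTrajectory γ u T)
    (hu : ContDiffOn ℝ ∞ u (Icc 0 T)) (hH : ∀ t ∈ Icc 0 T, G.projH (u t) = u t) (w : Coord n) :
    G.ccDist w (γ T) ≤ G.ccDist w (γ 0) + ENNReal.ofReal (∫ t in (0 : ℝ)..T, ‖u t‖) := by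
  conv_rhs => rw [ccDist]
  simp only [ENNReal.iInf_add]
  refine le_iInf fun S => le_iInf fun α => le_iInf fun ⟨hα, hw, hα0⟩ => ?_
  have hS := hα.nonneg
  have hspeed := hα.intervalIntegrable_speed
  obtain ⟨N, τ, hτ, h0, hN, hpiece⟩ := hα
  set β : ℝ → Coord n := fun t => if t ≤ S then α t else γ (t - S) with hβ
  have hβ1 : ∀ t ≤ S, β t = α t := fun t ht => if_pos ht
  have hβ2 : ∀ t, S ≤ t → β t = γ (t - S) := by
    intro t ht
    rcases ht.eq_or_lt with rfl | ht
    · rw [hβ1 S le_rfl, sub_self, hα0]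
    · exact if_neg (not_le.2 ht)
  have hder1 : ∀ t < S, β =ᶠ[𝓝 t] α := fun t ht => by
    filter_upwards [Iio_mem_nhds ht] with s hs using hβ1 s (le_of_lt hs)
  have hder2 : ∀ t, S < t → β =ᶠ[𝓝 t] fun t => γ (t - S) := fun t ht => by
    filter_upwards [Ioi_mem_nhds ht] with s hs using hβ2 s (le_of_lt hs)
  have hτS : ∀ i ≤ N, τ i ≤ S := fun i hi => by rw [← hN]; exact hτ hi
  have hpath : G.IsHorizontalPath β (S + T) := by
    refine ⟨N + 1, fun i => if i ≤ N then τ i else S + T, ?_, by simp [h0], by simp, ?_⟩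
    · refine monotone_nat_of_le_succ fun i => ?_
      by_cases h1 : i + 1 ≤ N
      · simp [h1, (by omega : i ≤ N), hτ (Nat.le_succ i)]
      · by_cases h2 : i ≤ N
        · simp only [h1, h2, if_true, if_false]
          linarith [hτS i h2]
        · simp [h1, h2]
    · intro i hi
      rcases Nat.lt_succ_iff_lt_or_eq.1 hi with hi | rfl
      · simp only [hi.le, Nat.succ_le_of_lt hi, if_true]
        refine ⟨(hpiece i hi).1.congr fun t ht => hβ1 t (ht.2.trans (hτS _ hi)), fun t ht => ?_⟩
        have ht' : t < S := ht.2.trans_le (hτS _ hi)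
        rw [(hder1 t ht').deriv_eq, hβ1 t ht'.le]
        exact (hpiece i hi).2 t ht
      · simp only [le_refl, if_true, Nat.not_succ_le_self, if_false, hN]
        refine ⟨?_, fun t ht => ?_⟩
        · have h1 : ContDiffOn ℝ ∞ (fun t => γ (t - S)) (Icc S (S + T)) :=
            (h.contDiffOn hu).comp (by fun_prop)
              fun t ht => ⟨by linarith [ht.1], by linarith [ht.2]⟩
          exact h1.congr fun t ht => hβ2 t ht.1
        · have ht' : t - S ∈ Ioo 0 T := ⟨by linarith [ht.1], by linarith [ht.2]⟩
          rw [(hder2 t ht.1).deriv_eq, deriv_comp_sub_const, hβ2 t ht.1.le,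
            (h.hasDerivAt ht').deriv]
          exact G.leftField_mem_horizontal (hH _ (Ioo_subset_Icc_self ht')) _
  have hlen : G.pathLength β (S + T) = G.pathLength α S + ∫ t in (0 : ℝ)..T, ‖u t‖ := by
    have i1 := hpath.intervalIntegrable_speed
    have hST : S ≤ S + T := by linarith
    rw [pathLength, ← intervalIntegral.integral_add_adjacent_intervals (b := S)
      (i1.mono_set (by rw [uIcc_of_le hS, uIcc_of_le (hS.trans hST)]; exact Icc_subset_Icc_right hST))
      (i1.mono_set (by rw [uIcc_of_le hST, uIcc_of_le (hS.trans hST)]; exact Icc_subset_Icc_left hS))]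
    have hne : ∀ᵐ t : ℝ, t ≠ S := by simp [ae_iff, measure_singleton]
    congr 1
    · refine intervalIntegral.integral_congr_ae ?_
      rw [uIoc_of_le hS]
      filter_upwards [hne] with t h1 ht
      have ht' : t < S := lt_of_le_of_ne ht.2 h1
      rw [(hder1 t ht').deriv_eq, hβ1 t ht'.le]
    · rw [← integral_norm_eq_pathLength hT h, pathLength]
      have e := intervalIntegral.integral_comp_sub_right (a := S) (b := S + T)
        (fun t => Real.sqrt (G.metric (γ t) (deriv γ t) (deriv γ t))) S
      rw [sub_self, add_sub_cancel_left] at e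
      rw [← e]
      refine intervalIntegral.integral_congr_ae ?_
      rw [uIoc_of_le hST]
      filter_upwards with t ht
      rw [(hder2 t ht.1).deriv_eq, hβ2 t ht.1.le, deriv_comp_sub_const]
  have hfin := ccDist_le_pathLength hpath
  rw [hβ1 0 hS, hβ2 (S + T) (by linarith), add_sub_cancel_left, hw, hlen] at hfin
  refine hfin.trans (ENNReal.ofReal_add_le)

end CarnotGroup

/-! ### Nearly minimizing trajectories -/

/-- Change of time: a smooth trajectory of length less than `R` can be run through in time `R` with
speed at most one. -/
theorem ExpLieGroup.IsTrajectory.exists_unit_speed {n : ℕ} {G : ExpLieGroup n}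
    {α v : ℝ → Coord n} {T R : ℝ} (hα : G.IsTrajectory α v T) (hv : ContDiff ℝ ∞ v) (hT : 0 < T)
    (hR : ∫ t in (0 : ℝ)..T, ‖v t‖ < R) :
    ∃ θ w : ℝ → ℝ, G.IsTrajectory (fun s => α (θ s)) (fun s => w s • v (θ s)) R ∧
      ContDiffOn ℝ ∞ (fun s => w s • v (θ s)) (Icc 0 R) ∧ (∀ s, ‖w s • v (θ s)‖ ≤ 1) ∧
      θ 0 = 0 ∧ θ R = T := by
  set L := ∫ t in (0 : ℝ)..T, ‖v t‖ with hL
  have hL0 : 0 ≤ L := intervalIntegral.integral_nonneg hT.le fun _ _ => norm_nonneg _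
  have hR0 : 0 < R := hL0.trans_lt hR
  -- a smooth upper bound of the speed, with integral exactly `R`
  set κ := (R - L) / (2 * T) with hκ
  have hκ0 : 0 < κ := div_pos (by linarith) (by linarith)
  set w₀ : ℝ → ℝ := fun t => Real.sqrt (‖v t‖ ^ 2 + κ ^ 2) with hw₀
  have hpos : ∀ t, 0 < ‖v t‖ ^ 2 + κ ^ 2 := fun t => by positivity
  have hw₀s : ContDiff ℝ ∞ w₀ := ((hv.norm_sq ℝ).add contDiff_const).sqrt fun t => (hpos t).ne'
  have hw₀v : ∀ t, ‖v t‖ ≤ w₀ t := fun t => Real.le_sqrt_of_sq_le (by nlinarith)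
  have hw₀κ : ∀ t, κ ≤ w₀ t := fun t => Real.le_sqrt_of_sq_le (by nlinarith [sq_nonneg ‖v t‖])
  have hw₀le : ∀ t, w₀ t ≤ ‖v t‖ + κ := fun t => by
    refine Real.sqrt_le_iff.2 ⟨by positivity, ?_⟩
    nlinarith [mul_nonneg (norm_nonneg (v t)) hκ0.le]
  set I := ∫ t in (0 : ℝ)..T, w₀ t with hI
  have hIR : I < R := by
    have h1 : I ≤ ∫ t in (0 : ℝ)..T, (‖v t‖ + κ) :=
      intervalIntegral.integral_mono_on hT.le (hw₀s.continuous.intervalIntegrable _ _)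
        ((hv.continuous.norm.add continuous_const).intervalIntegrable _ _) fun t _ => hw₀le t
    rw [intervalIntegral.integral_add (hv.continuous.norm.intervalIntegrable _ _)
      (continuous_const.intervalIntegrable _ _), intervalIntegral.integral_const, ← hL,
      smul_eq_mul, sub_zero] at h1
    have : T * κ = (R - L) / 2 := by rw [hκ]; field_simp
    linarith
  have hI0 : 0 < I := by
    have h1 : ∫ t in (0 : ℝ)..T, κ ≤ I :=
      intervalIntegral.integral_mono_on hT.le (continuous_const.intervalIntegrable _ _)
        (hw₀s.continuous.intervalIntegrable _ _) fun t _ => hw₀κ t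
    rw [intervalIntegral.integral_const, smul_eq_mul, sub_zero] at h1
    exact (mul_pos hT hκ0).trans_le h1
  have hq : 1 ≤ R / I := by rw [le_div_iff₀ hI0]; linarith
  set w : ℝ → ℝ := fun t => R / I * w₀ t with hw
  have hws : ContDiff ℝ ∞ w := contDiff_const.mul hw₀s
  have hww₀ : ∀ t, w₀ t ≤ w t := fun t => le_mul_of_one_le_left (hκ0.le.trans (hw₀κ t)) hq
  have hwpos : ∀ t, 0 < w t := fun t => hκ0.trans_le ((hw₀κ t).trans (hww₀ t))
  set σ : ℝ → ℝ := fun t => ∫ s in (0 : ℝ)..t, w s with hσ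
  have hσd : ∀ t, HasDerivAt σ (w t) t := fun t => hws.continuous.integral_hasStrictDerivAt 0 t
    |>.hasDerivAt
  have hσ0 : σ 0 = 0 := by simp [hσ]
  have hσT : σ T = R := by
    simp only [hσ, hw, intervalIntegral.integral_const_mul]
    rw [← hI, div_mul_cancel₀ _ hI0.ne']
  have hσmono : StrictMono σ := strictMono_of_hasDerivAt_pos hσd hwpos
  have hdiff : Monotone fun t => σ t - κ * t := by
    refine monotone_of_hasDerivAt_nonneg (f' := fun t => w t - κ) (fun t => ?_) fun t => ?_
    · simpa using! (hσd t).sub ((hasDerivAt_id t).const_mul κ)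
    · exact sub_nonneg.2 ((hw₀κ t).trans (hww₀ t))
  have hσsurj : Function.Surjective σ := by
    refine Continuous.surjective (continuous_iff_continuousAt.2 fun t => (hσd t).continuousAt)
      ?_ ?_
    · refine tendsto_atTop_mono' _ ?_ (tendsto_id.const_mul_atTop hκ0)
      filter_upwards [eventually_ge_atTop 0] with t ht
      have := hdiff ht
      simpa [hσ0] using this
    · refine tendsto_atBot_mono' _ ?_ (tendsto_id.const_mul_atBot hκ0)
      filter_upwards [eventually_le_atBot 0] with t ht
      have := hdiff ht
      simpa [hσ0] using this
  set e := hσmono.orderIsoOfSurjective σ hσsurj with he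
  set θ : ℝ → ℝ := fun s => e.symm s with hθ
  have hσθ : ∀ s, σ (θ s) = s := fun s => e.apply_symm_apply s
  have hθσ : ∀ t, θ (σ t) = t := fun t => e.symm_apply_apply t
  have hθd : ∀ s, HasDerivAt θ (w (θ s))⁻¹ s := fun s =>
    HasDerivAt.of_local_left_inverse e.symm.continuous.continuousAt (hσd _) (hwpos _).ne'
      (Eventually.of_forall hσθ)
  have hθ0 : θ 0 = 0 := by rw [← hσ0, hθσ, hσ0]
  have hθR : θ R = T := by rw [← hσT, hθσ]
  have hθmem : MapsTo θ (Icc 0 R) (Icc 0 T) := by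
    intro s hs
    rw [← hθ0, ← hθR]
    exact ⟨e.symm.monotone hs.1, e.symm.monotone hs.2⟩
  have hθs : ContDiffOn ℝ ∞ θ (Icc 0 R) :=
    ODE.contDiffOn_enat_Icc_of_hasDerivWithinAt (n := ⊤) (u := univ) (f := fun _ z => (w z)⁻¹)
      ((hws.inv fun t => (hwpos t).ne').comp_contDiffOn contDiffOn_snd)
      (fun s _ => (hθd s).hasDerivWithinAt) (fun _ _ => mem_univ _)
  refine ⟨θ, fun s => (w (θ s))⁻¹, fun s hs => ?_, ?_, fun s => ?_, hθ0, hθR⟩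
  · have h1 := HasDerivWithinAt.scomp s (hα (θ s) (hθmem hs)) (hθd s).hasDerivWithinAt hθmem
    rw [ExpLieGroup.leftField_eq, ← map_smul] at h1
    exact h1
  · exact ((hws.inv fun t => (hwpos t).ne').comp_contDiffOn hθs).smul (hv.comp_contDiffOn hθs)
  · rw [norm_smul, norm_inv, Real.norm_of_nonneg (hwpos _).le, inv_mul_le_iff₀ (hwpos _), mul_one]
    exact (hw₀v _).trans (hww₀ _)

/-- Smooth functions are dense in `L¹(0, T)`. -/
theorem exists_contDiff_integral_norm_sub_le {E : Type*} [NormedAddCommGroup E] [NormedSpace ℝ E]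
    {u : ℝ → E} {T δ : ℝ} (hT : 0 ≤ T) (hu : IntervalIntegrable u volume 0 T) (hδ : 0 < δ) :
    ∃ g : ℝ → E, ContDiff ℝ ∞ g ∧ ∫ t in (0 : ℝ)..T, ‖g t - u t‖ ≤ δ := by
  have h1 : IntegrableOn u (Ioc 0 T) := (intervalIntegrable_iff_integrableOn_Ioc_of_le hT).1 hu
  have h2 : MemLp ((Ioc 0 T).indicator u) 1 volume :=
    memLp_one_iff_integrable.2 (h1.integrable_indicator measurableSet_Ioc)
  obtain ⟨g, hg, hgs, hle⟩ := h2.exist_eLpNorm_sub_le (by simp) le_rfl hδ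
  refine ⟨g, hgs, ?_⟩
  have hgi : Integrable g := hgs.continuous.integrable_of_hasCompactSupport hg
  have hfi : Integrable ((Ioc 0 T).indicator u - g) := (memLp_one_iff_integrable.1 h2).sub hgi
  rw [eLpNorm_one_eq_lintegral_enorm, ← ofReal_integral_norm_eq_lintegral_enorm hfi,
    ENNReal.ofReal_le_ofReal_iff hδ.le] at hle
  rw [intervalIntegral.integral_of_le hT]
  refine le_trans (le_of_eq ?_) ((setIntegral_le_integral (s := Ioc 0 T) hfi.norm
    (Eventually.of_forall fun _ => norm_nonneg _)).trans hle)
  refine setIntegral_congr_fun measurableSet_Ioc fun t ht => ?_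
  simp only [Pi.sub_apply, indicator_of_mem ht]
  rw [norm_sub_rev]

namespace CarnotGroup

variable {n : ℕ} (G : CarnotGroup n)

/-- If `d(p, q) ≤ r`, then a neighbourhood of `q` is reached from `p` in time slightly larger than
`r` along smooth horizontal trajectories of speed at most one. -/
theorem exists_nearly_minimizing {p q : Coord n} {r : ℝ} (hr : 0 < r) (hpq : p ≠ q)
    (hd : G.ccDist p q ≤ ENNReal.ofReal r) {ε : ℝ} (hε : 0 < ε) :
    ∃ γ u : ℝ → Coord n, G.IsTrajectory γ u (r + ε) ∧ ContDiffOn ℝ ∞ u (Icc 0 (r + ε)) ∧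
      (∀ t, G.projH (u t) = u t) ∧ (∀ t, ‖u t‖ ≤ 1) ∧ γ 0 = p ∧ ‖γ (r + ε) - q‖ ≤ ε := by
  have hlt : G.ccDist p q < ENNReal.ofReal (r + ε / 2) :=
    hd.trans_lt ((ENNReal.ofReal_lt_ofReal_iff (by linarith)).2 (by linarith))
  rw [ccDist] at hlt
  simp only [iInf_lt_iff] at hlt
  obtain ⟨T, γ, ⟨hγ, h0, hTq⟩, hlen⟩ := hlt
  have hlen' : G.pathLength γ T < r + ε / 2 := (ENNReal.ofReal_lt_ofReal_iff (by linarith)).1 hlen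
  have hT : 0 < T := by
    refine lt_of_le_of_ne hγ.nonneg fun h => hpq ?_
    rw [← h0, ← hTq, h]
  obtain ⟨u, hu, hurc, hui, hae⟩ := hγ.exists_velocity
  have hlen2 : G.pathLength γ T = ∫ t in (0 : ℝ)..T, ‖u t‖ := by
    refine intervalIntegral.integral_congr_ae ?_
    rw [uIoc_of_le hT.le]
    filter_upwards [hae] with t h ht using (h ht).2
  obtain ⟨C, hC0, hC⟩ := G.exists_forall_norm_mul_neg_le (isCompact_Icc.image_of_continuousOn hu.1)
  -- a small neighbourhood of the identity on which translation by `q` is `ε`-close to `q`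
  obtain ⟨ρ, hρ0, hρ⟩ : ∃ ρ > 0, ∀ z : Coord n, ‖z‖ < ρ → ‖G.mul z q - q‖ < ε := by
    obtain ⟨ρ, hρ, h⟩ := Metric.continuousAt_iff.1
      ((G.contDiff_mul_left q).continuous.continuousAt (x := 0)) ε hε
    refine ⟨ρ, hρ, fun z hz => ?_⟩
    have := h (x := z) (by simpa using hz)
    rwa [G.zero_mul, dist_eq_norm] at this
  set δ := min (ε / 4) (min (1 / (2 * C)) (ρ / (2 * C))) with hδ
  have hδ0 : 0 < δ := by positivity
  have hδ1 : δ ≤ ε / 4 := min_le_left _ _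
  have hδ2 : C * δ < 1 := by
    have : δ ≤ 1 / (2 * C) := (min_le_right _ _).trans (min_le_left _ _)
    rw [le_div_iff₀ (by positivity)] at this
    linarith
  have hδ3 : C * δ < ρ := by
    have : δ ≤ ρ / (2 * C) := (min_le_right _ _).trans (min_le_right _ _)
    rw [le_div_iff₀ (by positivity)] at this
    linarith
  obtain ⟨g, hg, hgu⟩ := exists_contDiff_integral_norm_sub_le hT.le hui hδ0
  set v : ℝ → Coord n := fun t => G.projH (g t) with hv
  have hvs : ContDiff ℝ ∞ v := G.contDiff_projH.comp hg
  have hvi : IntervalIntegrable (fun t => ‖v t - u t‖) volume 0 T :=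
    ((hvs.continuous.intervalIntegrable _ _).sub hui).norm
  have hvu : ∫ t in (0 : ℝ)..T, ‖v t - u t‖ ≤ δ := by
    refine le_trans (intervalIntegral.integral_mono_ae_restrict hT.le hvi
      ((hg.continuous.intervalIntegrable _ _).sub hui).norm ?_) hgu
    rw [Measure.restrict_congr_set Ioc_ae_eq_Icc.symm, Filter.EventuallyLE, ae_restrict_iff' measurableSet_Ioc]
    filter_upwards [hae] with t h ht
    have h1 : v t - u t = G.projH (g t - u t) := by
      rw [← projHL_apply, map_sub, projHL_apply, projHL_apply, (h ht).1]
    rw [h1]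
    exact G.norm_projH_le _
  obtain ⟨α, hα, hα0⟩ := G.exists_isTrajectory p hT.le (u := v) hvs.continuous.continuousOn
  have hη := hC T γ u α v hu hα.isRightTrajectory (by rw [hα0, h0])
    (fun t ht => mem_image_of_mem _ ht) hvi
    (fun t ht => (hvs.continuous.continuousWithinAt.sub (hurc t ht)).norm)
    ((mul_le_mul_of_nonneg_left hvu hC0.le).trans_lt hδ2) T ⟨hT.le, le_rfl⟩
  have hend : ‖α T - q‖ < ε := by
    have := hρ _ ((hη.trans (mul_le_mul_of_nonneg_left hvu hC0.le)).trans_lt hδ3)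
    rwa [hTq, G.neg_mul_cancel_right] at this
  have hvlen : ∫ t in (0 : ℝ)..T, ‖v t‖ < r + ε := by
    have h1 : ∫ t in (0 : ℝ)..T, ‖v t‖ ≤ ∫ t in (0 : ℝ)..T, (‖u t‖ + ‖v t - u t‖) :=
      intervalIntegral.integral_mono_on hT.le (hvs.continuous.norm.intervalIntegrable _ _)
        (hui.norm.add hvi) fun t _ => by
          have := norm_add_le (u t) (v t - u t)
          rwa [add_sub_cancel] at this
    rw [intervalIntegral.integral_add hui.norm hvi] at h1
    linarith
  obtain ⟨θ, w, h1, h2, h3, h4, h5⟩ := hα.exists_unit_speed hvs hT hvlen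
  refine ⟨_, _, h1, h2, fun t => ?_, h3, by simp [h4, hα0], by simpa [h5] using hend.le⟩
  rw [projH_smul, hv, projH_projH]

end CarnotGroup

namespace ExpLieGroup

variable {n : ℕ} (G : ExpLieGroup n)

/-! ### The momentum map -/

/-- The momentum at `g` of a covector `ℓ` at the identity: the components of `Ad_g^* ℓ` in the
frame. Every solution of the normal geodesic equations has a momentum of this form, with `ℓ`
constant. -/
def momentum (ℓ : Coord n →L[ℝ] ℝ) (g : Coord n) : Coord n :=
  WithLp.toLp 2 fun I => ℓ (G.Ad g (EuclideanSpace.single I 1))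

theorem momentum_apply (ℓ : Coord n →L[ℝ] ℝ) (g : Coord n) (I : Fin n) :
    G.momentum ℓ g I = ℓ (G.Ad g (EuclideanSpace.single I 1)) := rfl

theorem inner_toLp_apply_single (L : Coord n →L[ℝ] ℝ) (v : Coord n) :
    inner ℝ v (WithLp.toLp 2 fun I => L (EuclideanSpace.single I 1)) = L v := by
  conv_rhs => rw [CarnotGroup.eq_sum_smul_single v, map_sum]
  simp only [PiLp.inner_apply, map_smul, smul_eq_mul]
  exact Finset.sum_congr rfl fun i _ => by simp [mul_comm]

theorem inner_momentum (ℓ : Coord n →L[ℝ] ℝ) (g v : Coord n) :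
    inner ℝ v (G.momentum ℓ g) = ℓ (G.Ad g v) :=
  inner_toLp_apply_single (ℓ.comp (G.Ad g)) v

theorem contDiff_momentum (ℓ : Coord n →L[ℝ] ℝ) : ContDiff ℝ ∞ (G.momentum ℓ) :=
  contDiff_euclidean.2 fun _ => ℓ.contDiff.comp (G.contDiff_Ad.clm_apply contDiff_const)

theorem hasDerivWithinAt_momentum (ℓ : Coord n →L[ℝ] ℝ) {γ : ℝ → Coord n} {u : Coord n}
    {s : Set ℝ} {t : ℝ} (hγ : HasDerivWithinAt γ (G.leftField u (γ t)) s t) :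
    HasDerivWithinAt (fun t => G.momentum ℓ (γ t))
      (WithLp.toLp 2 fun I => ℓ (G.Ad (γ t) (G.bracket u (EuclideanSpace.single I 1)))) s t := by
  rw [hasDerivWithinAt_iff_hasFDerivWithinAt, hasFDerivWithinAt_euclidean]
  intro I
  have h := (ℓ.hasFDerivAt.comp_hasDerivWithinAt t
    (G.hasDerivWithinAt_Ad hγ (EuclideanSpace.single I 1))).hasFDerivWithinAt
  convert! h using 1

end ExpLieGroup

/-! ### Integral inequalities -/

theorem sq_integral_le_mul_integral_sq {h : ℝ → ℝ} {R : ℝ} (hR : 0 < R)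
    (hh : ContinuousOn h (Icc 0 R)) :
    (∫ t in (0 : ℝ)..R, h t) ^ 2 ≤ R * ∫ t in (0 : ℝ)..R, h t ^ 2 := by
  set m := (∫ t in (0 : ℝ)..R, h t) / R with hm
  have i1 := hh.intervalIntegrable_of_Icc (μ := volume) hR.le
  have i2 : IntervalIntegrable (fun t => h t ^ 2) volume 0 R :=
    (hh.pow 2).intervalIntegrable_of_Icc hR.le
  have h1 : 0 ≤ ∫ t in (0 : ℝ)..R, (h t - m) ^ 2 :=
    intervalIntegral.integral_nonneg hR.le fun _ _ => sq_nonneg _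
  have e : ∀ t, (h t - m) ^ 2 = h t ^ 2 - 2 * m * h t + m ^ 2 := fun t => by ring
  simp only [e] at h1
  rw [intervalIntegral.integral_add (i2.sub (i1.const_mul _)) intervalIntegrable_const,
    intervalIntegral.integral_sub i2 (i1.const_mul _), intervalIntegral.integral_const_mul,
    intervalIntegral.integral_const, smul_eq_mul, sub_zero] at h1
  have e2 : ∫ t in (0 : ℝ)..R, h t = m * R := by rw [hm, div_mul_cancel₀ _ hR.ne']
  rw [e2] at h1 ⊢
  nlinarith

theorem integral_norm_smul_add_smul_sq {E : Type*} [NormedAddCommGroup E] [InnerProductSpace ℝ E]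
    {u g : ℝ → E} {R : ℝ} (hR : 0 ≤ R) (hu : ContinuousOn u (Icc 0 R))
    (hg : ContinuousOn g (Icc 0 R)) (a b : ℝ) :
    ∫ t in (0 : ℝ)..R, ‖a • u t + b • g t‖ ^ 2 =
      a ^ 2 * (∫ t in (0 : ℝ)..R, ‖u t‖ ^ 2) + 2 * a * b * (∫ t in (0 : ℝ)..R, inner ℝ (u t) (g t)) +
        b ^ 2 * ∫ t in (0 : ℝ)..R, ‖g t‖ ^ 2 := by
  have i1 : IntervalIntegrable (fun t => ‖u t‖ ^ 2) volume 0 R :=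
    (hu.norm.pow 2).intervalIntegrable_of_Icc hR
  have i2 := (hu.inner (𝕜 := ℝ) hg).intervalIntegrable_of_Icc (μ := volume) hR
  have i3 : IntervalIntegrable (fun t => ‖g t‖ ^ 2) volume 0 R :=
    (hg.norm.pow 2).intervalIntegrable_of_Icc hR
  rw [← intervalIntegral.integral_const_mul, ← intervalIntegral.integral_const_mul,
    ← intervalIntegral.integral_const_mul,
    ← intervalIntegral.integral_add (i1.const_mul _) (i2.const_mul _),
    ← intervalIntegral.integral_add ((i1.const_mul _).add (i2.const_mul _)) (i3.const_mul _)]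
  refine intervalIntegral.integral_congr fun t _ => ?_
  simp only [norm_add_sq_real, norm_smul, real_inner_smul_left, real_inner_smul_right, mul_pow,
    Real.norm_eq_abs, sq_abs]
  ring

namespace CarnotGroup

variable {n : ℕ} (G : CarnotGroup n)

/-- The horizontal momentum `(Ad_g^* ℓ)_H`. -/
def momentumH (ℓ : Coord n →L[ℝ] ℝ) (g : Coord n) : Coord n := G.projH (G.momentum ℓ g)

theorem projH_momentumH (ℓ : Coord n →L[ℝ] ℝ) (g : Coord n) :
    G.projH (G.momentumH ℓ g) = G.momentumH ℓ g := G.projH_projH _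

theorem contDiff_momentumH (ℓ : Coord n →L[ℝ] ℝ) : ContDiff ℝ ∞ (G.momentumH ℓ) :=
  G.contDiff_projH.comp (G.contDiff_momentum ℓ)

theorem inner_momentumH (ℓ : Coord n →L[ℝ] ℝ) (g v : Coord n) (hv : G.projH v = v) :
    inner ℝ v (G.momentumH ℓ g) = ℓ (G.Ad g v) := by
  rw [momentumH, G.inner_projH_right v _ hv, ExpLieGroup.inner_momentum]

/-- Evolution of the squared length of the horizontal momentum along a trajectory. It is conserved
when the velocity is parallel to the horizontal momentum. -/
theorem hasDerivWithinAt_norm_momentumH_sq (ℓ : Coord n →L[ℝ] ℝ) {γ : ℝ → Coord n} {u : Coord n}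
    {s : Set ℝ} {t : ℝ} (hγ : HasDerivWithinAt γ (G.leftField u (γ t)) s t) :
    HasDerivWithinAt (fun t => ‖G.momentumH ℓ (γ t)‖ ^ 2)
      (2 * ℓ (G.Ad (γ t) (G.bracket u (G.momentumH ℓ (γ t))))) s t := by
  have h1 := G.hasDerivWithinAt_momentum ℓ hγ
  have h2 := (G.projHL.hasFDerivAt.comp_hasDerivWithinAt t h1).norm_sq
  have e : inner ℝ (G.momentumH ℓ (γ t)) (G.projHL (WithLp.toLp 2 fun I =>
      ℓ (G.Ad (γ t) (G.bracket u (EuclideanSpace.single I 1))))) =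
      ℓ (G.Ad (γ t) (G.bracket u (G.momentumH ℓ (γ t)))) := by
    rw [projHL_apply, G.inner_projH_right _ _ (G.projH_momentumH ℓ _)]
    simp only [← ExpLieGroup.bracketL_apply]
    exact ExpLieGroup.inner_toLp_apply_single
      ((ℓ.comp (G.Ad (γ t))).comp (G.bracketL u)) (G.momentumH ℓ (γ t))
  rw [← e]
  exact h2

/-! ### Nearly minimizing trajectories have nearly parallel momentum -/

/-- `γ` runs from `p` to the `ε`-neighbourhood of `q` in time `r + ε`, with smooth horizontal
velocity `u` of length at most one. -/
structure IsNearlyMinimizing (p q : Coord n) (r ε : ℝ) (γ u : ℝ → Coord n) : Prop where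
  isTrajectory : G.IsTrajectory γ u (r + ε)
  contDiffOn : ContDiffOn ℝ ∞ u (Icc 0 (r + ε))
  projH_eq : ∀ t, G.projH (u t) = u t
  norm_le_one : ∀ t, ‖u t‖ ≤ 1
  apply_zero : γ 0 = p
  norm_sub_le : ‖γ (r + ε) - q‖ ≤ ε

/-- The norm of the horizontal momentum in `L²(0, R)`. -/
def momentumNorm (ℓ : Coord n →L[ℝ] ℝ) (γ : ℝ → Coord n) (R : ℝ) : ℝ :=
  Real.sqrt (∫ t in (0 : ℝ)..R, ‖G.momentumH ℓ (γ t)‖ ^ 2)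

/-- The defect in the Cauchy–Schwarz inequality in `L²(0, R)` between a velocity `u` with
`|u| ≤ 1` and the horizontal momentum, multiplied by the norm of the latter. -/
def alignmentDefect (ℓ : Coord n →L[ℝ] ℝ) (γ u : ℝ → Coord n) (R : ℝ) : ℝ :=
  G.momentumNorm ℓ γ R * (Real.sqrt R * G.momentumNorm ℓ γ R -
    ∫ t in (0 : ℝ)..R, inner ℝ (u t) (G.momentumH ℓ (γ t)))

variable {G}

/-- First order expansion of `f (z w)` near `z = 0` and `w = q`, as a lower bound. -/
theorem exists_forall_sub_le_apply_mul {f : Coord n → ℝ} {q : Coord n}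
    (hf : DifferentiableAt ℝ f q) (hq : f q = 0) :
    ∃ m : ℝ, 0 ≤ m ∧ ∀ κ > 0, ∃ ρ > 0, ∀ z w : Coord n, ‖z‖ < ρ → ‖w - q‖ < ρ →
      fderiv ℝ (fun z => f (G.mul z q)) 0 z - κ * ‖z‖ - (κ + m) * ‖w - q‖ ≤ f (G.mul z w) := by
  set ℓ := fderiv ℝ (fun z => f (G.mul z q)) 0 with hℓ
  have hmul : DifferentiableAt ℝ (fun p : Coord n × Coord n => G.mul p.1 p.2) (0, q) :=
    G.smooth_mul.differentiable (by simp) _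
  have hΨ : DifferentiableAt ℝ (fun p : Coord n × Coord n => f (G.mul p.1 p.2)) (0, q) :=
    DifferentiableAt.comp (g := f) (0, q) (by simpa [G.zero_mul] using hf) hmul
  set Λ := fderiv ℝ (fun p : Coord n × Coord n => f (G.mul p.1 p.2)) (0, q) with hΛ
  have hΛℓ : ∀ z, Λ (z, 0) = ℓ z := by
    intro z
    have h1 : HasFDerivAt (fun z : Coord n => (z, q)) (ContinuousLinearMap.inl ℝ _ _) 0 :=
      hasFDerivAt_prodMk_left 0 q
    have h2 := (HasFDerivAt.comp (f := fun z : Coord n => (z, q)) (0 : Coord n)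
      hΨ.hasFDerivAt h1).fderiv
    exact (DFunLike.congr_fun h2 z).symm
  refine ⟨‖Λ.comp (ContinuousLinearMap.inr ℝ _ _)‖, norm_nonneg _, fun κ hκ => ?_⟩
  have h1 := hΨ.hasFDerivAt.isLittleO.def hκ
  obtain ⟨ρ, hρ, h⟩ := Metric.eventually_nhds_iff.1 h1
  refine ⟨ρ, hρ, fun z w hz hw => ?_⟩
  have h2 := @h (z, w) (by
    rw [Prod.dist_eq]; exact max_lt (by simpa using hz) (by simpa [dist_eq_norm] using hw))
  have h3 : Λ ((z, w) - (0, q)) = ℓ z + Λ.comp (ContinuousLinearMap.inr ℝ _ _) (w - q) := by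
    rw [← hΛℓ, ContinuousLinearMap.comp_apply, ContinuousLinearMap.inr_apply, ← map_add]
    simp
  have h4 := (Λ.comp (ContinuousLinearMap.inr ℝ _ _)).le_opNorm (w - q)
  have h5 : ‖((z, w) : Coord n × Coord n) - (0, q)‖ ≤ ‖z‖ + ‖w - q‖ := by
    rw [Prod.norm_def]
    exact max_le (by simp) (by simp)
  simp only [G.zero_mul, hq, sub_zero] at h2
  rw [← hΛ, h3, Real.norm_eq_abs] at h2
  have h6 := (abs_le.1 h2).1
  have h7 := (abs_le.1 (Real.norm_eq_abs _ ▸ h4)).1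
  have h8 := mul_le_mul_of_nonneg_left h5 hκ.le
  linarith

theorem momentumNorm_nonneg (ℓ : Coord n →L[ℝ] ℝ) (γ : ℝ → Coord n) (R : ℝ) :
    0 ≤ G.momentumNorm ℓ γ R := Real.sqrt_nonneg _

theorem momentumNorm_sq (ℓ : Coord n →L[ℝ] ℝ) (γ : ℝ → Coord n) {R : ℝ} (hR : 0 ≤ R) :
    G.momentumNorm ℓ γ R ^ 2 = ∫ t in (0 : ℝ)..R, ‖G.momentumH ℓ (γ t)‖ ^ 2 :=
  Real.sq_sqrt (intervalIntegral.integral_nonneg hR fun _ _ => by positivity)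

theorem momentumNorm_le {ℓ : Coord n →L[ℝ] ℝ} {γ : ℝ → Coord n} {R M : ℝ} (hR : 0 ≤ R)
    (hγ : ContinuousOn γ (Icc 0 R)) (hM0 : 0 ≤ M)
    (hM : ∀ t ∈ Icc 0 R, ‖G.momentumH ℓ (γ t)‖ ≤ M) :
    G.momentumNorm ℓ γ R ≤ M * Real.sqrt R := by
  have hgc : ContinuousOn (fun t => G.momentumH ℓ (γ t)) (Icc 0 R) :=
    (G.contDiff_momentumH ℓ).continuous.comp_continuousOn hγ
  have h1 : ∫ t in (0 : ℝ)..R, ‖G.momentumH ℓ (γ t)‖ ^ 2 ≤ ∫ t in (0 : ℝ)..R, M ^ 2 :=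
    intervalIntegral.integral_mono_on hR
      ((hgc.norm.pow 2).intervalIntegrable_of_Icc hR) intervalIntegrable_const
      fun t ht => by have := hM t ht; gcongr
  rw [intervalIntegral.integral_const, smul_eq_mul, sub_zero, ← momentumNorm_sq ℓ γ hR] at h1
  refine abs_le_of_sq_le_sq' ?_ (by positivity) |>.2
  rw [mul_pow, Real.sq_sqrt hR]
  linarith

theorem integral_norm_sq_le {u : ℝ → Coord n} {R : ℝ} (hR : 0 ≤ R)
    (hu : ContinuousOn u (Icc 0 R)) (h1 : ∀ t, ‖u t‖ ≤ 1) : ∫ t in (0 : ℝ)..R, ‖u t‖ ^ 2 ≤ R := by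
  have h1 : ∫ t in (0 : ℝ)..R, ‖u t‖ ^ 2 ≤ ∫ t in (0 : ℝ)..R, (1 : ℝ) :=
    intervalIntegral.integral_mono_on hR
      ((hu.norm.pow 2).intervalIntegrable_of_Icc hR) intervalIntegrable_const
      fun t _ => pow_le_one₀ (norm_nonneg _) (h1 t)
  simpa using h1

/-- The trajectory obtained by turning the velocity `u` towards the horizontal momentum: the gain
in energy and the displacement of the endpoint are both governed, to first order in the size `s` of
the variation, by the defect in the Cauchy–Schwarz inequality between the two. -/
theorem exists_forall_variation (G : CarnotGroup n) (ℓ : Coord n →L[ℝ] ℝ) {K : Set (Coord n)}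
    (hK : IsCompact K) :
    ∃ C : ℝ, 0 < C ∧ ∀ (R s M : ℝ) (γ u : ℝ → Coord n), 0 < R → 0 < s → 0 ≤ M →
      G.IsTrajectory γ u R → ContDiffOn ℝ ∞ u (Icc 0 R) → (∀ t, G.projH (u t) = u t) →
      (∀ t, ‖u t‖ ≤ 1) → (∀ t ∈ Icc 0 R, γ t ∈ K) →
      (∀ t ∈ Icc 0 R, ‖G.momentumH ℓ (γ t)‖ ≤ M) → s * G.momentumNorm ℓ γ R ≤ 1 / 2 →
      C * (s * (2 * M * Real.sqrt R * R)) < 1 →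
      0 ≤ Real.sqrt R * G.momentumNorm ℓ γ R -
        ∫ t in (0 : ℝ)..R, inner ℝ (u t) (G.momentumH ℓ (γ t)) →
      ∃ α v : ℝ → Coord n, G.IsTrajectory α v R ∧ ContDiffOn ℝ ∞ v (Icc 0 R) ∧
        (∀ t, G.projH (v t) = v t) ∧ α 0 = γ 0 ∧
        (∫ t in (0 : ℝ)..R, ‖v t‖) ^ 2 ≤ R * (R - s * Real.sqrt R * (Real.sqrt R *
          G.momentumNorm ℓ γ R - ∫ t in (0 : ℝ)..R, inner ℝ (u t) (G.momentumH ℓ (γ t)))) ∧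
        ‖G.mul (α R) (-(γ R))‖ ≤ C * (s * (2 * M * Real.sqrt R * R)) ∧
        s * G.alignmentDefect ℓ γ u R - C * (s * (2 * M * Real.sqrt R * R)) ^ 2 ≤
          ℓ (G.mul (α R) (-(γ R))) := by
  obtain ⟨C, hC0, hC⟩ := G.exists_forall_norm_mul_neg_sub_integral_le hK
  refine ⟨C * (1 + ‖ℓ‖), by positivity, ?_⟩
  intro R s M γ u hR0 hs0 hM0 hγ hus huH hu1 hγK hgM hsA hsmall hD0
  rw [alignmentDefect]
  set H := 2 * M * Real.sqrt R * R with hH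
  set B := Real.sqrt R with hB
  have hB0 : 0 < B := Real.sqrt_pos.2 hR0
  have hBB : B ^ 2 = R := Real.sq_sqrt hR0.le
  have huc : ContinuousOn u (Icc 0 R) := hus.continuousOn
  have hγc : ContinuousOn γ (Icc 0 R) := hγ.continuousOn
  set g : ℝ → Coord n := fun t => G.momentumH ℓ (γ t) with hg
  have hgc : ContinuousOn g (Icc 0 R) := (G.contDiff_momentumH ℓ).continuous.comp_continuousOn hγc
  have hAM : G.momentumNorm ℓ γ R ≤ M * B := momentumNorm_le hR0.le hγc hM0 hgM
  have hA0 : 0 ≤ G.momentumNorm ℓ γ R := momentumNorm_nonneg ℓ γ R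
  have hAsq : G.momentumNorm ℓ γ R ^ 2 = ∫ t in (0 : ℝ)..R, ‖g t‖ ^ 2 :=
    momentumNorm_sq ℓ γ hR0.le
  generalize G.momentumNorm ℓ γ R = A at *
  set I := ∫ t in (0 : ℝ)..R, inner ℝ (u t) (g t) with hI
  have hE := integral_norm_sq_le hR0.le huc hu1
  -- Let `A = ‖g‖` and `B = √R ≥ ‖u‖`, norms in `L²`, and `I = ⟨u, g⟩`. The direction `B g - A u` has
  -- with `g` the inner product `A (A B - I)` and, if `‖u‖ = B`, with `u` the product `-B (A B - I)`:
  -- both the displacement and the loss of energy are proportional to `A B - I`.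
  set v : ℝ → Coord n := fun t => (1 - s * A) • u t + (s * B) • g t with hv
  have hvu : ∀ t, v t - u t = (-(s * A)) • u t + (s * B) • g t := fun t => by
    simp only [hv]; module
  have hvc : ContinuousOn v (Icc 0 R) :=
    (huc.const_smul (1 - s * A)).add (hgc.const_smul (s * B))
  have hgs : ContDiffOn ℝ ∞ g (Icc 0 R) :=
    (G.contDiff_momentumH ℓ).comp_contDiffOn (hγ.contDiffOn hus)
  have hvs : ContDiffOn ℝ ∞ v (Icc 0 R) :=
    (hus.const_smul (1 - s * A)).add (hgs.const_smul (s * B))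
  have hvH : ∀ t, G.projH (v t) = v t := by
    intro t
    simp only [hv]
    rw [← projHL_apply, map_add, map_smul, map_smul, projHL_apply, projHL_apply, huH,
      projH_momentumH]
  have hvuH : ∀ t, G.projH (v t - u t) = v t - u t := by
    intro t
    rw [← projHL_apply, map_sub, projHL_apply, projHL_apply, hvH, huH]
  obtain ⟨α, hα, hα0⟩ := G.exists_isTrajectory (γ 0) hR0.le hvc
  refine ⟨α, v, hα, hvs, hvH, hα0, ?_, ?_⟩
  · -- the energy, hence the length
    have hEv : ∫ t in (0 : ℝ)..R, ‖v t‖ ^ 2 ≤ R - s * B * (B * A - I) := by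
      have h1 := integral_norm_smul_add_smul_sq hR0.le huc hgc (1 - s * A) (s * B)
      rw [← hAsq, ← hI] at h1
      simp only [hv]
      rw [h1]
      have h2 : (1 - s * A) ^ 2 * (∫ t in (0 : ℝ)..R, ‖u t‖ ^ 2) ≤ (1 - s * A) ^ 2 * B ^ 2 := by
        rw [hBB]; gcongr
      have h4 : 0 ≤ (1 / 2 - s * A) * (s * B * (B * A - I)) :=
        mul_nonneg (by linarith) (by positivity)
      generalize (∫ t in (0 : ℝ)..R, ‖u t‖ ^ 2) = E at h2 ⊢
      linarith
    exact (sq_integral_le_mul_integral_sq hR0 hvc.norm).trans (by gcongr)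
  -- the displacement of the endpoint
  have hJ : ∫ t in (0 : ℝ)..R, ‖v t - u t‖ ≤ s * H := by
    have h1 : ∫ t in (0 : ℝ)..R, ‖v t - u t‖ ≤ ∫ t in (0 : ℝ)..R, s * (2 * M * B) := by
      refine intervalIntegral.integral_mono_on hR0.le
        ((hvc.sub huc).norm.intervalIntegrable_of_Icc hR0.le) intervalIntegrable_const
        fun t ht => ?_
      rw [hvu]
      refine (norm_add_le _ _).trans ?_
      rw [norm_smul, norm_smul, norm_neg, Real.norm_of_nonneg (by positivity : 0 ≤ s * A),
        Real.norm_of_nonneg (by positivity : 0 ≤ s * B)]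
      have h2 := hu1 t
      have h3 := hgM t ht
      calc s * A * ‖u t‖ + s * B * ‖g t‖ ≤ s * (M * B) * 1 + s * B * M := by gcongr
        _ = _ := by ring
    rw [intervalIntegral.integral_const, smul_eq_mul, sub_zero] at h1
    exact h1.trans_eq (by rw [hH]; ring)
  have hJ0 : 0 ≤ ∫ t in (0 : ℝ)..R, ‖v t - u t‖ :=
    intervalIntegral.integral_nonneg hR0.le fun _ _ => norm_nonneg _
  have hsH : 0 ≤ s * H := hJ0.trans hJ
  have hCC : C ≤ C * (1 + ‖ℓ‖) :=
    le_mul_of_one_le_right hC0.le (by linarith [norm_nonneg ℓ])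
  obtain ⟨hη1, hη2⟩ := hC R γ u α v hR0.le hγ hα hα0 hγK huc hvc
    ((mul_le_mul hCC hJ hJ0 (by positivity)).trans_lt hsmall)
  set η := G.mul (α R) (-(γ R)) with hη
  have hη2' : ‖η - ∫ t in (0 : ℝ)..R, G.Ad (γ t) (v t - u t)‖ ≤ C * (s * H) ^ 2 :=
    hη2.trans (by gcongr)
  have hwork : ℓ (∫ t in (0 : ℝ)..R, G.Ad (γ t) (v t - u t)) = s * (A * (B * A - I)) := by
    have hAc : ContinuousOn (fun t => G.Ad (γ t) (v t - u t)) (Icc 0 R) :=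
      (G.contDiff_Ad.continuous.comp_continuousOn hγc).clm_apply (hvc.sub huc)
    rw [← ContinuousLinearMap.intervalIntegral_comp_comm ℓ (hAc.intervalIntegrable_of_Icc hR0.le)]
    have e : ∀ t, ℓ (G.Ad (γ t) (v t - u t)) =
        (-(s * A)) * inner ℝ (u t) (g t) + (s * B) * ‖g t‖ ^ 2 := by
      intro t
      rw [← G.inner_momentumH ℓ _ _ (hvuH t), hvu, inner_add_left, real_inner_smul_left,
        real_inner_smul_left, real_inner_self_eq_norm_sq]
    have i1 : IntervalIntegrable (fun t => inner ℝ (u t) (g t)) volume 0 R :=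
      (huc.inner (𝕜 := ℝ) hgc).intervalIntegrable_of_Icc hR0.le
    have i2 : IntervalIntegrable (fun t => ‖g t‖ ^ 2) volume 0 R :=
      (hgc.norm.pow 2).intervalIntegrable_of_Icc hR0.le
    simp only [e]
    rw [intervalIntegral.integral_add (i1.const_mul _) (i2.const_mul _),
      intervalIntegral.integral_const_mul, intervalIntegral.integral_const_mul, ← hI, ← hAsq]
    ring
  refine ⟨hη1.trans (mul_le_mul hCC hJ hJ0 (by positivity)), ?_⟩
  have h1 := ℓ.le_opNorm (η - ∫ t in (0 : ℝ)..R, G.Ad (γ t) (v t - u t))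
  rw [map_sub, hwork, Real.norm_eq_abs] at h1
  have h2 := (abs_le.1 (h1.trans (mul_le_mul_of_nonneg_left hη2' (norm_nonneg _)))).1
  have h3 : 0 ≤ C * (s * H) ^ 2 := by positivity
  linarith

/-- If all points at distance less than `r` from `p` satisfy `f < 0`, then the velocity of a nearly
minimizing trajectory is almost aligned with its horizontal momentum: otherwise turning it towards
the momentum would shorten the trajectory below `r` and make `f` positive at its endpoint. -/
theorem exists_forall_alignmentDefect_lt {f : Coord n → ℝ} {p q : Coord n} {r : ℝ} (hr : 0 < r)
    (hf : DifferentiableAt ℝ f q) (hq : f q = 0) (hball : ∀ z ∈ G.ccBall p r, f z < 0)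
    {δ : ℝ} (hδ : 0 < δ) :
    ∃ ε₀ > 0, ∀ ε, 0 < ε → ε < ε₀ → ∀ γ u, G.IsNearlyMinimizing p q r ε γ u →
      G.alignmentDefect (fderiv ℝ (fun z => f (G.mul z q)) 0) γ u (r + ε) < δ := by
  obtain ⟨m, hm0, hm⟩ := exists_forall_sub_le_apply_mul (G := G) hf hq
  set ℓ := fderiv ℝ (fun z => f (G.mul z q)) 0 with hℓ
  obtain ⟨K, hK, hKmem⟩ := G.exists_isCompact_forall_trajectory_mem p 1 (r + 1)
  obtain ⟨C, hC0, hC⟩ := G.exists_forall_variation ℓ hK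
  obtain ⟨M₀, hM₀⟩ := hK.exists_bound_of_continuousOn
    (G.contDiff_momentumH ℓ).continuous.continuousOn
  set M := max M₀ 1 with hMdef
  have hM0 : 0 < M := lt_max_of_lt_right one_pos
  have hM : ∀ z ∈ K, ‖G.momentumH ℓ z‖ ≤ M := fun z hz => (hM₀ z hz).trans (le_max_left _ _)
  clear_value M
  set Q := r + 1 with hQ
  have hQ1 : 1 ≤ Q := by linarith
  set H := 2 * M * Q * Q with hH
  have hH0 : 0 < H := by positivity
  set κ := δ / (4 * (C * H)) with hκ
  have hκ0 : 0 < κ := by positivity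
  have hκ1 : κ * (C * H) = δ / 4 := by rw [hκ]; field_simp
  clear_value κ
  obtain ⟨ρ, hρ0, hρ⟩ := hm κ hκ0
  -- the size `s` of the variation
  obtain ⟨s, hs0, hs1, hs2, hs3, hs4⟩ : ∃ s > 0, C * H ^ 2 * s ≤ δ / 4 ∧ C * (s * H) < ρ ∧
      C * (s * H) < 1 ∧ s * (M * Q) ≤ 1 / 2 := by
    have hev : ∀ᶠ s in 𝓝[>] (0 : ℝ), C * H ^ 2 * s < δ / 4 ∧ C * (s * H) < ρ ∧
      C * (s * H) < 1 ∧ s * (M * Q) < 1 / 2 := by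
      have hlim : ∀ (φ : ℝ → ℝ), Continuous φ → φ 0 = 0 → ∀ c > 0, ∀ᶠ s in 𝓝[>] (0 : ℝ), φ s < c :=
        fun φ hφ h0 c hc => (hφ.tendsto' 0 0 h0).mono_left nhdsWithin_le_nhds |>.eventually
          (gt_mem_nhds hc)
      exact (hlim _ (by fun_prop) (by simp) _ (by positivity)).and
        ((hlim _ (by fun_prop) (by simp) _ hρ0).and ((hlim _ (by fun_prop) (by simp) _ one_pos).and
          (hlim _ (by fun_prop) (by simp) _ (by norm_num))))
    obtain ⟨s, hs, hs0⟩ := (hev.and self_mem_nhdsWithin).exists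
    exact ⟨s, hs0, hs.1.le, hs.2.1, hs.2.2.1, hs.2.2.2.le⟩
  set ε₀ := min 1 (min ρ (min (s * δ / (4 * (κ + m))) (r * s * δ / (M * (2 * r + 1))))) with hε₀
  have hε₀0 : 0 < ε₀ := by positivity
  refine ⟨ε₀, hε₀0, fun ε hε hεε₀ γ u hγ => ?_⟩
  by_contra! hdef
  have hε1 : ε < 1 := hεε₀.trans_le (min_le_left _ _)
  have hερ : ε < ρ := hεε₀.trans_le ((min_le_right _ _).trans (min_le_left _ _))
  have hε3 : (κ + m) * ε < s * δ / 4 := by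
    have h1 : ε < s * δ / (4 * (κ + m)) :=
      hεε₀.trans_le ((min_le_right _ _).trans ((min_le_right _ _).trans (min_le_left _ _)))
    rw [lt_div_iff₀ (by positivity)] at h1
    linarith
  have hε4 : ε * (M * (2 * r + 1)) < r * s * δ := by
    have h1 : ε < r * s * δ / (M * (2 * r + 1)) :=
      hεε₀.trans_le ((min_le_right _ _).trans ((min_le_right _ _).trans (min_le_right _ _)))
    rwa [lt_div_iff₀ (by positivity)] at h1
  clear_value ε₀
  obtain ⟨R, hR⟩ : ∃ R, R = r + ε := ⟨_, rfl⟩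
  rw [← hR] at hdef
  have hR0 : 0 < R := by linarith
  have hRQ : R ≤ Q := by linarith
  have hB0 : 0 < Real.sqrt R := Real.sqrt_pos.2 hR0
  have hBQ : Real.sqrt R ≤ Q := Real.sqrt_le_iff.2 ⟨by linarith, by nlinarith⟩
  have htraj : G.IsTrajectory γ u R := hR ▸ hγ.isTrajectory
  have hus : ContDiffOn ℝ ∞ u (Icc 0 R) := hR ▸ hγ.contDiffOn
  have hend : ‖γ R - q‖ ≤ ε := hR ▸ hγ.norm_sub_le
  have hγK : ∀ t ∈ Icc 0 R, γ t ∈ K := hKmem R γ u hRQ htraj.isRightTrajectory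
    hγ.apply_zero fun t _ => hγ.norm_le_one t
  have hgM : ∀ t ∈ Icc 0 R, ‖G.momentumH ℓ (γ t)‖ ≤ M := fun t ht => hM _ (hγK t ht)
  have hAM := momentumNorm_le hR0.le htraj.continuousOn hM0.le hgM
  have hA0 : 0 ≤ G.momentumNorm ℓ γ R := momentumNorm_nonneg ℓ γ R
  have hAD0 := hδ.trans_le hdef
  have hD0 := pos_of_mul_pos_right hAD0 hA0
  have hHs : s * (2 * M * Real.sqrt R * R) ≤ s * H := by rw [hH]; gcongr
  have hHs0 : 0 ≤ s * (2 * M * Real.sqrt R * R) := by positivity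
  have hCs : C * (s * (2 * M * Real.sqrt R * R)) ≤ C * (s * H) := by gcongr
  obtain ⟨α, v, hα, hvs, hvH, hα0, hlen, hη1, hη2⟩ := hC R s M γ u hR0 hs0 hM0.le htraj hus
    hγ.projH_eq hγ.norm_le_one hγK hgM
    (le_trans (by
      have : G.momentumNorm ℓ γ R ≤ M * Q := hAM.trans (by gcongr)
      gcongr) hs4) (hCs.trans_lt hs3) hD0.le
  -- the energy gained by the variation outweighs the excess time `ε`
  have hlen' : ∫ t in (0 : ℝ)..R, ‖v t‖ < r := by
    refine lt_of_pow_lt_pow_left₀ 2 hr.le (hlen.trans_lt ?_)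
    rw [alignmentDefect] at hdef
    generalize Real.sqrt R * G.momentumNorm ℓ γ R -
      ∫ t in (0 : ℝ)..R, inner ℝ (u t) (G.momentumH ℓ (γ t)) = D at *
    generalize G.momentumNorm ℓ γ R = A at *
    generalize Real.sqrt R = B at *
    have h2 : δ ≤ M * (B * D) := by
      calc δ ≤ A * D := hdef
        _ ≤ M * B * D := by gcongr
        _ = _ := by ring
    refine lt_of_mul_lt_mul_left ?_ hM0.le
    have h5 : s * r * δ ≤ s * r * (M * (B * D)) := by gcongr
    have h6 : s * r * (M * (B * D)) ≤ s * R * (M * (B * D)) := by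
      have : r ≤ R := by linarith
      gcongr
    have h7 : M * (R * R) ≤ M * r ^ 2 + ε * (M * (2 * r + 1)) := by
      have : M * (ε * ε) ≤ M * (ε * 1) := by gcongr
      rw [hR]
      linarith
    linarith
  have hneg : f (α R) < 0 := by
    refine hball _ ?_
    have h1 := ccDist_le_of_isTrajectory hR0.le hα hvs fun t _ => hvH t
    rw [hα0, hγ.apply_zero] at h1
    exact h1.trans_lt ((ENNReal.ofReal_lt_ofReal_iff hr).2 hlen')
  have hfin := hρ _ (γ R) ((hη1.trans hCs).trans_lt hs2) (hend.trans_lt hερ)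
  rw [G.neg_mul_cancel_right] at hfin
  have h1 : κ * ‖G.mul (α R) (-(γ R))‖ ≤ s * (δ / 4) := by
    calc κ * ‖G.mul (α R) (-(γ R))‖ ≤ κ * (C * (s * H)) := by gcongr; exact hη1.trans hCs
      _ = s * (κ * (C * H)) := by ring
      _ = _ := by rw [hκ1]
  have h2 : (κ + m) * ‖γ R - q‖ ≤ (κ + m) * ε := by gcongr
  have h3 : C * (s * (2 * M * Real.sqrt R * R)) ^ 2 ≤ s * (δ / 4) := by
    calc C * (s * (2 * M * Real.sqrt R * R)) ^ 2 ≤ C * (s * H) ^ 2 := by gcongr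
      _ = s * (C * H ^ 2 * s) := by ring
      _ ≤ s * (δ / 4) := by gcongr
  have h4 : s * δ ≤ s * G.alignmentDefect ℓ γ u R := by gcongr
  have h5 : 0 < s * δ := by positivity
  linarith

/-- The `L²` distance between the normalized velocity and momentum is controlled by the alignment
defect. -/
theorem sq_integral_norm_smul_sub_smul_le {ℓ : Coord n →L[ℝ] ℝ} {γ u : ℝ → Coord n} {R : ℝ}
    (hR : 0 < R) (hγ : ContinuousOn γ (Icc 0 R)) (hu : ContinuousOn u (Icc 0 R))
    (h1 : ∀ t, ‖u t‖ ≤ 1) :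
    (∫ t in (0 : ℝ)..R, ‖G.momentumNorm ℓ γ R • u t - Real.sqrt R • G.momentumH ℓ (γ t)‖) ^ 2 ≤
      2 * R * Real.sqrt R * G.alignmentDefect ℓ γ u R := by
  have hgc : ContinuousOn (fun t => G.momentumH ℓ (γ t)) (Icc 0 R) :=
    (G.contDiff_momentumH ℓ).continuous.comp_continuousOn hγ
  have hc : ContinuousOn (fun t => G.momentumNorm ℓ γ R • u t - Real.sqrt R • G.momentumH ℓ (γ t))
      (Icc 0 R) :=
    (hu.const_smul (G.momentumNorm ℓ γ R)).sub (hgc.const_smul (Real.sqrt R))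
  refine (sq_integral_le_mul_integral_sq hR hc.norm).trans ?_
  have h2 := integral_norm_smul_add_smul_sq hR.le hu hgc (G.momentumNorm ℓ γ R) (-Real.sqrt R)
  simp only [neg_smul, ← sub_eq_add_neg] at h2
  rw [h2, ← momentumNorm_sq ℓ γ hR.le, alignmentDefect]
  have hE := integral_norm_sq_le hR.le hu h1
  have hBB := Real.sq_sqrt hR.le
  have h3 : G.momentumNorm ℓ γ R ^ 2 * (∫ t in (0 : ℝ)..R, ‖u t‖ ^ 2) ≤
      G.momentumNorm ℓ γ R ^ 2 * Real.sqrt R ^ 2 := by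
    rw [hBB]; gcongr
  generalize Real.sqrt R = B at *
  generalize (∫ t in (0 : ℝ)..R, ‖u t‖ ^ 2) = E at *
  generalize (∫ t in (0 : ℝ)..R, inner ℝ (u t) (G.momentumH ℓ (γ t))) = I at *
  generalize G.momentumNorm ℓ γ R = A at *
  calc _ ≤ R * (A ^ 2 * B ^ 2 + 2 * A * -B * I + (-B) ^ 2 * A ^ 2) := by gcongr
    _ = _ := by ring

/-- The horizontal momentum of a trajectory has almost constant length if the velocity is almost
parallel to it. -/
theorem exists_forall_abs_norm_momentumH_sq_sub_le (G : CarnotGroup n) (ℓ : Coord n →L[ℝ] ℝ)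
    {K : Set (Coord n)} (hK : IsCompact K) :
    ∃ C : ℝ, 0 < C ∧ ∀ (R a b : ℝ) (γ u : ℝ → Coord n), 0 < R → 0 < b → G.IsTrajectory γ u R →
      ContinuousOn u (Icc 0 R) → (∀ t, ‖u t‖ ≤ 1) → (∀ t ∈ Icc 0 R, γ t ∈ K) →
      ∀ t ∈ Icc 0 R, b * |‖G.momentumH ℓ (γ t)‖ ^ 2 - ‖G.momentumH ℓ (γ R)‖ ^ 2| ≤
        C * ∫ t in (0 : ℝ)..R, ‖a • u t - b • G.momentumH ℓ (γ t)‖ := by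
  obtain ⟨C₁, hC₁⟩ := hK.exists_bound_of_continuousOn G.contDiff_Ad.continuous.continuousOn
  refine ⟨2 * (‖ℓ‖ * (|C₁| * ‖G.bracketL‖)) + 1, by positivity, ?_⟩
  intro R a b γ u hR hb hγ hu hu1 hγK t ht
  set g : ℝ → Coord n := fun t => G.momentumH ℓ (γ t) with hg
  have hgc : ContinuousOn g (Icc 0 R) :=
    (G.contDiff_momentumH ℓ).continuous.comp_continuousOn hγ.continuousOn
  have hec : ContinuousOn (fun t => a • u t - b • g t) (Icc 0 R) :=
    (hu.const_smul a).sub (hgc.const_smul b)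
  have hsub : Icc t R ⊆ Icc 0 R := Icc_subset_Icc_left ht.1
  have hfc : ContinuousOn (fun s => 2 * ℓ (G.Ad (γ s) (G.bracketL (u s) (g s)))) (Icc 0 R) :=
    continuousOn_const.mul (ℓ.continuous.comp_continuousOn
      ((G.contDiff_Ad.continuous.comp_continuousOn hγ.continuousOn).clm_apply
        ((G.bracketL.continuous.comp_continuousOn hu).clm_apply hgc)))
  have hgsq : ContinuousOn (fun s => ‖g s‖ ^ 2) (Icc 0 R) := hgc.norm.pow 2
  have hftc := intervalIntegral.integral_eq_sub_of_hasDerivAt_of_le ht.2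
    (hgsq.mono hsub)
    (fun s hs => ((G.hasDerivWithinAt_norm_momentumH_sq ℓ (hγ s (hsub (Ioo_subset_Icc_self hs)))
      ).hasDerivAt (Icc_mem_nhds (ht.1.trans_lt hs.1) hs.2)))
    (by simpa only [ExpLieGroup.bracketL_apply] using
      (hfc.mono hsub).intervalIntegrable_of_Icc ht.2)
  have hpt : ∀ s ∈ Icc 0 R, b * |2 * ℓ (G.Ad (γ s) (G.bracket (u s) (g s)))| ≤
      (2 * (‖ℓ‖ * (|C₁| * ‖G.bracketL‖)) + 1) * ‖a • u s - b • g s‖ := by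
    intro s hs
    -- the bracket of `u` with `b g` only sees the difference `a u - b g`, as `[u, u] = 0`
    have e1 : b * (2 * ℓ (G.Ad (γ s) (G.bracket (u s) (g s)))) =
        -(2 * ℓ (G.Ad (γ s) (G.bracketL (u s) (a • u s - b • g s)))) := by
      rw [map_sub, map_smul, map_smul, ExpLieGroup.bracketL_apply, ExpLieGroup.bracketL_apply,
        ExpLieGroup.bracket_self, smul_zero, zero_sub, map_neg, map_neg, map_smul, map_smul,
        smul_eq_mul]
      ring
    have e2 : b * |2 * ℓ (G.Ad (γ s) (G.bracket (u s) (g s)))| =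
        2 * |ℓ (G.Ad (γ s) (G.bracketL (u s) (a • u s - b • g s)))| := by
      rw [← abs_of_pos hb, ← abs_mul, abs_of_pos hb, e1, abs_neg, abs_mul, abs_two]
    rw [e2]
    have h1 : ‖G.bracketL (u s) (a • u s - b • g s)‖ ≤ ‖G.bracketL‖ * 1 * ‖a • u s - b • g s‖ :=
      (G.bracketL.le_opNorm₂ _ _).trans (by have := hu1 s; gcongr)
    have h2 := (hC₁ _ (hγK s hs)).trans (le_abs_self _)
    have h3 : ‖G.Ad (γ s) (G.bracketL (u s) (a • u s - b • g s))‖ ≤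
        |C₁| * (‖G.bracketL‖ * 1 * ‖a • u s - b • g s‖) :=
      ((G.Ad (γ s)).le_opNorm _).trans (by gcongr)
    have h4 : |ℓ (G.Ad (γ s) (G.bracketL (u s) (a • u s - b • g s)))| ≤
        ‖ℓ‖ * (|C₁| * (‖G.bracketL‖ * 1 * ‖a • u s - b • g s‖)) :=
      (ℓ.le_opNorm _).trans (by gcongr)
    have h5 := norm_nonneg (a • u s - b • g s)
    linarith
  generalize 2 * (‖ℓ‖ * (|C₁| * ‖G.bracketL‖)) + 1 = C at hpt ⊢
  rw [abs_sub_comm, ← abs_of_pos hb, ← abs_mul, abs_of_pos hb]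
  simp only [hg] at hftc
  rw [← hftc, ← intervalIntegral.integral_const_mul, ← intervalIntegral.integral_const_mul]
  have iC : IntervalIntegrable (fun t => C * ‖a • u t - b • g t‖) volume 0 R :=
    (continuousOn_const.mul hec.norm).intervalIntegrable_of_Icc hR.le
  rw [← Real.norm_eq_abs]
  refine (intervalIntegral.norm_integral_le_of_norm_le (g := fun t => C * ‖a • u t - b • g t‖) ht.2
    (Eventually.of_forall fun s hs => ?_) (iC.mono_set ?_)).trans ?_
  · rw [Real.norm_eq_abs, abs_mul, abs_of_pos hb]
    exact hpt s (hsub (Ioc_subset_Icc_self hs))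
  · rw [uIcc_of_le ht.2, uIcc_of_le hR.le]
    exact hsub
  · refine intervalIntegral.integral_mono_interval ht.1 ht.2 le_rfl ?_ iC
    rw [Filter.EventuallyLE, ae_restrict_iff' measurableSet_Ioc]
    exact Eventually.of_forall fun s hs => (by positivity : (0 : ℝ) ≤ b * _).trans
      (hpt s (Ioc_subset_Icc_self hs))

/-- Along nearly minimizing trajectories the velocity converges in `L¹` to the horizontal momentum,
normalized by its length at the endpoint. -/
theorem exists_forall_integral_norm_smul_sub_le {f : Coord n → ℝ} {p q : Coord n} {r a : ℝ}
    (hr : 0 < r) (hf : DifferentiableAt ℝ f q) (hq : f q = 0)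
    (hball : ∀ z ∈ G.ccBall p r, f z < 0) (ha : 0 < a)
    (hℓa : ‖G.momentumH (fderiv ℝ (fun z => f (G.mul z q)) 0) q‖ = a) {δ : ℝ} (hδ : 0 < δ) :
    ∃ ε₀ > 0, ∀ ε, 0 < ε → ε < ε₀ → ∀ γ u, G.IsNearlyMinimizing p q r ε γ u →
      ∫ t in (0 : ℝ)..(r + ε),
        ‖a • u t - G.momentumH (fderiv ℝ (fun z => f (G.mul z q)) 0) (γ t)‖ ≤ δ := by
  have hdefect := fun {δ : ℝ} (hδ : 0 < δ) =>
    exists_forall_alignmentDefect_lt (G := G) hr hf hq hball hδ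
  generalize fderiv ℝ (fun z => f (G.mul z q)) 0 = ℓ at *
  obtain ⟨K, hK, hKmem⟩ := G.exists_isCompact_forall_trajectory_mem p 1 (r + 1)
  obtain ⟨C, hC0, hC⟩ := G.exists_forall_abs_norm_momentumH_sq_sub_le ℓ hK
  set β := Real.sqrt r with hβ
  have hβ0 : 0 < β := Real.sqrt_pos.2 hr
  obtain ⟨δ₁, hδ₁, hδ₁δ⟩ : ∃ δ₁ > 0, (r + 1) * (C * δ₁ / β + δ₁) / a + δ₁ / β ≤ δ := by
    have h1 : Tendsto (fun δ₁ : ℝ => (r + 1) * (C * δ₁ / β + δ₁) / a + δ₁ / β) (𝓝[>] 0) (𝓝 0) :=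
      (Continuous.tendsto' (by fun_prop) _ _ (by simp)).mono_left nhdsWithin_le_nhds
    obtain ⟨δ₁, h, h0⟩ := ((h1.eventually (gt_mem_nhds hδ)).and self_mem_nhdsWithin).exists
    exact ⟨δ₁, h0, h.le⟩
  obtain ⟨ε₁, hε₁, h₁⟩ := hdefect (δ := δ₁ ^ 2 / (2 * (r + 1) ^ 2)) (by positivity)
  have hsqc : Continuous fun z => ‖G.momentumH ℓ z‖ ^ 2 :=
    (G.contDiff_momentumH ℓ).continuous.norm.pow 2
  obtain ⟨ε₂, hε₂, h₂⟩ := Metric.continuousAt_iff.1 (hsqc.continuousAt (x := q)) δ₁ hδ₁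
  refine ⟨min 1 (min ε₁ ε₂), by positivity, fun ε hε hεlt γ u hγ => ?_⟩
  have hε1 : ε < 1 := hεlt.trans_le (min_le_left _ _)
  have hdef := h₁ ε hε (hεlt.trans_le ((min_le_right _ _).trans (min_le_left _ _))) γ u hγ
  have hgend := @h₂ (γ (r + ε)) (by
    rw [dist_eq_norm]
    exact hγ.norm_sub_le.trans_lt (hεlt.trans_le ((min_le_right _ _).trans (min_le_right _ _))))
  obtain ⟨R, hR⟩ : ∃ R, R = r + ε := ⟨_, rfl⟩
  have htraj : G.IsTrajectory γ u R := hR ▸ hγ.isTrajectory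
  have huc : ContinuousOn u (Icc 0 R) := hR ▸ hγ.contDiffOn.continuousOn
  rw [← hR] at hdef hgend ⊢
  have hR0 : 0 < R := by linarith
  have hRQ : R ≤ r + 1 := by linarith
  have hγK : ∀ t ∈ Icc 0 R, γ t ∈ K := hKmem R γ u hRQ htraj.isRightTrajectory
    hγ.apply_zero fun t _ => hγ.norm_le_one t
  have hu1 := hγ.norm_le_one
  rw [Real.dist_eq, hℓa] at hgend
  have he2 := sq_integral_norm_smul_sub_smul_le (G := G) (ℓ := ℓ) hR0 htraj.continuousOn huc hu1
  have hgconst := hC R (G.momentumNorm ℓ γ R) (Real.sqrt R) γ u hR0 (Real.sqrt_pos.2 hR0) htraj huc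
    hu1 hγK
  have hA0 : 0 ≤ G.momentumNorm ℓ γ R := momentumNorm_nonneg ℓ γ R
  have hAsq := momentumNorm_sq (G := G) ℓ γ hR0.le
  have hB0 : 0 < Real.sqrt R := Real.sqrt_pos.2 hR0
  have hBB : Real.sqrt R ^ 2 = R := Real.sq_sqrt hR0.le
  have hβB : β ≤ Real.sqrt R := Real.sqrt_le_sqrt (by linarith)
  have hBQ : Real.sqrt R ≤ r + 1 := Real.sqrt_le_iff.2 ⟨by linarith, by nlinarith⟩
  generalize G.momentumNorm ℓ γ R = A at *
  generalize Real.sqrt R = B at *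
  set g : ℝ → Coord n := fun t => G.momentumH ℓ (γ t) with hg
  have hgc : ContinuousOn g (Icc 0 R) :=
    (G.contDiff_momentumH ℓ).continuous.comp_continuousOn htraj.continuousOn
  have hec : ContinuousOn (fun t => A • u t - B • g t) (Icc 0 R) :=
    (huc.const_smul A).sub (hgc.const_smul B)
  have he1 : ∫ t in (0 : ℝ)..R, ‖A • u t - B • g t‖ ≤ δ₁ := by
    refine abs_le_of_sq_le_sq' ?_ hδ₁.le |>.2
    refine he2.trans ?_
    calc 2 * R * B * G.alignmentDefect ℓ γ u R
        ≤ 2 * R * B * (δ₁ ^ 2 / (2 * (r + 1) ^ 2)) := by gcongr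
      _ ≤ 2 * (r + 1) * (r + 1) * (δ₁ ^ 2 / (2 * (r + 1) ^ 2)) := by gcongr
      _ = δ₁ ^ 2 := by field_simp
  set δ₂ := C * δ₁ / β + δ₁ with hδ₂
  have hδ₂0 : 0 < δ₂ := by positivity
  -- the length of the momentum is almost constant, and at the endpoint it is close to `a`
  have hgt : ∀ t ∈ Icc 0 R, |‖g t‖ ^ 2 - a ^ 2| ≤ δ₂ := by
    intro t ht
    have h3 : |‖g t‖ ^ 2 - ‖G.momentumH ℓ (γ R)‖ ^ 2| ≤ C * δ₁ / β := by
      rw [le_div_iff₀ hβ0]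
      calc |‖g t‖ ^ 2 - ‖G.momentumH ℓ (γ R)‖ ^ 2| * β
          ≤ |‖g t‖ ^ 2 - ‖G.momentumH ℓ (γ R)‖ ^ 2| * B := by gcongr
        _ = B * |‖g t‖ ^ 2 - ‖G.momentumH ℓ (γ R)‖ ^ 2| := mul_comm _ _
        _ ≤ _ := (hgconst t ht).trans (by gcongr)
    exact (abs_sub_le _ _ _).trans (add_le_add h3 hgend.le)
  have hA2 : |A ^ 2 - (B * a) ^ 2| ≤ B ^ 2 * δ₂ := by
    have i1 : IntervalIntegrable (fun t => ‖g t‖ ^ 2) volume 0 R :=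
      (hgc.norm.pow 2).intervalIntegrable_of_Icc hR0.le
    have h3 := intervalIntegral.norm_integral_le_of_norm_le_const (a := 0) (b := R)
      (f := fun t => ‖g t‖ ^ 2 - a ^ 2) (C := δ₂) fun t ht => by
        rw [uIoc_of_le hR0.le] at ht
        exact hgt t (Ioc_subset_Icc_self ht)
    rw [intervalIntegral.integral_sub i1 intervalIntegrable_const, intervalIntegral.integral_const,
      ← hAsq, smul_eq_mul, sub_zero, abs_of_pos hR0, Real.norm_eq_abs] at h3
    rw [mul_pow, hBB]
    linarith
  -- hence the constants `A / B` and `a` are close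
  have hAB : |B * a - A| ≤ B * δ₂ / a := by
    rw [le_div_iff₀ ha]
    refine le_of_mul_le_mul_left ?_ hB0
    calc B * (|B * a - A| * a) ≤ |B * a - A| * (A + B * a) := by
          have := abs_nonneg (B * a - A)
          nlinarith [mul_nonneg this hA0]
      _ = |A ^ 2 - (B * a) ^ 2| := by
          rw [show A ^ 2 - (B * a) ^ 2 = (A - B * a) * (A + B * a) by ring, abs_mul,
            abs_of_nonneg (by positivity : 0 ≤ A + B * a), abs_sub_comm]
      _ ≤ B * (B * δ₂) := by linarith
  have hfc : ContinuousOn (fun t => a • u t - g t) (Icc 0 R) := (huc.const_smul a).sub hgc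
  have hfin : B * ∫ t in (0 : ℝ)..R, ‖a • u t - g t‖ ≤ R * (B * δ₂ / a) + δ₁ := by
    have h3 : ∫ t in (0 : ℝ)..R, B * ‖a • u t - g t‖ ≤
        ∫ t in (0 : ℝ)..R, (B * δ₂ / a + ‖A • u t - B • g t‖) := by
      refine intervalIntegral.integral_mono_on hR0.le
        ((continuousOn_const.mul hfc.norm).intervalIntegrable_of_Icc hR0.le)
        ((continuousOn_const.add hec.norm).intervalIntegrable_of_Icc hR0.le) fun t _ => ?_
      have e : B • (a • u t - g t) = (B * a - A) • u t + (A • u t - B • g t) := by module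
      rw [← abs_of_pos hB0, ← Real.norm_eq_abs, ← norm_smul, Real.norm_eq_abs, abs_of_pos hB0, e]
      refine (norm_add_le _ _).trans ?_
      gcongr
      rw [norm_smul, Real.norm_eq_abs]
      exact (mul_le_of_le_one_right (abs_nonneg _) (hu1 t)).trans hAB
    rw [intervalIntegral.integral_const_mul, intervalIntegral.integral_add intervalIntegrable_const
      (hec.norm.intervalIntegrable_of_Icc hR0.le), intervalIntegral.integral_const, smul_eq_mul,
      sub_zero] at h3
    linarith
  have h4 : ∫ t in (0 : ℝ)..R, ‖a • u t - g t‖ ≤ R * δ₂ / a + δ₁ / B := by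
    refine le_of_mul_le_mul_left (hfin.trans_eq ?_) hB0
    field_simp
  refine h4.trans (le_trans ?_ hδ₁δ)
  gcongr

/-! ### Normal trajectories -/

/-- The trajectory whose velocity is the normalized horizontal momentum, with the opposite sign. It
exists for all times, since the length of the horizontal momentum is conserved. -/
theorem exists_normal_trajectory (G : CarnotGroup n) (ℓ : Coord n →L[ℝ] ℝ) {x : Coord n} {a T : ℝ}
    (ha : 0 < a) (hx : ‖G.momentumH ℓ x‖ = a) (hT : 0 ≤ T) :
    ∃ γ : ℝ → Coord n, G.IsTrajectory γ (fun t => (-a⁻¹) • G.momentumH ℓ (γ t)) T ∧ γ 0 = x ∧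
      ∀ t ∈ Icc 0 T, ‖G.momentumH ℓ (γ t)‖ = a := by
  obtain ⟨K, hK, hKmem⟩ := G.exists_isCompact_forall_trajectory_mem x 1 T
  have hB : ContDiff ℝ 1 fun z => (ContinuousLinearMap.toSpanSingleton ℝ
      (G.leftMap z ((-a⁻¹) • G.momentumH ℓ z)) : ℝ →L[ℝ] Coord n) := by
    have h1 : ContDiff ℝ ∞ fun z => G.leftMap z ((-a⁻¹) • G.momentumH ℓ z) :=
      G.contDiff_leftMap.clm_apply ((G.contDiff_momentumH ℓ).const_smul (-a⁻¹))
    exact (ContinuousLinearMap.toSpanSingletonCLE (𝕜 := ℝ)).contDiff.comp (h1.of_le (WithTop.coe_le_coe.2 le_top))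
  obtain ⟨χ, γ, hχ, hχK, hχc, h0, hγ⟩ := exists_cutoff_solution hB hT
    (c := fun _ => (1 : ℝ)) continuousOn_const hK x
  have htraj : G.IsTrajectory γ (fun t => (χ (γ t) * -a⁻¹) • G.momentumH ℓ (γ t)) T := by
    intro t ht
    have := hγ t ht
    rw [ContinuousLinearMap.toSpanSingleton_apply, one_smul, ← map_smul, smul_smul] at this
    exact this
  have hcons : ∀ t ∈ Icc 0 T, ‖G.momentumH ℓ (γ t)‖ = a := by
    have h1 := constant_of_has_deriv_right_zero (f := fun t => ‖G.momentumH ℓ (γ t)‖ ^ 2)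
      (a := 0) (b := T)
      (((G.contDiff_momentumH ℓ).continuous.comp_continuousOn htraj.continuousOn).norm.pow 2)
      fun t ht => by
        have h2 := G.hasDerivWithinAt_norm_momentumH_sq ℓ (htraj.isRightTrajectory.2 t ht)
        rw [← ExpLieGroup.bracketL_apply, map_smul, _root_.smul_apply,
          ExpLieGroup.bracketL_apply, ExpLieGroup.bracket_self, smul_zero, map_zero, map_zero,
          mul_zero] at h2
        exact h2
    intro t ht
    have h2 := h1 t ht
    rw [h0, hx] at h2
    exact (pow_left_inj₀ (norm_nonneg _) ha.le two_ne_zero).1 h2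
  refine ⟨γ, htraj.congr_control fun t ht => ?_, h0, hcons⟩
  have h1 := hKmem T γ _ le_rfl htraj.isRightTrajectory h0 (fun t ht => by
    rw [norm_smul, hcons t ⟨ht.1, ht.2.le⟩, norm_mul, norm_neg, norm_inv, Real.norm_of_nonneg ha.le,
      Real.norm_of_nonneg (hχ _).1, _root_.mul_assoc, inv_mul_cancel₀ ha.ne', mul_one]
    exact (hχ _).2) t ht
  rw [hχK _ h1, one_mul]

/-- The normal trajectory issued from the contact point reaches the centre of the ball: it is the
uniform limit of the reversed nearly minimizing trajectories. -/
theorem normal_trajectory_apply_eq {f : Coord n → ℝ} {p q : Coord n} {r a : ℝ}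
    (hr : 0 < r) (hf : DifferentiableAt ℝ f q) (hq : f q = 0)
    (hball : ∀ z ∈ G.ccBall p r, f z < 0) (hpq : p ≠ q)
    (hd : G.ccDist p q ≤ ENNReal.ofReal r) (ha : 0 < a)
    (hℓa : ‖G.momentumH (fderiv ℝ (fun z => f (G.mul z q)) 0) q‖ = a) {γ : ℝ → Coord n}
    (hγ : G.IsTrajectory γ
      (fun t => (-a⁻¹) • G.momentumH (fderiv ℝ (fun z => f (G.mul z q)) 0) (γ t)) r)
    (h0 : γ 0 = q) : γ r = p := by
  have hconv := fun {δ : ℝ} (hδ : 0 < δ) =>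
    exists_forall_integral_norm_smul_sub_le (G := G) hr hf hq hball ha hℓa hδ
  generalize fderiv ℝ (fun z => f (G.mul z q)) 0 = ℓ at *
  obtain ⟨K, hK, hKmem⟩ := G.exists_isCompact_forall_trajectory_mem p 1 (r + 1)
  have hK' : IsCompact (K ∪ γ '' Icc 0 r) :=
    hK.union (isCompact_Icc.image_of_continuousOn hγ.continuousOn)
  obtain ⟨ρ, hρ⟩ := hK'.isBounded.subset_closedBall (0 : Coord n)
  -- the normal field and its Lipschitz constant
  set V : Coord n → Coord n := fun z => G.leftMap z ((-a⁻¹) • G.momentumH ℓ z) with hV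
  have hVs : ContDiff ℝ ∞ V :=
    G.contDiff_leftMap.clm_apply ((G.contDiff_momentumH ℓ).const_smul (-a⁻¹))
  obtain ⟨L, hL⟩ := (hVs.contDiffOn (s := Metric.closedBall 0 ρ)).exists_lipschitzOnWith (by simp)
    (convex_closedBall _ _) (isCompact_closedBall _ _)
  obtain ⟨C₀, hC₀⟩ := hK.exists_bound_of_continuousOn G.contDiff_leftMap.continuous.continuousOn
  set C := |C₀| with hCdef
  have hC : ∀ z ∈ K, ‖G.leftMap z‖ ≤ C := fun z hz => (hC₀ z hz).trans (le_abs_self _)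
  have hC0 : 0 ≤ C := abs_nonneg _
  clear_value C
  have main : ∀ δ > 0, ∃ ε₀ > 0, ∀ ε, 0 < ε → ε < ε₀ →
      ‖γ r - p‖ ≤ Real.exp (L * r) * (ε + C * a⁻¹ * δ) + C * ε := by
    intro δ hδ
    obtain ⟨ε₁, hε₁, h₁⟩ := hconv hδ
    refine ⟨min 1 ε₁, by positivity, fun ε hε hεlt => ?_⟩
    have hε1 : ε < 1 := hεlt.trans_le (min_le_left _ _)
    -- `α` runs from `p` to `q`, so its reversal starts, like `γ`, near `q`
    obtain ⟨α, u, g1, g2, g3, g4, g5, g6⟩ := G.exists_nearly_minimizing hr hpq hd hε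
    have hint := h₁ ε hε (hεlt.trans_le (min_le_right _ _)) α u ⟨g1, g2, g3, g4, g5, g6⟩
    have hαK : ∀ t ∈ Icc 0 (r + ε), α t ∈ K := hKmem _ α u (by linarith) g1.isRightTrajectory
      g5 fun t _ => g4 t
    obtain ⟨R, hR⟩ : ∃ R, R = r + ε := ⟨_, rfl⟩
    rw [← hR] at g1 g2 g6 hint hαK
    have hrR : r ≤ R := by linarith
    have hmem : ∀ t ∈ Icc 0 r, R - t ∈ Icc 0 R := fun t ht =>
      ⟨by linarith [ht.2], by linarith [ht.1]⟩
    set e : ℝ → ℝ := fun t => ‖a • u t - G.momentumH ℓ (α t)‖ with he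
    have hec : ContinuousOn e (Icc 0 R) := ((g2.continuousOn.const_smul a).sub
      ((G.contDiff_momentumH ℓ).continuous.comp_continuousOn g1.continuousOn)).norm
    have herc : ContinuousOn (fun t => C * a⁻¹ * e (R - t)) (Icc 0 r) :=
      continuousOn_const.mul (hec.comp (by fun_prop) hmem)
    have hrc : ContinuousOn (fun t => α (R - t)) (Icc 0 r) :=
      g1.continuousOn.comp (by fun_prop) hmem
    have hrd : ∀ t ∈ Ico 0 r, HasDerivWithinAt (fun t => α (R - t))
        (-(G.leftField (u (R - t)) (α (R - t)))) (Ici t) t := by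
      intro t ht
      have h2 := g1 (R - t) (hmem t (Ico_subset_Icc_self ht))
      have h3 : HasDerivWithinAt (fun t => R - t) (-1) (Icc t r) t := by
        simpa using (hasDerivWithinAt_id t (Icc t r)).const_sub R
      have h4 := HasDerivWithinAt.scomp t h2 h3
        fun s hs => hmem s ⟨ht.1.trans hs.1, hs.2⟩
      rw [neg_one_smul] at h4
      exact h4.mono_of_mem_nhdsWithin (Icc_mem_nhdsGE ht.2)
    have hbi : ∫ t in (0 : ℝ)..r, C * a⁻¹ * e (R - t) ≤ C * a⁻¹ * δ := by
      rw [intervalIntegral.integral_const_mul, intervalIntegral.integral_comp_sub_left]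
      gcongr
      refine le_trans ?_ hint
      refine intervalIntegral.integral_mono_interval (by linarith) (by linarith) (by linarith) ?_
        (hec.intervalIntegrable_of_Icc (hr.le.trans hrR))
      exact Eventually.of_forall fun s => norm_nonneg _
    have hint0 : IntervalIntegrable (fun t => C * a⁻¹ * e (R - t)) volume 0 r :=
      herc.intervalIntegrable_of_Icc hr.le
    have ha' : 0 < a⁻¹ := inv_pos.2 ha
    have hgron := norm_le_exp_mul_of_norm_deriv_right_le (L := L) (δ := ε)
      (d := fun t => α (R - t) - γ t)
      (d' := fun t => -(G.leftField (u (R - t)) (α (R - t))) - V (γ t))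
      (ρ := Real.exp (L * r) * (ε + ∫ s in (0 : ℝ)..r, C * a⁻¹ * e (R - s)) + 1)
      (hrc.sub hγ.continuousOn)
      (fun t ht => (hrd t ht).sub (hγ.isRightTrajectory.2 t ht)) hint0
      (fun t ht => mul_nonneg (mul_nonneg hC0 ha'.le) (norm_nonneg _))
      (fun t ht => (herc t (Ico_subset_Icc_self ht)).mono_of_mem_nhdsWithin
        (mem_of_superset (Icc_mem_nhdsGE ht.2) (Icc_subset_Icc_left ht.1)))
      L.2 (by simpa [h0] using g6) ?_ (by linarith) r ⟨hr.le, le_rfl⟩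
    · have hend : ‖α (R - r) - p‖ ≤ C * ε := by
        have h2 := norm_image_sub_le_of_norm_deriv_right_le_segment (f := α) (a := 0) (b := R)
          (C := C) g1.continuousOn g1.isRightTrajectory.2 (fun t ht => ?_) (R - r)
          (hmem r ⟨hr.le, le_rfl⟩)
        · rw [g5, sub_zero] at h2
          exact h2.trans_eq (by rw [hR]; ring)
        · exact ((G.leftMap (α t)).le_opNorm _).trans ((mul_le_mul (hC _ (hαK t
            (Ico_subset_Icc_self ht))) (g4 t) (norm_nonneg _) hC0).trans_eq (mul_one C))
      have h3 : γ r - p = (α (R - r) - p) - (α (R - r) - γ r) := by abel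
      rw [h3]
      refine (norm_sub_le _ _).trans ?_
      have h4 : Real.exp (L * r) * (ε + ∫ s in (0 : ℝ)..r, C * a⁻¹ * e (R - s)) ≤
          Real.exp (L * r) * (ε + C * a⁻¹ * δ) := by gcongr
      linarith
    · intro t ht _
      have hαt := hαK _ (hmem t (Ico_subset_Icc_self ht))
      -- the reversed trajectory solves the equation of `V` up to the alignment error
      have e1 : -(G.leftField (u (R - t)) (α (R - t))) - V (γ t) = (V (α (R - t)) - V (γ t)) -
          G.leftMap (α (R - t)) (a⁻¹ • (a • u (R - t) - G.momentumH ℓ (α (R - t)))) := by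
        rw [smul_sub, smul_smul, inv_mul_cancel₀ ha.ne', one_smul, map_sub]
        simp only [hV, neg_smul, map_neg]
        change -(G.leftMap _ _) - _ = _
        abel
      rw [e1]
      refine (norm_sub_le _ _).trans (add_le_add ?_ ?_)
      · exact hL.norm_sub_le (hρ (Or.inl hαt)) (hρ (Or.inr ⟨t, Ico_subset_Icc_self ht, rfl⟩))
      · refine ((G.leftMap _).le_opNorm _).trans ?_
        rw [norm_smul, Real.norm_of_nonneg ha'.le, _root_.mul_assoc]
        exact mul_le_mul_of_nonneg_right (hC _ hαt) (by positivity)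
  have h5 : ∀ δ > 0, ‖γ r - p‖ ≤ Real.exp (L * r) * (C * a⁻¹ * δ) := by
    intro δ hδ
    obtain ⟨ε₀, hε₀, h⟩ := main δ hδ
    have h6 : Tendsto (fun ε : ℝ => Real.exp (L * r) * (ε + C * a⁻¹ * δ) + C * ε) (𝓝[>] 0)
        (𝓝 (Real.exp (L * r) * (C * a⁻¹ * δ))) :=
      (Continuous.tendsto' (by fun_prop) _ _ (by simp)).mono_left nhdsWithin_le_nhds
    refine ge_of_tendsto h6 ?_
    filter_upwards [Ioo_mem_nhdsGT hε₀] with ε hε using h ε hε.1 hε.2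
  have h7 : Tendsto (fun δ : ℝ => Real.exp (L * r) * (C * a⁻¹ * δ)) (𝓝[>] 0) (𝓝 0) :=
    (Continuous.tendsto' (by fun_prop) _ _ (by simp)).mono_left nhdsWithin_le_nhds
  have h8 := ge_of_tendsto h7 (by filter_upwards [self_mem_nhdsWithin] with δ hδ using h5 δ hδ)
  exact sub_eq_zero.1 (norm_le_zero_iff.1 h8)

/-! ### The normal geodesic equations -/

theorem apply_eq_zero_of_mem_gradedLayer {ord : Fin n → ℕ} {j : ℕ} {v : Coord n}
    (hv : v ∈ gradedLayer ord j) {i : Fin n} (hi : ord i ≠ j) : v i = 0 := by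
  rw [gradedLayer] at hv
  induction hv using Submodule.span_induction with
  | mem v hv =>
    obtain ⟨k, hk, rfl⟩ := hv
    have : i ≠ k := fun h => hi (h ▸ hk)
    simp [this]
  | zero => rfl
  | add v w _ _ h1 h2 => simp [h1, h2]
  | smul c v _ h => simp [h]

/-- Brackets with horizontal vectors are vertical. -/
theorem structConst_eq_zero {R I J : Fin n} (hR : G.ord R = 1) (hJ : G.ord J = 1) :
    G.structConst R I J = 0 := by
  have h1 : G.bracket (EuclideanSpace.single J 1) (EuclideanSpace.single I 1) ∈
      gradedLayer G.ord (G.ord I + 1) := by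
    rw [← G.stratified _ (G.one_le_ord I)]
    exact Submodule.subset_span ⟨_, Submodule.subset_span ⟨J, hJ, rfl⟩, _,
      Submodule.subset_span ⟨I, rfl, rfl⟩, rfl⟩
  have h2 := apply_eq_zero_of_mem_gradedLayer h1 (i := R) (by have := G.one_le_ord I; omega)
  rw [structConst, ExpLieGroup.bracket_swap, PiLp.neg_apply, h2, neg_zero]

/-- Invariant form of the right-hand side of the momentum equation: for horizontal `u`, the vector
`- C(P_V) u` has the components `⟨[u, X_I], P⟩`. -/
theorem neg_vertMatrix_mulVec_apply (P : Coord n) {u : Coord n} (hu : G.projH u = u) (I : Fin n) :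
    (-((G.vertMatrix P).mulVec u.ofLp)) I =
      inner ℝ (G.bracket u (EuclideanSpace.single I 1)) P := by
  have e : G.bracket u (EuclideanSpace.single I 1) =
      -∑ J, u J • G.bracket (EuclideanSpace.single I 1) (EuclideanSpace.single J 1) := by
    rw [ExpLieGroup.bracket_swap, ← ExpLieGroup.bracketL_apply]
    conv_lhs => rw [eq_sum_smul_single u, map_sum]
    simp only [map_smul, ExpLieGroup.bracketL_apply]
  rw [e, inner_neg_left, sum_inner]
  simp only [Pi.neg_apply, Matrix.mulVec, dotProduct, vertMatrix, Matrix.of_apply]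
  congr 1
  refine Finset.sum_congr rfl fun J _ => ?_
  rw [real_inner_smul_left, mul_comm, PiLp.inner_apply]
  by_cases hJ : G.ord J = 1
  · congr 1
    rw [Finset.sum_filter]
    refine Finset.sum_congr rfl fun α _ => ?_
    by_cases hα : G.ord α = 1
    · have h := structConst_eq_zero (I := I) hα hJ
      rw [structConst] at h
      simp [hα, h]
    · simp [hα, structConst]
  · have : u J = 0 := by rw [← hu, projH_apply, if_neg hJ]
    simp [this]

/-- A curve whose velocity is a multiple of its horizontal momentum is a normal geodesic. -/
theorem isNormalSolution_of_isTrajectory {ℓ : Coord n →L[ℝ] ℝ} {γ : ℝ → Coord n} {c r : ℝ}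
    (hγ : G.IsTrajectory γ (fun t => c • G.momentumH ℓ (γ t)) r) :
    G.IsNormalSolution (γ 0) (c • G.momentum ℓ (γ 0)) r γ (fun t => c • G.momentum ℓ (γ t)) := by
  refine ⟨rfl, rfl, fun t ht => ?_⟩
  have hP : G.projH (c • G.momentum ℓ (γ t)) = c • G.momentumH ℓ (γ t) := G.projH_smul _ _
  rw [hP]
  refine ⟨hγ t ht, ?_⟩
  refine ((G.hasDerivWithinAt_momentum ℓ (hγ t ht)).const_smul c).congr_deriv ?_
  ext I
  have h1 := neg_vertMatrix_mulVec_apply (G := G) (c • G.momentum ℓ (γ t))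
    (u := c • G.momentumH ℓ (γ t)) (by rw [projH_smul, projH_momentumH]) I
  rw [inner_smul_right, ExpLieGroup.inner_momentum] at h1
  exact h1.symm

/-- The vector field on the phase space whose integral curves are the solutions of the normal
geodesic equations. -/
def normalField (G : CarnotGroup n) (z : Coord n × Coord n) : Coord n × Coord n :=
  (G.leftField (G.projH z.2) z.1, WithLp.toLp 2 (-((G.vertMatrix z.2).mulVec (G.projH z.2).ofLp)))

theorem contDiff_normalField : ContDiff ℝ 1 G.normalField := by
  have hp : ContDiff ℝ 1 fun z : Coord n × Coord n => G.projH z.2 :=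
    (G.contDiff_projH.of_le (WithTop.coe_le_coe.2 le_top)).comp contDiff_snd
  refine ContDiff.prodMk ?_ ?_
  · exact ((G.contDiff_leftMap.of_le (WithTop.coe_le_coe.2 le_top)).comp contDiff_fst).clm_apply hp
  · refine contDiff_euclidean.2 fun I => ?_
    simp only [Pi.neg_apply, Matrix.mulVec, dotProduct, vertMatrix, Matrix.of_apply]
    refine (ContDiff.sum fun J _ => ContDiff.mul (ContDiff.sum fun α _ => ?_) ?_).neg
    · exact (contDiff_euclidean.1 contDiff_snd α).mul contDiff_const
    · exact contDiff_euclidean.1 hp J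

theorem IsNormalSolution.hasDerivWithinAt {x₀ P₀ : Coord n} {r : ℝ} {γ P : ℝ → Coord n}
    (h : G.IsNormalSolution x₀ P₀ r γ P) {t : ℝ} (ht : t ∈ Icc 0 r) :
    HasDerivWithinAt (fun t => (γ t, P t)) (G.normalField (γ t, P t)) (Icc 0 r) t :=
  (h.2.2 t ht).1.prodMk (h.2.2 t ht).2

theorem IsNormalSolution.mono {x₀ P₀ : Coord n} {r s : ℝ} {γ P : ℝ → Coord n}
    (h : G.IsNormalSolution x₀ P₀ r γ P) (hs : s ≤ r) : G.IsNormalSolution x₀ P₀ s γ P :=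
  ⟨h.1, h.2.1, fun t ht =>
    have h1 := h.2.2 t ⟨ht.1, ht.2.trans hs⟩
    ⟨h1.1.mono (Icc_subset_Icc_right hs), h1.2.mono (Icc_subset_Icc_right hs)⟩⟩

theorem IsNormalSolution.eq {x₀ P₀ : Coord n} {r : ℝ} {γ P α Q : ℝ → Coord n}
    (h : G.IsNormalSolution x₀ P₀ r γ P) (h' : G.IsNormalSolution x₀ P₀ r α Q) {t : ℝ}
    (ht : t ∈ Icc 0 r) : γ t = α t := by
  have hc : ContinuousOn (fun t => (γ t, P t)) (Icc 0 r) :=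
    fun t ht => (h.hasDerivWithinAt ht).continuousWithinAt
  have hc' : ContinuousOn (fun t => (α t, Q t)) (Icc 0 r) :=
    fun t ht => (h'.hasDerivWithinAt ht).continuousWithinAt
  obtain ⟨ρ, hρ⟩ := ((isCompact_Icc.image_of_continuousOn hc).union
    (isCompact_Icc.image_of_continuousOn hc')).isBounded.subset_closedBall 0
  obtain ⟨L, hL⟩ := (G.contDiff_normalField.contDiffOn
    (s := Metric.closedBall 0 ρ)).exists_lipschitzOnWith one_ne_zero
    (convex_closedBall _ _) (isCompact_closedBall _ _)
  have hnhds : ∀ t ∈ Ico 0 r, Icc 0 r ∈ 𝓝[≥] t := fun t ht =>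
    mem_of_superset (Icc_mem_nhdsGE ht.2) (Icc_subset_Icc_left ht.1)
  have huniq := ODE_solution_unique_of_mem_Icc_right (v := fun _ => G.normalField)
    (s := fun _ => Metric.closedBall 0 ρ) (fun _ _ => hL) hc
    (fun t ht => (h.hasDerivWithinAt (Ico_subset_Icc_self ht)).mono_of_mem_nhdsWithin (hnhds t ht))
    (fun t ht => hρ (Or.inl ⟨t, Ico_subset_Icc_self ht, rfl⟩)) hc'
    (fun t ht => (h'.hasDerivWithinAt (Ico_subset_Icc_self ht)).mono_of_mem_nhdsWithin (hnhds t ht))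
    (fun t ht => hρ (Or.inr ⟨t, Ico_subset_Icc_self ht, rfl⟩))
    (by simp only [h.1, h.2.1, h'.1, h'.2.1])
  exact congrArg Prod.fst (huniq ht)

theorem IsNormalSolution.expSR_eq {x₀ P₀ : Coord n} {r : ℝ} {γ P : ℝ → Coord n}
    (h : G.IsNormalSolution x₀ P₀ r γ P) {t : ℝ} (ht : t ∈ Icc 0 r) :
    G.expSR x₀ P₀ t = γ t := by
  have hex : ∃ γ : ℝ → Coord n, G.IsNormalGeodesic x₀ P₀ t γ := ⟨γ, P, h.mono ht.2⟩
  rw [expSR, dif_pos hex]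
  obtain ⟨Q, hQ⟩ := hex.choose_spec
  exact hQ.eq (h.mono ht.2) ⟨ht.1, le_rfl⟩

theorem IsNormalSolution.isNormalGeodesic_expSR {x₀ P₀ : Coord n} {r : ℝ} {γ P : ℝ → Coord n}
    (h : G.IsNormalSolution x₀ P₀ r γ P) (hr : 0 ≤ r) :
    G.IsNormalGeodesic x₀ P₀ r (G.expSR x₀ P₀) := by
  refine ⟨P, (h.expSR_eq ⟨le_rfl, hr⟩).trans h.1, h.2.1, fun t ht => ⟨?_, (h.2.2 t ht).2⟩⟩
  rw [h.expSR_eq ht]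
  exact (h.2.2 t ht).1.congr (fun s hs => h.expSR_eq hs) (h.expSR_eq ht)

/-! ### The metric normal -/

theorem ccDist_self (p : Coord n) : G.ccDist p p = 0 := by
  have h : G.IsTrajectory (fun _ => p) (fun _ => 0) 0 := fun t _ => by
    rw [ExpLieGroup.leftField_eq, map_zero]
    exact hasDerivWithinAt_const _ _ _
  have h1 := ccDist_le_of_isTrajectory le_rfl h contDiffOn_const fun t _ => G.projHL.map_zero
  simpa using h1

/-- A unit speed horizontal curve of length `r` from a point `x` of `S` to the centre of a ball of
radius `r` whose interior does not meet `S` lies in the metric normal. -/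
theorem mem_metricNormal_of_isTrajectory {S : Set (Coord n)} {r : ℝ} {γ u : ℝ → Coord n}
    (hγ : G.IsTrajectory γ u r) (hu : ContDiffOn ℝ ∞ u (Icc 0 r))
    (hH : ∀ t ∈ Icc 0 r, G.projH (u t) = u t) (h1 : ∀ t ∈ Icc 0 r, ‖u t‖ = 1)
    (h0 : γ 0 ∈ S) (hS : ∀ w ∈ S, ENNReal.ofReal r ≤ G.ccDist (γ r) w) {t : ℝ}
    (ht : t ∈ Icc 0 r) : γ t ∈ G.metricNormal S (γ 0) := by
  have hsub : Icc 0 t ⊆ Icc 0 r := Icc_subset_Icc_right ht.2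
  have hle : G.ccDist (γ 0) (γ t) ≤ ENNReal.ofReal t := by
    have h2 := ccDist_le_of_isTrajectory ht.1 (hγ.mono ht.2) (hu.mono hsub)
      fun s hs => hH s (hsub hs)
    rwa [intervalIntegral.integral_congr (g := fun _ => (1 : ℝ)) fun s hs => by
      rw [uIcc_of_le ht.1] at hs; exact h1 s (hsub hs), intervalIntegral.integral_const, sub_zero,
      smul_eq_mul, mul_one] at h2
  refine le_antisymm (le_iInf₂ fun w hw => hle.trans ?_) (iInf₂_le _ h0)
  have hmaps : ∀ s ∈ Icc 0 (r - t), t + s ∈ Icc 0 r := fun s hs =>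
    ⟨by linarith [ht.1, hs.1], by linarith [hs.2]⟩
  have hshift : G.IsTrajectory (fun s => γ (t + s)) (fun s => u (t + s)) (r - t) := by
    intro s hs
    have h3 : HasDerivWithinAt (fun s => t + s) 1 (Icc 0 (r - t)) s :=
      (hasDerivWithinAt_id s _).const_add t
    have h4 := HasDerivWithinAt.scomp s (hγ (t + s) (hmaps s hs)) h3 hmaps
    rwa [one_smul] at h4
  have h2 := ccDist_le_ccDist_add (sub_nonneg.2 ht.2) hshift
    (hu.comp (contDiffOn_const.add contDiffOn_id) hmaps) (fun s hs => hH _ (hmaps s hs)) w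
  rw [intervalIntegral.integral_congr (g := fun _ => (1 : ℝ)) fun s hs => by
      rw [uIcc_of_le (sub_nonneg.2 ht.2)] at hs; exact h1 _ (hmaps s hs),
    intervalIntegral.integral_const, sub_zero, smul_eq_mul, mul_one, add_sub_cancel, add_zero,
    ccDist_comm w (γ r)] at h2
  have h3 := (hS w hw).trans h2
  rwa [← add_sub_cancel t r, ENNReal.ofReal_add ht.1 (sub_nonneg.2 ht.2),
    add_sub_cancel, ENNReal.add_le_add_iff_right ENNReal.ofReal_ne_top] at h3

/-! ### The momentum at the contact point -/

/-- The covector at the identity obtained by right translation of `df_x` has momentum `grad f(x)` at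
`x`. -/
theorem momentum_fderiv_eq_grad {f : Coord n → ℝ} {x : Coord n} (hf : DifferentiableAt ℝ f x) :
    G.momentum (fderiv ℝ (fun z => f (G.mul z x)) 0) x = G.grad f x := by
  ext I
  rw [ExpLieGroup.momentum_apply]
  have hf' : DifferentiableAt ℝ f (G.mul 0 x) := by rwa [G.zero_mul]
  have h1 := fderiv_comp (0 : Coord n) hf' (G.differentiableAt_mul_left x 0)
  have h2 := G.fderiv_mul_left_leftField 0 x (G.Ad x (EuclideanSpace.single I 1))
  rw [← ExpLieGroup.Ad_mul, G.neg_mul, ExpLieGroup.Ad_zero, ExpLieGroup.leftField_zero,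
    G.zero_mul] at h2
  change fderiv ℝ (f ∘ fun z => G.mul z x) 0 _ = _
  rw [h1, ContinuousLinearMap.comp_apply, h2, G.zero_mul]
  rfl

theorem projH_grad_ne_zero {f : Coord n → ℝ} {x : Coord n} (hx : ¬ G.IsCharacteristic f x) :
    G.projH (G.grad f x) ≠ 0 := by
  contrapose! hx
  intro v hv
  rw [horizontal] at hv
  induction hv using Submodule.span_induction with
  | mem v hv =>
    obtain ⟨i, hi, rfl⟩ := hv
    have h1 : G.projH (G.grad f x) i = 0 := by rw [hx]; rfl
    rwa [projH_apply, if_pos hi] at h1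
  | zero => exact map_zero _
  | add v w _ _ h1 h2 => rw [map_add, h1, h2, add_zero]
  | smul c v _ h => rw [map_smul, h, smul_zero]

theorem normalN_eq {f : Coord n → ℝ} {x : Coord n} (hx : G.projH (G.grad f x) ≠ 0) :
    G.normalN f x = ‖G.projH (G.grad f x)‖⁻¹ • G.grad f x := by
  have h1 : ‖G.grad f x‖ ≠ 0 := fun h => hx (norm_le_zero_iff.1 (h ▸ G.norm_projH_le _))
  rw [normalN, unitNormal, projH_smul, norm_smul, norm_inv, norm_norm, mul_inv, inv_inv, smul_smul]
  congr 1
  field_simp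

theorem normalN_neg (f : Coord n → ℝ) (x : Coord n) :
    G.normalN (fun z => -f z) x = -G.normalN f x := by
  have h : G.grad (fun z => -f z) x = -G.grad f x := by
    ext I
    change fderiv ℝ (fun z => -f z) x _ = -(fderiv ℝ f x _)
    rw [fderiv_fun_neg]
    rfl
  rw [normalN, normalN, unitNormal, unitNormal, h, norm_neg, smul_neg, projH_neg, norm_neg, smul_neg]

theorem isCharacteristic_neg {f : Coord n → ℝ} {x : Coord n} :
    G.IsCharacteristic (fun z => -f z) x ↔ G.IsCharacteristic f x := by
  simp only [IsCharacteristic, fderiv_fun_neg, _root_.neg_apply, neg_eq_zero]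

/-- If a ball about `y` contained in `{f < 0}` touches `{f = 0}` at a non-characteristic point `x`,
then the normal geodesic from `x` runs within the metric normal to the centre `y`. -/
theorem exists_isNormalSolution {f : Coord n → ℝ} {x y : Coord n} {r : ℝ} (hr : 0 < r)
    (hf : DifferentiableAt ℝ f x) (hball : ∀ z ∈ G.ccBall y r, f z < 0)
    (hd : G.ccDist y x ≤ ENNReal.ofReal r) (hx0 : f x = 0) (hx : ¬ G.IsCharacteristic f x) :
    ∃ γ P : ℝ → Coord n, G.IsNormalSolution x (-G.normalN f x) r γ P ∧ γ r = y ∧ y ≠ x ∧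
      ∀ t ∈ Icc 0 r, γ t ∈ G.metricNormal {z | f z = 0} x := by
  have hyx : y ≠ x := by
    rintro rfl
    have h1 := hball y (by
      rw [ccBall, Set.mem_ofPred_eq, ccDist_self]
      exact ENNReal.ofReal_pos.2 hr)
    exact h1.ne hx0
  have hg := projH_grad_ne_zero hx
  have ha : 0 < ‖G.projH (G.grad f x)‖ := norm_pos_iff.2 hg
  have hmom := G.momentum_fderiv_eq_grad hf
  have hℓa : ‖G.momentumH (fderiv ℝ (fun z => f (G.mul z x)) 0) x‖ =
      ‖G.projH (G.grad f x)‖ := by rw [momentumH, hmom]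
  have hN := normalN_eq hg
  generalize ‖G.projH (G.grad f x)‖ = a at *
  obtain ⟨γ, hγ, h0, hnorm⟩ := exists_normal_trajectory G _ ha hℓa hr.le
  have hend := normal_trajectory_apply_eq hr hf hx0 hball hyx hd ha hℓa hγ h0
  generalize fderiv ℝ (fun z => f (G.mul z x)) 0 = ℓ at *
  have hγs : ContDiffOn ℝ ∞ γ (Icc 0 r) := by
    refine ODE.contDiffOn_enat_Icc_of_hasDerivWithinAt (n := ⊤) (u := univ)
      (f := fun _ z => G.leftMap z ((-a⁻¹) • G.momentumH ℓ z)) ?_ hγ (fun _ _ => mem_univ _)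
    exact (G.contDiff_leftMap.comp_contDiffOn contDiffOn_snd).clm_apply
      (((G.contDiff_momentumH ℓ).comp_contDiffOn contDiffOn_snd).const_smul (-a⁻¹))
  have hsol := isNormalSolution_of_isTrajectory hγ
  rw [h0, hmom, neg_smul, ← hN] at hsol
  refine ⟨γ, _, hsol, hend, hyx, fun t ht => ?_⟩
  rw [← h0]
  refine mem_metricNormal_of_isTrajectory hγ
    (((G.contDiff_momentumH ℓ).comp_contDiffOn hγs).const_smul (-a⁻¹))
    (fun t _ => by rw [projH_smul, projH_momentumH]) (fun t ht => ?_) (by rw [h0]; exact hx0)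
    (fun w hw => ?_) ht
  · rw [norm_smul, hnorm t ht, norm_neg, norm_inv, Real.norm_of_nonneg ha.le,
      inv_mul_cancel₀ ha.ne']
  · rw [hend]
    by_contra! h
    exact (hball w h).ne hw

end CarnotGroup

end

theorem mainTheorem3 {n : ℕ} (G : CarnotGroup n) (f : Coord n → ℝ) (hf : ContDiff ℝ 2 f)
    (x y N : Coord n) (r : ℝ) (hr : 0 < r)
    (hside : (G.ccBall y r ⊆ {z | f z < 0} ∧ N = G.normalN f x) ∨
      (G.ccBall y r ⊆ {z | 0 < f z} ∧ N = -G.normalN f x))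
    (htouch : G.ccClosedBall y r ∩ {z | f z = 0} = {x})
    (hx : ¬ G.IsCharacteristic f x) :
    G.IsNormalGeodesic x (-N) r (G.expSR x (-N)) ∧
      G.expSR x (-N) r = y ∧
      (G.metricNormal {z | f z = 0} x).Nontrivial ∧
      ∀ t ∈ Set.Icc (0 : ℝ) r, G.expSR x (-N) t ∈ G.metricNormal {z | f z = 0} x := by
  obtain ⟨hd, hx0⟩ : x ∈ G.ccClosedBall y r ∩ {z | f z = 0} := htouch ▸ Set.mem_singleton x
  have hdiff : DifferentiableAt ℝ f x := hf.differentiable two_ne_zero x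
  obtain ⟨γ, P, hsol, hend, hyx, hmem⟩ : ∃ γ P : ℝ → Coord n,
      G.IsNormalSolution x (-N) r γ P ∧ γ r = y ∧ y ≠ x ∧
        ∀ t ∈ Set.Icc 0 r, γ t ∈ G.metricNormal {z | f z = 0} x := by
    rcases hside with ⟨hball, rfl⟩ | ⟨hball, rfl⟩
    · exact CarnotGroup.exists_isNormalSolution hr hdiff hball hd hx0 hx
    · have h := CarnotGroup.exists_isNormalSolution (f := fun z => -f z) hr hdiff.fun_neg
        (fun z hz => neg_neg_of_pos (hball hz)) hd (neg_eq_zero.2 hx0)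
        (CarnotGroup.isCharacteristic_neg.not.2 hx)
      simpa only [CarnotGroup.normalN_neg, neg_eq_zero] using h
  have hmem' : ∀ t ∈ Set.Icc 0 r, G.expSR x (-N) t ∈ G.metricNormal {z | f z = 0} x :=
    fun t ht => by rw [hsol.expSR_eq ht]; exact hmem t ht
  refine ⟨hsol.isNormalGeodesic_expSR hr.le, (hsol.expSR_eq ⟨hr.le, le_rfl⟩).trans hend, ?_, hmem'⟩
  refine ⟨y, ?_, x, ?_, hyx⟩
  · rw [← hend]; exact hmem r ⟨hr.le, le_rfl⟩
  · have h0 := hmem 0 ⟨le_rfl, hr.le⟩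
    rwa [hsol.1] at h0
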